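/- **Setting.** Let $N\ge 0$ and let $\eta,\xi_1,\dots,\xi_N,\varsigma_-,\kappa_-,\tau_-,\alpha,\beta\in\mathbb C$. On $\mathcal H=(\mathbb C^2)^{\otimes N}$ with an auxiliary space $\mathcal H_0=\mathbb C^2$, let $R_{12}(\lambda)\in\operatorname{End}(\mathbb C^2\otimes\mathbb C^2)$ be the six-vertex $R$-matrix: in the standard basis its diagonal is $(\sinh(\lambda+\eta),\sinh\lambda,\sinh\lambda,\sinh(\lambda+\eta))$, its two entries exchanging up–down and down–up are $\sinh\eta$, and its other entries vanish. Put $$M(\lambda)=R_{0N}(\lambda-\xi_N-\tfrac\eta2)\cdots R_{01}(\lambda-\xi_1-\tfrac\eta2),\qquad \hat M(\lambda)=(-1)^N\sigma_0^yM^{t_0}(-\lambda)\sigma_0^y,$$ $$K_-(\lambda)=\frac1{\sinh\varsigma_-}\begin{pmatrix}\sinh(\lambda-\frac\eta2+\varsigma_-)&\kappa_-e^{\tau_-}\sinh(2\lambda-\eta)\\ \kappa_-e^{-\tau_-}\sinh(2\lambda-\eta)&\sinh(\varsigma_--\lambda+\frac\eta2)\end{pmatrix},$$ and $\mathcal U_-(\lambda)=M(\lambda)K_-(\lambda)\hat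 M(\lambda)$. With $S(\lambda|\beta)=\begin{pmatrix}e^{\lambda-\eta(\beta+\alpha)}&e^{\lambda+\eta(\beta-\alpha)}\\1&1\end{pmatrix}$ and $S_{1\dots N}(\beta)=\prod_{n=N\to1}S_n\big(-\xi_n\,|\,\beta+\sum_{j>n}\sigma^z_j\big)$, define $$\widetilde{\mathcal U}_-(\lambda|\beta)=S_0^{-1}(-\lambda+\tfrac\eta2|\beta)\,\mathcal U_-(\lambda)\,S_0(\lambda-\tfrac\eta2|\beta),$$ $$\begin{pmatrix}\mathcal A_-^{\rm SOS}&\mathcal B_-^{\rm SOS}\\ \mathcal C_-^{\rm SOS}&\mathcal D_-^{\rm SOS}\end{pmatrix}(\lambda|\beta)=S_{1\dots N}^{-1}(\beta+\sigma_0^z)\,\widetilde{\mathcal U}_-(\lambda|\beta)\,S_{1\dots N}(\beta+\sigma_0^z),$$ and let $\mathsf b_-(\lambda|\beta)$ be the upper right entry of $S^{-1}(-\lambda+\frac\eta2|\beta)\,K_-(\lambda)\,S(\lambda-\frac\eta2|\beta)$. Put $a(\lambda)=\prod_n\sinh(\lambda-\xi_n+\frac\eta2)$, $d(\lambda)=\prod_n\sinh(\lambda-\xi_n-\frac\eta2)$,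 $\xi_n^{(h)}=\xi_n+\frac\eta2-h\eta$ for $h\in\{0,1\}$, $\xi^{(\mathbf h)}=(\xi_1^{(h_1)},\dots,\xi_N^{(h_N)})$, and $\widehat V(x_1,\dots,x_N)=\det_{1\le i,j\le N}[\sinh^{2(j-1)}x_i]$. **Assumptions.** $\sinh\eta\ne0$, $\sinh\varsigma_-\ne0$, $\kappa_-\neq0$, and $\alpha_-,\beta_-\in\mathbb C$ satisfy $\sinh\alpha_-\cosh\beta_-=\frac{\sinh\varsigma_-}{2\kappa_-}$ and $\cosh\alpha_-\sinh\beta_-=\frac{\cosh\varsigma_-}{2\kappa_-}$; $\sinh(\eta(\beta+m))\ne0$ for all $m\in\mathbb Z$; $\xi_j^{(h)}\pm\xi_k^{(h')}\notin i\pi\mathbb Z$ for all $j\ne k$ and $h,h'\in\{0,1\}$; and $\sinh(2\xi_j\pm\eta)\ne0$ for all $j$. The function $\mathsf g_-$ satisfies $$\mathsf g_-(\lambda+\tfrac\eta2)\,\mathsf g_-(-\lambda+\tfrac\eta2)=-\frac{(\sinh^2\lambda-\sinh^2\alpha_-)(\sinh^2\lambda+\cosh^2\beta_-)}{\sinh^2\alpha_-\cosh^2\beta_-}$$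 at $\lambda=\xi_j$, and $\mathsf g_-(\frac\eta2-\xi_j)\ne0$, for all $j$. Put $\mathsf A_-(\lambda)=\mathsf g_-(\lambda)\,a(\lambda)\,d(-\lambda)$ and $k_j=\frac{\sinh(2\xi_j+\eta)}{\sinh(2\xi_j-\eta)}$. **States.** Let $\langle0|$ be the dual reference state with all spins up and $|\underline0\rangle$ the reference state with all spins down. For $\mathbf h\in\{0,1\}^N$ let $$|\mathbf h,\beta+1\rangle=\prod_{j=1}^N\left(\frac{\mathcal D_-^{\rm SOS}(\xi_j+\frac\eta2|\beta+1)}{k_j\,\mathsf A_-(\frac\eta2-\xi_j)}\right)^{h_j}|\underline0\rangle,\qquad \langle\beta-1,\mathbf h|=\langle0|\prod_{j=1}^N\left(\frac{\mathcal A_-^{\rm SOS}(\frac\eta2-\xi_j|\beta-1)}{\mathsf A_-(\frac\eta2-\xi_j)}\right)^{1-h_j},$$ where the factors of either product may be multiplied in any order (the statements below hold for every choice of the two orders). **Claim.** Put $$N(\{\xi\},\beta)=(-1)^N\,\widehat V(\xi_1,\dots,\xi_N)\,\frac{\widehat V(\xi_1^{(0)},\dots,\xi_N^{(0)})}{\widehat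 V(\xi_1^{(1)},\dots,\xi_N^{(1)})}\prod_{j=1}^N\left[\frac{\mathsf b_-(\frac\eta2-\xi_j|\beta+1+N-2j)}{\mathsf g_-(\frac\eta2-\xi_j)}\,\frac{\sinh(\eta(\beta+1+N-2j))}{\sinh(\eta(\beta+N-j))}\right].$$ 1. For all $\mathbf h,\mathbf k\in\{0,1\}^N$, $$\langle\beta-1,\mathbf h\,|\,\mathbf k,\beta+1\rangle=\delta_{\mathbf h,\mathbf k}\,N(\{\xi\},\beta)\,\frac{e^{2\sum_{j=1}^Nh_j\xi_j}}{\widehat V(\xi^{(\mathbf h)})}.$$ 2. $$N(\{\xi\},\beta)=\widehat V(\xi_1^{(0)},\dots,\xi_N^{(0)})\;\langle0|\prod_{j=1}^N\frac{\mathcal A_-^{\rm SOS}(\frac\eta2-\xi_j|\beta-1)}{\mathsf A_-(\frac\eta2-\xi_j)}\,|\underline0\rangle.$$ 3. If moreover $\sinh(2\xi_j)\ne0$ for all $j$, then $N(\{\xi\},\beta)\ne0$ if and only if $$\sinh\big(\eta(\beta+1-\alpha+N-2j)-\tau_-\big)\ne\sinh(\alpha_-+\beta_-)\qquad\text{for all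 }j\in\{1,\dots,N\}.$$ -/

import Mathlib

open Complex Matrix

namespace XXZOpen

noncomputable section

/-- Parameters of the inhomogeneous open XXZ chain of length `N` that enter the boundary monodromy
matrix: the anisotropy `η`, the inhomogeneities `ξ`, the boundary parameters `ς`, `κ`, `τ` of the
matrix `K₋`, and the arbitrary shift `α` of the vertex-IRF gauge transformation. -/
structure Chain (N : ℕ) where
  η : ℂ
  ξ : Fin N → ℂ
  ς : ℂ
  κ : ℂ
  τ : ℂ
  α : ℂ

/-- Spin configurations, which label the standard basis of `(ℂ²)^{⊗ N}`; `0` is spin up and `1` is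
spin down. -/
abbrev Conf (N : ℕ) : Type := Fin N → Fin 2

/-- Operators on the space of states `(ℂ²)^{⊗ N}`, as matrices in the standard basis. -/
abbrev Op (N : ℕ) : Type := Matrix (Conf N) (Conf N) ℂ

/-- Operators on `ℂ² ⊗ (ℂ²)^{⊗ N}` (auxiliary space in front), as `2 × 2` block matrices. -/
abbrev AuxOp (N : ℕ) : Type := Matrix (Fin 2) (Fin 2) (Op N)

/-- Eigenvalue of `σᶻ`: `1` for up and `-1` for down. -/
def sz (s : Fin 2) : ℂ := if s = 0 then 1 else -1

/-- The operator `X` acting on the `n`-th tensor factor. -/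
def onSite {N : ℕ} (n : Fin N) (X : Matrix (Fin 2) (Fin 2) ℂ) : Op N :=
  Matrix.of fun h k => if ∀ m, m ≠ n → h m = k m then X (h n) (k n) else 0

/-- A scalar `2 × 2` matrix acting on the auxiliary space. -/
def onAux (N : ℕ) (K : Matrix (Fin 2) (Fin 2) ℂ) : AuxOp N :=
  K.map fun c => c • (1 : Op N)

/-- The six-vertex `R`-matrix on `ℂ² ⊗ ℂ²`. -/
def Rmat (η u : ℂ) : Matrix (Fin 2 × Fin 2) (Fin 2 × Fin 2) ℂ :=
  Matrix.of fun x y =>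
    if x = y then (if x.1 = x.2 then sinh (u + η) else sinh u)
    else if x = y.swap then sinh η else 0

/-- The Pauli matrix `σʸ`. -/
def pauliY : Matrix (Fin 2) (Fin 2) ℂ := !![0, -I; I, 0]

/-- The vertex-IRF gauge matrix `S(u|β)`. -/
def gaugeS (η α u β : ℂ) : Matrix (Fin 2) (Fin 2) ℂ :=
  !![exp (u - η * (β + α)), exp (u + η * (β - α)); 1, 1]

/-- `V̂(x₁,…,x_N) = det [sinh^{2(j-1)} x_i]`. -/
def vdm {N : ℕ} (x : Fin N → ℂ) : ℂ :=
  (Matrix.of fun i j : Fin N => sinh (x i) ^ (2 * (j : ℕ))).det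

namespace Chain

variable {N : ℕ} (p : Chain N)

/-- `R_{0n}(u)`. -/
def R0 (n : Fin N) (u : ℂ) : AuxOp N :=
  Matrix.of fun a b => onSite n (Matrix.of fun s t => Rmat p.η u (a, s) (b, t))

/-- The bulk monodromy matrix `M(u) = R_{0N}(u - ξ_N - η/2) ⋯ R_{01}(u - ξ_1 - η/2)`. -/
def M (u : ℂ) : AuxOp N :=
  (List.ofFn fun i : Fin N => p.R0 i.rev (u - p.ξ i.rev - p.η / 2)).prod

/-- `M̂(u) = (-1)^N σ₀ʸ M^{t₀}(-u) σ₀ʸ`; the transpose of the block matrix is the partial transpose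
in the auxiliary space. -/
def Mhat (u : ℂ) : AuxOp N :=
  (-1 : ℂ) ^ N • (onAux N pauliY * (p.M (-u)).transpose * onAux N pauliY)

/-- The boundary matrix `K₋(u)`. -/
def Kminus (u : ℂ) : Matrix (Fin 2) (Fin 2) ℂ :=
  (1 / sinh p.ς) •
    !![sinh (u - p.η / 2 + p.ς), p.κ * exp p.τ * sinh (2 * u - p.η);
       p.κ * exp (-p.τ) * sinh (2 * u - p.η), sinh (p.ς - u + p.η / 2)]

/-- The boundary monodromy matrix `U₋(u) = M(u) K₋(u) M̂(u)`. -/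
def Uminus (u : ℂ) : AuxOp N := p.M u * onAux N (p.Kminus u) * p.Mhat u

/-- The local factor `S_n(-ξ_n | β + ∑_{j>n} σ_jᶻ)`. -/
def gaugeSite (β : ℂ) (n : Fin N) : Op N :=
  Matrix.of fun h k =>
    if ∀ m, m ≠ n → h m = k m then
      gaugeS p.η p.α (-p.ξ n) (β + ∑ j ∈ Finset.Ioi n, sz (h j)) (h n) (k n)
    else 0

/-- `S_{1…N}({ξ}|β)`, the product of the local factors ordered from `n = N` down to `n = 1`. -/
def gaugeBulk (β : ℂ) : Op N := (List.ofFn fun i : Fin N => p.gaugeSite β i.rev).prod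

/-- `Ũ₋(u|β) = S₀⁻¹(-u + η/2|β) U₋(u) S₀(u - η/2|β)`. -/
def Utilde (u β : ℂ) : AuxOp N :=
  onAux N (gaugeS p.η p.α (-u + p.η / 2) β)⁻¹ * p.Uminus u *
    onAux N (gaugeS p.η p.α (u - p.η / 2) β)

/-- `U₋^SOS(u|β) = S_{1…N}⁻¹({ξ}|β + σ₀ᶻ) Ũ₋(u|β) S_{1…N}({ξ}|β + σ₀ᶻ)`. -/
def USOS (u β : ℂ) : AuxOp N :=
  Matrix.of fun a b =>
    (p.gaugeBulk (β + sz a))⁻¹ * p.Utilde u β a b * p.gaugeBulk (β + sz b)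

/-- `A₋^SOS(u|β)`. -/
def ASOS (u β : ℂ) : Op N := p.USOS u β 0 0

/-- `D₋^SOS(u|β)`. -/
def DSOS (u β : ℂ) : Op N := p.USOS u β 1 1

/-- `K₋^SOS(u|β) = S₀⁻¹(-u + η/2|β) K₋(u) S₀(u - η/2|β)`. -/
def KSOS (u β : ℂ) : Matrix (Fin 2) (Fin 2) ℂ :=
  (gaugeS p.η p.α (-u + p.η / 2) β)⁻¹ * p.Kminus u * gaugeS p.η p.α (u - p.η / 2) β

/-- `b₋(u|β)`, the upper right entry of `K₋^SOS(u|β)`. -/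
def bMinus (u β : ℂ) : ℂ := p.KSOS u β 0 1

/-- `a(u) = ∏ sinh(u - ξ_n + η/2)`. -/
def a (u : ℂ) : ℂ := ∏ n, sinh (u - p.ξ n + p.η / 2)

/-- `d(u) = ∏ sinh(u - ξ_n - η/2)`. -/
def d (u : ℂ) : ℂ := ∏ n, sinh (u - p.ξ n - p.η / 2)

/-- `A₋(u) = g₋(u) a(u) d(-u)`, the normalization coefficient. -/
def coefA (g : ℂ → ℂ) (u : ℂ) : ℂ := g u * p.a u * p.d (-u)

/-- `k_j = sinh(2ξ_j + η) / sinh(2ξ_j - η)`. -/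
def k (j : Fin N) : ℂ := sinh (2 * p.ξ j + p.η) / sinh (2 * p.ξ j - p.η)

/-- `ξ_n^{(h)} = ξ_n + η/2 - h η`. -/
def xiShift (n : Fin N) (h : Fin 2) : ℂ := p.ξ n + p.η / 2 - ((h : ℕ) : ℂ) * p.η

end Chain

/-- The reference state with all spins up. -/
def refUp (N : ℕ) : Conf N → ℂ := Pi.single (fun _ => 0) 1

/-- The reference state with all spins down. -/
def refDown (N : ℕ) : Conf N → ℂ := Pi.single (fun _ => 1) 1

namespace Chain

variable {N : ℕ} (p : Chain N)

/-- The right SoV state `|h, β+1⟩`. The permutation `π` fixes the order in which the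
(non-commuting) factors are multiplied. -/
def sovRight (g : ℂ → ℂ) (β : ℂ) (π : Equiv.Perm (Fin N)) (h : Conf N) : Conf N → ℂ :=
  (List.ofFn fun i : Fin N =>
    ((p.k (π i) * p.coefA g (p.η / 2 - p.ξ (π i)))⁻¹ •
      p.DSOS (p.ξ (π i) + p.η / 2) (β + 1)) ^ (h (π i) : ℕ)).prod *ᵥ refDown N

/-- The left SoV state `⟨β-1, h|`. The permutation `π` fixes the order in which the
(non-commuting) factors are multiplied. -/
def sovLeft (g : ℂ → ℂ) (β : ℂ) (π : Equiv.Perm (Fin N)) (h : Conf N) : Conf N → ℂ :=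
  refUp N ᵥ* (List.ofFn fun i : Fin N =>
    ((p.coefA g (p.η / 2 - p.ξ (π i)))⁻¹ •
      p.ASOS (p.η / 2 - p.ξ (π i)) (β - 1)) ^ (1 - (h (π i) : ℕ))).prod

/-- The explicit normalization constant `N({ξ},β)`. The `j`-th factor of the product, with
`j = 1,…,N`, is indexed by `j - 1 : Fin N`. -/
def normConst (g : ℂ → ℂ) (β : ℂ) : ℂ :=
  (-1) ^ N * vdm p.ξ *
    (vdm (fun n => p.xiShift n 0) / vdm (fun n => p.xiShift n 1)) *
    ∏ j : Fin N,
      (p.bMinus (p.η / 2 - p.ξ j) (β + 1 + N - 2 * ((j : ℕ) + 1)) / g (p.η / 2 - p.ξ j) *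
        (sinh (p.η * (β + 1 + N - 2 * ((j : ℕ) + 1))) / sinh (p.η * (β + N - ((j : ℕ) + 1)))))

end Chain

end

end XXZOpen

/-! The mechanism is the reversal of signs of inhomogeneities. Write `bnd x a u L` for the boundary
matrix with auxiliary site `a`, dressed by the sites of `L`. If a site `j` of the chain itself
serves as auxiliary site, dressed only by the sites inside it and taken at `x j + η/2`, the result
is an operator `refl x j L`. At this parameter the reflection equation says that `refl x j L`
intertwines the boundary matrices with inhomogeneities `x` and `flip x j` (`bnd_mul_refl`). Two
reversals of the same site give a scalar, and a product of reversals depends, up to a scalar, only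
on the set of sites reversed an odd number of times. It can thus be put in a normal form `sweep`,
and the scalar is 1 if no site repeats (`reflWord_eq_sweep`).

The vertex-IRF gauge turns both reference states into product states, and the vertex-IRF relations
make the R-matrices act on these by scalars and exchanges of dynamical parameters. At `η/2 - ξ_j`
and at `ξ_j + η/2` one of the R-matrices that couple the auxiliary site to site `j` has argument
zero and becomes an exchange of the two sites. Hence `A₋(η/2 - ξ_j|β-1)` and `D₋(ξ_j + η/2|β+1)`,
applied to the reference states, give an explicit scalar times a reversal of `j` applied to the
reference state with `ξ_j` reversed (`rowState_vecMul_bnd`, `bnd_mulVec_colState`). The remaining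
operators cross the reversal by the intertwining relation, so every SoV state is a product of
reversals on a reference state.

Each pairing is therefore a matrix element of a `sweep` between two reference states
(`pairing_words`). A site that is not reversed contributes the product of two orthogonal gauge
vectors. Thus every site has to be reversed, which forces equality of the two labels. In that case
the sites are stripped off one at a time, each leaving a boundary factor `kFac`
(`rowState_sweep_colState`).

This factor splits into a function of the signed inhomogeneity and a function `dynFac` of the
dynamical parameter (`kFac_eq`). The second does not see the label `h`; the first yields the
exponential. The factors attached to pairs of sites combine to Vandermonde determinants
(`vdm_quotient`). The second claim is the pairing with both labels zero, and the third follows from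
the zeros of `dynFac`. -/

namespace XXZOpen
noncomputable section

open Function

/-! ### Operators on one or two sites of a finite set of sites -/

section LocalOperators

set_option linter.unusedSectionVars false

variable {ι : Type*} [Fintype ι] [DecidableEq ι]

/-- The operator `X` acting on site `i` of an arbitrary finite set of sites. -/
def emb1 (i : ι) (X : Matrix (Fin 2) (Fin 2) ℂ) : Matrix (ι → Fin 2) (ι → Fin 2) ℂ :=
  Matrix.of fun h k => ∑ s, if k = update h i s then X (h i) s else 0

/-- The operator `X` acting on the sites `i` and `j` of an arbitrary finite set of sites. -/
def emb2 (i j : ι) (X : Matrix (Fin 2 × Fin 2) (Fin 2 × Fin 2) ℂ) :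
    Matrix (ι → Fin 2) (ι → Fin 2) ℂ :=
  Matrix.of fun h k =>
    ∑ s, ∑ t, if k = update (update h i s) j t then X (h i, h j) (s, t) else 0

/-- The exchange of two spins. -/
def swapMat : Matrix (Fin 2 × Fin 2) (Fin 2 × Fin 2) ℂ :=
  Matrix.of fun x y => if x = y.swap then 1 else 0

theorem emb1_mulVec (i : ι) (X : Matrix (Fin 2) (Fin 2) ℂ) (f : (ι → Fin 2) → ℂ)
    (h : ι → Fin 2) : (emb1 i X *ᵥ f) h = ∑ s, X (h i) s * f (update h i s) := by
  simp only [emb1, Matrix.mulVec, dotProduct, Matrix.of_apply, Finset.sum_mul]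
  rw [Finset.sum_comm]
  simp [ite_mul]

theorem emb2_mulVec (i j : ι) (X : Matrix (Fin 2 × Fin 2) (Fin 2 × Fin 2) ℂ)
    (f : (ι → Fin 2) → ℂ) (h : ι → Fin 2) :
    (emb2 i j X *ᵥ f) h =
      ∑ s, ∑ t, X (h i, h j) (s, t) * f (update (update h i s) j t) := by
  simp only [emb2, Matrix.mulVec, dotProduct, Matrix.of_apply, Finset.sum_mul]
  rw [Finset.sum_comm]
  refine Finset.sum_congr rfl fun s _ => ?_
  rw [Finset.sum_comm]
  simp [ite_mul]

/-- Operator identities are tested on vectors, where a local operator is a sum of two or four terms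
instead of a sum over all configurations. -/
theorem matrix_ext_mulVec {κ : Type*} [Fintype κ] [DecidableEq κ] {A B : Matrix κ κ ℂ}
    (h : ∀ f, A *ᵥ f = B *ᵥ f) : A = B := by
  ext i j
  have := congrFun (h (Pi.single j 1)) i
  simpa using this

theorem emb1_apply (i : ι) (X : Matrix (Fin 2) (Fin 2) ℂ) (h k : ι → Fin 2) :
    emb1 i X h k = if ∀ m, m ≠ i → h m = k m then X (h i) (k i) else 0 := by
  simp only [emb1, Matrix.of_apply]
  have key : ∀ s, k = update h i s ↔ ((∀ m, m ≠ i → h m = k m) ∧ s = k i) := by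
    intro s
    rw [eq_comm, update_eq_iff]
    tauto
  simp only [key]
  by_cases hh : ∀ m, m ≠ i → h m = k m
  · simp only [and_iff_right hh, if_pos hh]
    simp
  · simp [hh]

theorem emb2_apply {i j : ι} (hij : i ≠ j) (X : Matrix (Fin 2 × Fin 2) (Fin 2 × Fin 2) ℂ)
    (h k : ι → Fin 2) :
    emb2 i j X h k =
      if ∀ m, m ≠ i → m ≠ j → h m = k m then X (h i, h j) (k i, k j) else 0 := by
  simp only [emb2, Matrix.of_apply]
  have key : ∀ s t, k = update (update h i s) j t ↔
      ((∀ m, m ≠ i → m ≠ j → h m = k m) ∧ s = k i ∧ t = k j) := by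
    intro s t
    constructor
    · rintro rfl
      refine ⟨fun m h1 h2 => ?_, ?_, ?_⟩ <;> simp [*]
    · rintro ⟨h1, rfl, rfl⟩
      funext m
      by_cases hj : m = j
      · subst hj; simp
      · by_cases hi : m = i
        · subst hi; simp [hj]
        · simp [hi, hj, h1 m hi hj]
  simp only [key]
  by_cases hh : ∀ m, m ≠ i → m ≠ j → h m = k m
  · rw [if_pos hh, Finset.sum_eq_single (k i), Finset.sum_eq_single (k j), if_pos ⟨hh, rfl, rfl⟩]
    all_goals simp +contextual
  · simp [hh]

theorem emb1_transpose (i : ι) (X : Matrix (Fin 2) (Fin 2) ℂ) :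
    (emb1 i X)ᵀ = emb1 i Xᵀ := by
  ext h k
  simp only [Matrix.transpose_apply, emb1_apply]
  refine if_congr ?_ rfl rfl
  exact forall₂_congr fun _ _ => eq_comm

theorem emb2_transpose {i j : ι} (hij : i ≠ j) (X : Matrix (Fin 2 × Fin 2) (Fin 2 × Fin 2) ℂ) :
    (emb2 i j X)ᵀ = emb2 i j Xᵀ := by
  ext h k
  simp only [Matrix.transpose_apply, emb2_apply hij]
  refine if_congr ?_ rfl rfl
  exact forall₃_congr fun _ _ _ => eq_comm

theorem emb1_smul (i : ι) (c : ℂ) (X : Matrix (Fin 2) (Fin 2) ℂ) :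
    emb1 i (c • X) = c • emb1 i X := by
  ext h k
  simp [emb1_apply]

theorem emb2_smul {i j : ι} (hij : i ≠ j) (c : ℂ)
    (X : Matrix (Fin 2 × Fin 2) (Fin 2 × Fin 2) ℂ) : emb2 i j (c • X) = c • emb2 i j X := by
  ext h k
  simp [emb2_apply hij]

theorem emb1_one (i : ι) : emb1 i (1 : Matrix (Fin 2) (Fin 2) ℂ) = 1 := by
  refine matrix_ext_mulVec fun f => funext fun h => ?_
  rw [emb1_mulVec, Finset.sum_eq_single (h i)] <;> simp +contextual [eq_comm]

theorem emb1_mul (i : ι) (X Y : Matrix (Fin 2) (Fin 2) ℂ) :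
    emb1 i X * emb1 i Y = emb1 i (X * Y) := by
  refine matrix_ext_mulVec fun f => funext fun h => ?_
  rw [← mulVec_mulVec]
  simp only [emb1_mulVec, update_self, update_idem, Matrix.mul_apply, Finset.mul_sum,
    Finset.sum_mul]
  rw [Finset.sum_comm]
  simp [mul_assoc]

theorem emb2_swap {i j : ι} (hij : i ≠ j) (X : Matrix (Fin 2 × Fin 2) (Fin 2 × Fin 2) ℂ)
    (hX : ∀ x y, X x.swap y.swap = X x y) : emb2 i j X = emb2 j i X := by
  ext h k
  simp only [emb2_apply hij, emb2_apply hij.symm]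
  refine if_congr (forall_congr' fun _ => imp.swap) ?_ rfl
  exact (hX (h i, h j) (k i, k j)).symm

theorem emb1_commute {i j : ι} (hij : i ≠ j) (X Y : Matrix (Fin 2) (Fin 2) ℂ) :
    Commute (emb1 i X) (emb1 j Y) := by
  refine matrix_ext_mulVec fun f => funext fun h => ?_
  simp only [← mulVec_mulVec, emb1_mulVec, update_of_ne hij, update_of_ne hij.symm, Finset.mul_sum]
  rw [Finset.sum_comm]
  refine Finset.sum_congr rfl fun s _ => Finset.sum_congr rfl fun t _ => ?_
  rw [update_comm hij]
  ring

theorem emb1_emb2_commute {i j k : ι} (hij : i ≠ j) (hik : i ≠ k)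
    (X : Matrix (Fin 2) (Fin 2) ℂ) (Y : Matrix (Fin 2 × Fin 2) (Fin 2 × Fin 2) ℂ) :
    Commute (emb1 i X) (emb2 j k Y) := by
  refine matrix_ext_mulVec fun f => funext fun h => ?_
  simp only [← mulVec_mulVec, emb1_mulVec, emb2_mulVec, update_of_ne hij, update_of_ne hij.symm,
    update_of_ne hik, update_of_ne hik.symm, Finset.mul_sum]
  rw [Finset.sum_comm]
  refine Finset.sum_congr rfl fun s _ => ?_
  rw [Finset.sum_comm]
  refine Finset.sum_congr rfl fun t _ => Finset.sum_congr rfl fun r _ => ?_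
  rw [update_comm hij, update_comm hik]
  ring

theorem emb2_commute {i j k l : ι} (hik : i ≠ k) (hil : i ≠ l) (hjk : j ≠ k) (hjl : j ≠ l)
    (X Y : Matrix (Fin 2 × Fin 2) (Fin 2 × Fin 2) ℂ) :
    Commute (emb2 i j X) (emb2 k l Y) := by
  refine matrix_ext_mulVec fun f => funext fun h => ?_
  simp only [← mulVec_mulVec, emb2_mulVec, update_of_ne hik, update_of_ne hik.symm,
    update_of_ne hil, update_of_ne hil.symm, update_of_ne hjk, update_of_ne hjk.symm,
    update_of_ne hjl, update_of_ne hjl.symm, Finset.mul_sum]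
  have key : ∀ s t s' t', update (update (update (update h i s) j t) k s') l t'
      = update (update (update (update h k s') l t') i s) j t := fun s t s' t' => by
    rw [update_comm hjk, update_comm hjl, update_comm hik, update_comm hil]
  simp only [key, Fin.sum_univ_two]
  ring

/-- The values of `f` on configurations that agree with `h` off the sites `i`, `j`, `k`. -/
def slice (i j k : ι) (h : ι → Fin 2) (f : (ι → Fin 2) → ℂ) (s t r : Fin 2) : ℂ :=
  f (update (update (update h i s) j t) k r)

theorem slice_self (i j k : ι) (h : ι → Fin 2) (f : (ι → Fin 2) → ℂ) :
    slice i j k h f (h i) (h j) (h k) = f h := by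
  simp [slice]

theorem slice_emb2_12 {i j k : ι} (hij : i ≠ j) (hik : i ≠ k) (hjk : j ≠ k)
    (X : Matrix (Fin 2 × Fin 2) (Fin 2 × Fin 2) ℂ) (h f s t r) :
    slice i j k h (emb2 i j X *ᵥ f) s t r =
      ∑ s', ∑ t', X (s, t) (s', t') * slice i j k h f s' t' r := by
  simp only [slice, emb2_mulVec]
  refine Finset.sum_congr rfl fun s' _ => Finset.sum_congr rfl fun t' _ => ?_
  congr 2
  · simp [hij, hik, hjk]
  · funext m
    simp only [update_apply]
    grind

theorem slice_emb2_13 {i j k : ι} (hij : i ≠ j) (hik : i ≠ k)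
    (X : Matrix (Fin 2 × Fin 2) (Fin 2 × Fin 2) ℂ) (h f s t r) :
    slice i j k h (emb2 i k X *ᵥ f) s t r =
      ∑ s', ∑ r', X (s, r) (s', r') * slice i j k h f s' t r' := by
  simp only [slice, emb2_mulVec]
  refine Finset.sum_congr rfl fun s' _ => Finset.sum_congr rfl fun t' _ => ?_
  congr 2
  · simp [hij, hik]
  · funext m
    simp only [update_apply]
    grind

theorem slice_emb2_23 {i j k : ι} (hjk : j ≠ k)
    (X : Matrix (Fin 2 × Fin 2) (Fin 2 × Fin 2) ℂ) (h f s t r) :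
    slice i j k h (emb2 j k X *ᵥ f) s t r =
      ∑ t', ∑ r', X (t, r) (t', r') * slice i j k h f s t' r' := by
  simp only [slice, emb2_mulVec]
  refine Finset.sum_congr rfl fun s' _ => Finset.sum_congr rfl fun t' _ => ?_
  congr 2
  · simp [hjk]
  · funext m
    simp only [update_apply]
    grind

/-- Reduces identities between operators on three sites to relations between eight components. -/
theorem slice_ext {i j k : ι} {f g : (ι → Fin 2) → ℂ}
    (hfg : ∀ h s t r, slice i j k h f s t r = slice i j k h g s t r) : f = g := by
  funext h
  rw [← slice_self i j k h f, hfg, slice_self]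

theorem swapMat_emb2 {i j k : ι} (hij : i ≠ j) (hik : i ≠ k) (hjk : j ≠ k)
    (X : Matrix (Fin 2 × Fin 2) (Fin 2 × Fin 2) ℂ) :
    emb2 i j swapMat * emb2 i k X = emb2 j k X * emb2 i j swapMat := by
  refine matrix_ext_mulVec fun f => slice_ext (i := i) (j := j) (k := k) fun h s t r => ?_
  simp only [← mulVec_mulVec, slice_emb2_12 hij hik hjk, slice_emb2_13 hij hik,
    slice_emb2_23 hjk, swapMat, Matrix.of_apply, Prod.swap]
  fin_cases s <;> fin_cases t <;> fin_cases r <;> simp [Fin.sum_univ_two]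

theorem swapMat_emb1 {i j : ι} (hij : i ≠ j) (X : Matrix (Fin 2) (Fin 2) ℂ) :
    emb2 i j swapMat * emb1 i X = emb1 j X * emb2 i j swapMat := by
  refine matrix_ext_mulVec fun f => funext fun h => ?_
  simp only [← mulVec_mulVec, emb2_mulVec, emb1_mulVec, swapMat, Matrix.of_apply, Prod.swap,
    update_of_ne hij, update_self, update_idem, update_comm hij,
    Prod.mk.injEq]
  rcases Fin.exists_fin_two.mp ⟨h i, rfl⟩ with hi | hi <;>
  rcases Fin.exists_fin_two.mp ⟨h j, rfl⟩ with hj | hj <;>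
  simp [hi, hj, Fin.sum_univ_two]

end LocalOperators

/-! ### Yang–Baxter equation, unitarity and the reflection equation -/

section Reflection

set_option linter.unusedSectionVars false

variable {ι : Type*} [Fintype ι] [DecidableEq ι]

theorem Rmat_swap (η u : ℂ) (x y : Fin 2 × Fin 2) :
    Rmat η u x.swap y.swap = Rmat η u x y := by
  obtain ⟨a, b⟩ := x
  obtain ⟨c, d⟩ := y
  fin_cases a <;> fin_cases b <;> fin_cases c <;> fin_cases d <;> simp [Rmat]

theorem Rmat_transpose (η u : ℂ) : (Rmat η u)ᵀ = Rmat η u := by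
  ext ⟨a, b⟩ ⟨c, d⟩
  fin_cases a <;> fin_cases b <;> fin_cases c <;> fin_cases d <;> simp [Rmat]

/-- The degeneration at zero is what singles out the points `±ξ_j + η/2`: there one R-matrix of the
boundary monodromy is an exchange. -/
theorem Rmat_zero (η : ℂ) : Rmat η 0 = sinh η • swapMat := by
  ext ⟨a, b⟩ ⟨c, d⟩
  fin_cases a <;> fin_cases b <;> fin_cases c <;> fin_cases d <;> simp [Rmat, swapMat]

/-- The six-vertex `R`-matrix acting on the sites `i` and `j`. -/
def Rop (η : ℂ) (i j : ι) (u : ℂ) : Matrix (ι → Fin 2) (ι → Fin 2) ℂ := emb2 i j (Rmat η u)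

theorem Rop_symm (η : ℂ) {i j : ι} (hij : i ≠ j) (u : ℂ) : Rop η i j u = Rop η j i u :=
  emb2_swap hij _ (Rmat_swap η u)

/-- The middle argument is a free variable with a side condition, so that the relation applies
whatever form the shifted spectral parameters have. -/
theorem yang_baxter (η : ℂ) {i j k : ι} (hij : i ≠ j) (hik : i ≠ k) (hjk : j ≠ k) {u v w : ℂ}
    (hw : w = u + v) :
    Rop η i j u * Rop η i k w * Rop η j k v = Rop η j k v * Rop η i k w * Rop η i j u := by
  subst hw
  refine matrix_ext_mulVec fun f => slice_ext (i := i) (j := j) (k := k) fun h s t r => ?_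
  simp only [Rop, ← mulVec_mulVec, slice_emb2_12 hij hik hjk, slice_emb2_13 hij hik,
    slice_emb2_23 hjk]
  generalize slice i j k h f = F
  -- In terms of the exponentials of `η`, `u`, `v` every component is an identity between rational
  -- functions.
  have hη := Complex.exp_ne_zero η
  have hu := Complex.exp_ne_zero u
  have hv := Complex.exp_ne_zero v
  fin_cases s <;> fin_cases t <;> fin_cases r <;> simp [Fin.sum_univ_two, Rmat] <;>
  simp only [Complex.sinh, Complex.exp_add, Complex.exp_neg, neg_add] <;>
  generalize Complex.exp η = a at * <;> generalize Complex.exp u = b at * <;>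
  generalize Complex.exp v = c at * <;> field_simp <;> ring

theorem Rop_mul_neg (η : ℂ) {i j : ι} (hij : i ≠ j) (u : ℂ) :
    Rop η i j u * Rop η i j (-u) = (sinh (η + u) * sinh (η - u)) • 1 := by
  refine matrix_ext_mulVec fun f => funext fun h => ?_
  rw [← mulVec_mulVec]
  simp only [Rop, emb2_mulVec, update_self, update_of_ne hij, smul_mulVec,
    one_mulVec, Pi.smul_apply, smul_eq_mul]
  have hη := Complex.exp_ne_zero η
  have hu := Complex.exp_ne_zero u
  have key : ∀ s t s' t', update (update (update (update h i s) j t) i s') j t'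
      = update (update h i s') j t' := fun s t s' t' => by
    rw [update_comm hij.symm, update_idem, update_idem]
  have hself : ∀ s t, h i = s → h j = t → f h = f (update (update h i s) j t) := by
    rintro _ _ rfl rfl
    simp
  simp only [key]
  rcases Fin.exists_fin_two.mp ⟨h i, rfl⟩ with hi | hi <;>
  rcases Fin.exists_fin_two.mp ⟨h j, rfl⟩ with hj | hj <;>
  rw [hself _ _ hi hj] <;>
  simp [hi, hj, Fin.sum_univ_two, Rmat] <;>
  simp only [Complex.sinh, Complex.exp_add, Complex.exp_neg, neg_add, sub_eq_add_neg, neg_neg] <;>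
  generalize Complex.exp η = a at * <;> generalize Complex.exp u = b at * <;>
  field_simp <;> ring

namespace Chain

variable {N : ℕ} (p : Chain N)

/-- The matrix `K₋` acting on site `i`. -/
def Kop (i : ι) (u : ℂ) : Matrix (ι → Fin 2) (ι → Fin 2) ℂ := emb1 i (p.Kminus u)

theorem reflection_K {i j : ι} (hij : i ≠ j) {u v w w' : ℂ} (hw : w = u - v)
    (hw' : w' = u + v - p.η) :
    Rop p.η i j w * p.Kop i u * Rop p.η i j w' * p.Kop j v =
      p.Kop j v * Rop p.η i j w' * p.Kop i u * Rop p.η i j w := by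
  subst hw hw'
  -- Centring both parameters at `η/2` leaves `x - y` and `x + y` in the R-matrices and `±x`, `±y`
  -- (shifted by `ς` or doubled) in the boundary matrices.
  obtain ⟨x, rfl⟩ : ∃ x, u = x + p.η / 2 := ⟨u - p.η / 2, by ring⟩
  obtain ⟨y, rfl⟩ : ∃ y, v = y + p.η / 2 := ⟨v - p.η / 2, by ring⟩
  refine matrix_ext_mulVec fun f => funext fun h => ?_
  have key1 : ∀ s t s', update (update (update h i s) j t) i s'
      = update (update h i s') j t := fun s t s' => by
    rw [update_comm hij.symm, update_idem]
  have key2 : ∀ s t, update (update h j t) i s = update (update h i s) j t := fun s t => by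
    rw [update_comm hij.symm]
  simp only [Rop, Kop, Kminus, ← mulVec_mulVec, emb2_mulVec, emb1_mulVec, update_self,
    update_of_ne hij, update_idem, key1, key2,
    Matrix.smul_apply, smul_eq_mul]
  generalize hF : (fun s t => f (update (update h i s) j t)) = F
  replace hF : ∀ s t, f (update (update h i s) j t) = F s t := fun s t => by rw [← hF]
  simp only [hF]
  rw [show x + p.η / 2 - (y + p.η / 2) = x - y by ring,
    show x + p.η / 2 + (y + p.η / 2) - p.η = x + y by ring,
    show x + p.η / 2 - p.η / 2 + p.ς = x + p.ς by ring,
    show y + p.η / 2 - p.η / 2 + p.ς = y + p.ς by ring,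
    show p.ς - (x + p.η / 2) + p.η / 2 = p.ς - x by ring,
    show p.ς - (y + p.η / 2) + p.η / 2 = p.ς - y by ring,
    show 2 * (x + p.η / 2) - p.η = x + x by ring,
    show 2 * (y + p.η / 2) - p.η = y + y by ring]
  generalize 1 / sinh p.ς = c
  generalize p.κ * exp p.τ = κ₁
  generalize p.κ * exp (-p.τ) = κ₂
  have hη := Complex.exp_ne_zero p.η
  have hx := Complex.exp_ne_zero x
  have hy := Complex.exp_ne_zero y
  have hς := Complex.exp_ne_zero p.ς
  rcases Fin.exists_fin_two.mp ⟨h i, rfl⟩ with hi | hi <;>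
  rcases Fin.exists_fin_two.mp ⟨h j, rfl⟩ with hj | hj <;>
  simp [hi, hj, Fin.sum_univ_two, Rmat] <;>
  simp only [Complex.sinh, Complex.exp_add, Complex.exp_neg, neg_add, sub_eq_add_neg, neg_neg] <;>
  generalize Complex.exp p.η = a at * <;> generalize Complex.exp x = b at * <;>
  generalize Complex.exp y = d at * <;> generalize Complex.exp p.ς = e at * <;>
  field_simp <;> ring

end Chain

end Reflection

/-! ### Dressed boundary matrices and the reversal of inhomogeneities -/

section Boundary

set_option linter.unusedSectionVars false

variable {ι : Type*} [Fintype ι] [DecidableEq ι]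

/-- The inhomogeneities with the sign of the `j`-th one reversed. -/
def flip (x : ι → ℂ) (j : ι) : ι → ℂ := update x j (-x j)

@[simp] theorem flip_self (x : ι → ℂ) (j : ι) : flip x j j = -x j := by simp [flip]

theorem flip_of_ne (x : ι → ℂ) {i j : ι} (h : i ≠ j) : flip x j i = x i := by simp [flip, h]

@[simp] theorem flip_flip (x : ι → ℂ) (j : ι) : flip (flip x j) j = x := by simp [flip]

theorem Rop_commute (η : ℂ) {i j k l : ι} (hik : i ≠ k) (hil : i ≠ l) (hjk : j ≠ k) (hjl : j ≠ l)
    (u v : ℂ) : Commute (Rop η i j u) (Rop η k l v) := emb2_commute hik hil hjk hjl _ _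

/-- Sklyanin's dressing argument in an arbitrary monoid: the Yang–Baxter relations `y1`–`y4` carry
the outer factors past `R` and `R'`, and the commutations bring the bare reflection equation
together in the middle. -/
theorem reflection_dressing {M : Type*} [Monoid M] {A B R R' A₁ A₂ B₁ B₂ : M}
    (y1 : R * A₁ * B₁ = B₁ * A₁ * R) (y2 : R * A₂ * B₂ = B₂ * A₂ * R)
    (y3 : A₂ * R' * B₁ = B₁ * R' * A₂) (y4 : A₁ * R' * B₂ = B₂ * R' * A₁)
    (c1 : A * B₁ = B₁ * A) (c2 : A * B₂ = B₂ * A) (c3 : A₁ * B = B * A₁) (c4 : A₂ * B = B * A₂)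
    (h : R * A * R' * B = B * R' * A * R) :
    R * (A₁ * A * A₂) * R' * (B₁ * B * B₂) = B₁ * B * B₂ * R' * (A₁ * A * A₂) * R := by
  calc R * (A₁ * A * A₂) * R' * (B₁ * B * B₂)
      = R * A₁ * A * (A₂ * R' * B₁) * B * B₂ := by simp only [mul_assoc]
    _ = R * A₁ * (A * B₁) * R' * (A₂ * B) * B₂ := by rw [y3]; simp only [mul_assoc]
    _ = (R * A₁ * B₁) * A * R' * B * (A₂ * B₂) := by rw [c1, c4]; simp only [mul_assoc]
    _ = B₁ * A₁ * (R * A * R' * B) * A₂ * B₂ := by rw [y1]; simp only [mul_assoc]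
    _ = B₁ * (A₁ * B) * R' * A * (R * A₂ * B₂) := by rw [h]; simp only [mul_assoc]
    _ = B₁ * B * A₁ * R' * (A * B₂) * A₂ * R := by rw [c3, y2]; simp only [mul_assoc]
    _ = B₁ * B * (A₁ * R' * B₂) * A * A₂ * R := by rw [c2]; simp only [mul_assoc]
    _ = B₁ * B * B₂ * R' * (A₁ * A * A₂) * R := by rw [y4]; simp only [mul_assoc]

theorem smul_one_of_nested {n : Type*} [Fintype n] [DecidableEq n] {A B R R' S S' : Matrix n n ℂ}
    {c d e : ℂ} (h1 : R' * S' = c • 1) (h2 : A * B = d • 1) (h3 : R * S = e • 1) :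
    R * A * R' * (S' * B * S) = (c * d * e) • 1 := by
  calc R * A * R' * (S' * B * S) = R * (A * (R' * S') * B) * S := by simp only [mul_assoc]
    _ = (c * d * e) • 1 := by
      rw [h1, mul_smul_comm, mul_one, smul_mul_assoc, h2, smul_smul, mul_smul_comm, mul_one,
        smul_mul_assoc, h3, smul_smul]

namespace Chain

variable {N : ℕ} (p : Chain N)

/-- `K₋(η - u)` is the adjugate of `K₋(u)`, so the scalar is the determinant of `K₋(u)`. -/
theorem Kop_mul_neg (i : ι) {u v : ℂ} (h : v = p.η - u) :
    ∃ c : ℂ, p.Kop i u * p.Kop i v = c • 1 := by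
  subst h
  refine ⟨(1 / sinh p.ς) ^ 2 * (sinh (u - p.η / 2 + p.ς) * sinh (p.ς - u + p.η / 2) -
    p.κ * exp p.τ * (p.κ * exp (-p.τ)) * sinh (2 * u - p.η) ^ 2), ?_⟩
  rw [Kop, Kop, emb1_mul, ← emb1_one i, ← emb1_smul]
  congr 1
  simp only [Kminus]
  rw [show p.η - u - p.η / 2 + p.ς = p.ς - u + p.η / 2 by ring,
    show p.ς - (p.η - u) + p.η / 2 = u - p.η / 2 + p.ς by ring,
    show 2 * (p.η - u) - p.η = -(2 * u - p.η) by ring, sinh_neg]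
  ext s t
  fin_cases s <;> fin_cases t <;> simp [Matrix.mul_apply, Fin.sum_univ_two] <;> ring

theorem Kop_Rop_commute {i j k : ι} (hij : i ≠ j) (hik : i ≠ k) (u v : ℂ) :
    Commute (p.Kop i u) (Rop p.η j k v) := emb1_emb2_commute hij hik _ _

/-- The boundary monodromy matrix with auxiliary site `a`, dressed by a list of sites of which the
first is the outermost. -/
def bnd (x : ι → ℂ) (a : ι) (u : ℂ) : List ι → Matrix (ι → Fin 2) (ι → Fin 2) ℂ
  | [] => p.Kop a u
  | n :: L => Rop p.η a n (u - x n - p.η / 2) * bnd x a u L * Rop p.η a n (u + x n - p.η / 2)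

theorem bnd_congr {x y : ι → ℂ} (a : ι) (u : ℂ) {L : List ι} (h : ∀ n ∈ L, x n = y n) :
    p.bnd x a u L = p.bnd y a u L := by
  induction L with
  | nil => rfl
  | cons n L ih =>
    rw [bnd, bnd, ih fun m hm => h m (by simp [hm]), h n (by simp)]

theorem bnd_flip (x : ι → ℂ) (a : ι) (u : ℂ) {j : ι} {L : List ι} (h : j ∉ L) :
    p.bnd (flip x j) a u L = p.bnd x a u L :=
  p.bnd_congr a u fun n hn => flip_of_ne x (by rintro rfl; exact h hn)

theorem commute_bnd {Z : Matrix (ι → Fin 2) (ι → Fin 2) ℂ} {a : ι} {L : List ι} (x : ι → ℂ) (u : ℂ)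
    (hK : Commute Z (p.Kop a u)) (hR : ∀ n ∈ L, ∀ v, Commute Z (Rop p.η a n v)) :
    Commute Z (p.bnd x a u L) := by
  induction L with
  | nil => exact hK
  | cons n L ih =>
    exact ((hR n (by simp) _).mul_right (ih fun m hm => hR m (by simp [hm]))).mul_right
      (hR n (by simp) _)

theorem Rop_commute_bnd {i j a : ι} {L : List ι} (x : ι → ℂ) (u v : ℂ) (hia : i ≠ a) (hja : j ≠ a)
    (hi : i ∉ L) (hj : j ∉ L) : Commute (Rop p.η i j v) (p.bnd x a u L) := by
  refine p.commute_bnd x u (p.Kop_Rop_commute hia.symm hja.symm _ _).symm fun n hn w => ?_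
  exact Rop_commute _ hia (by rintro rfl; exact hi hn) hja (by rintro rfl; exact hj hn) _ _

theorem emb1_commute_bnd {i a : ι} {L : List ι} (x : ι → ℂ) (u : ℂ) (hia : i ≠ a)
    (hi : i ∉ L) (X : Matrix (Fin 2) (Fin 2) ℂ) : Commute (emb1 i X) (p.bnd x a u L) := by
  refine p.commute_bnd x u (emb1_commute hia _ _) fun n hn w => ?_
  exact emb1_emb2_commute hia (by rintro rfl; exact hi hn) _ _

/-- The reflection equation for the dressed boundary matrix. -/
theorem reflection_bnd (x : ι → ℂ) {a b : ι} (hab : a ≠ b) {u v w w' : ℂ} (hw : w = u - v)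
    (hw' : w' = u + v - p.η) {L : List ι} (hL : L.Nodup) (ha : a ∉ L) (hb : b ∉ L) :
    Rop p.η a b w * p.bnd x a u L * Rop p.η a b w' * p.bnd x b v L =
      p.bnd x b v L * Rop p.η a b w' * p.bnd x a u L * Rop p.η a b w := by
  induction L with
  | nil => exact p.reflection_K hab hw hw'
  | cons m L ih =>
    simp only [List.mem_cons, not_or] at ha hb
    obtain ⟨ham, ha⟩ := ha
    obtain ⟨hbm, hb⟩ := hb
    rw [List.nodup_cons] at hL
    specialize ih hL.2 ha hb
    refine reflection_dressing (yang_baxter _ hab ham hbm (by rw [hw]; ring))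
      (yang_baxter _ hab ham hbm (by rw [hw]; ring)) ?_ ?_ ?_ ?_ ?_ ?_ ih
    · rw [Rop_symm _ hbm]
      exact yang_baxter _ ham hab (Ne.symm hbm) (by rw [hw']; ring)
    · rw [Rop_symm _ hbm]
      exact yang_baxter _ ham hab (Ne.symm hbm) (by rw [hw']; ring)
    · exact (p.Rop_commute_bnd x _ _ hab.symm (Ne.symm ham) hb hL.1).eq.symm
    · exact (p.Rop_commute_bnd x _ _ hab.symm (Ne.symm ham) hb hL.1).eq.symm
    · exact (p.Rop_commute_bnd x _ _ hab (Ne.symm hbm) ha hL.1).eq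
    · exact (p.Rop_commute_bnd x _ _ hab (Ne.symm hbm) ha hL.1).eq

/-- In the product the R-matrices meet in pairs with opposite arguments, and unitarity collapses it
to a scalar from the middle outwards. -/
theorem bnd_mul_neg (x : ι → ℂ) {a : ι} {u v : ℂ} (hv : v = p.η - u) {L : List ι} (ha : a ∉ L) :
    ∃ c : ℂ, p.bnd x a u L * p.bnd x a v L = c • 1 := by
  induction L with
  | nil => exact p.Kop_mul_neg a hv
  | cons n L ih =>
    simp only [List.mem_cons, not_or] at ha
    obtain ⟨c, hc⟩ := ih ha.2
    have e1 : v - x n - p.η / 2 = -(u + x n - p.η / 2) := by rw [hv]; ring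
    have e2 : v + x n - p.η / 2 = -(u - x n - p.η / 2) := by rw [hv]; ring
    have h1 := Rop_mul_neg p.η ha.1 (u + x n - p.η / 2)
    have h2 := Rop_mul_neg p.η ha.1 (u - x n - p.η / 2)
    simp only [bnd, e1, e2]
    exact ⟨_, smul_one_of_nested h1 hc h2⟩

/-- Turns the auxiliary site into a site of the chain once an R-matrix has become an exchange. -/
theorem swap_bnd (x : ι → ℂ) {a j : ι} (haj : a ≠ j) (u : ℂ) {L : List ι} (ha : a ∉ L) (hj : j ∉ L) :
    emb2 a j swapMat * p.bnd x a u L = p.bnd x j u L * emb2 a j swapMat := by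
  induction L with
  | nil => exact swapMat_emb1 haj _
  | cons n L ih =>
    simp only [List.mem_cons, not_or] at ha hj
    have h : ∀ v, emb2 a j swapMat * Rop p.η a n v = Rop p.η j n v * emb2 a j swapMat := fun v =>
      swapMat_emb2 haj ha.1 hj.1 _
    simp only [bnd]
    rw [← mul_assoc, ← mul_assoc, h, mul_assoc _ (emb2 a j swapMat), ih ha.2 hj.2, ← mul_assoc,
      mul_assoc _ (emb2 a j swapMat), h, ← mul_assoc]

/-- The operator that intertwines the boundary monodromy matrices with inhomogeneities `x` and
`flip x j`. -/
def refl (x : ι → ℂ) (j : ι) : List ι → Matrix (ι → Fin 2) (ι → Fin 2) ℂ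
  | [] => 1
  | n :: L => if n = j then p.bnd x j (x j + p.η / 2) L else refl x j L

theorem commute_refl {Z : Matrix (ι → Fin 2) (ι → Fin 2) ℂ} {L : List ι} (x : ι → ℂ) (j : ι)
    (hK : ∀ n ∈ L, ∀ v, Commute Z (p.Kop n v))
    (hR : ∀ n ∈ L, ∀ m ∈ L, ∀ v, Commute Z (Rop p.η n m v)) :
    Commute Z (p.refl x j L) := by
  induction L with
  | nil => exact Commute.one_right _
  | cons n L ih =>
    rw [refl]
    split_ifs with h
    · subst h
      exact p.commute_bnd x _ (hK n (by simp) _) fun m hm v => hR n (by simp) m (by simp [hm]) v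
    · exact ih (fun m hm => hK m (by simp [hm])) fun m hm m' hm' => hR m (by simp [hm]) m' (by simp [hm'])

theorem Rop_commute_refl {a b : ι} {L : List ι} (ha : a ∉ L) (hb : b ∉ L) (x : ι → ℂ) (j : ι)
    (v : ℂ) : Commute (Rop p.η a b v) (p.refl x j L) := by
  have h1 : ∀ n ∈ L, a ≠ n := by rintro n hn rfl; exact ha hn
  have h2 : ∀ n ∈ L, b ≠ n := by rintro n hn rfl; exact hb hn
  refine p.commute_refl x j (fun n hn w => ?_) fun n hn m hm w => ?_
  · exact (p.Kop_Rop_commute (h1 n hn).symm (h2 n hn).symm _ _).symm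
  · exact Rop_commute _ (h1 n hn) (h1 m hm) (h2 n hn) (h2 m hm) _ _

/-- If `j` is the outermost site, take the second parameter of the reflection equation to be `v = x
j + η/2`. Then `u - v` and `u + v - η` are the arguments of the two R-matrices that couple `a` to
`j`, and reversing the sign of `x j` exchanges them. The R-matrices of sites outside `j` commute
with the reversal. -/
theorem bnd_mul_refl (x : ι → ℂ) {a j : ι} (u : ℂ) {L : List ι} (hL : L.Nodup) (ha : a ∉ L)
    (hj : j ∈ L) :
    p.bnd x a u L * p.refl x j L = p.refl x j L * p.bnd (flip x j) a u L := by
  induction L with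
  | nil => simp at hj
  | cons n L ih =>
    simp only [List.mem_cons, not_or] at ha
    rw [List.nodup_cons] at hL
    by_cases hn : n = j
    · subst hn
      simp only [bnd, refl, if_true, flip_self, p.bnd_flip x a u hL.1]
      have := p.reflection_bnd x ha.1 (u := u) (v := x n + p.η / 2)
        (w := u - x n - p.η / 2) (w' := u + x n - p.η / 2) (by ring) (by ring) hL.2 ha.2 hL.1
      rw [this, sub_neg_eq_add, ← sub_eq_add_neg]
      simp only [mul_assoc]
    · have hj' : j ∈ L := by simpa [Ne.symm hn] using hj
      simp only [bnd, refl, if_neg hn, flip_of_ne x hn]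
      have hc := fun v => (p.Rop_commute_refl ha.2 hL.1 x j v).eq
      rw [mul_assoc, hc, ← mul_assoc, mul_assoc (Rop _ _ _ _), ih hL.2 ha.2 hj', ← mul_assoc, hc]
      simp only [mul_assoc]

/-- The two parameters `x j + η/2` and `-x j + η/2` add up to `η`, so `bnd_mul_neg` applies. -/
theorem refl_mul_refl_flip (x : ι → ℂ) (j : ι) {L : List ι} (hL : L.Nodup) :
    ∃ c : ℂ, p.refl x j L * p.refl (flip x j) j L = c • 1 := by
  induction L with
  | nil => exact ⟨1, by simp [refl]⟩
  | cons n L ih =>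
    rw [List.nodup_cons] at hL
    by_cases hn : n = j
    · subst hn
      simp only [refl, if_true, flip_self, p.bnd_flip x n _ hL.1]
      exact p.bnd_mul_neg x (by ring) hL.1
    · simp only [refl, if_neg hn]
      exact ih hL.2

/-- The product of the intertwiners that reverse the signs of the inhomogeneities in `D`, the
outermost first. -/
def sweep (x : ι → ℂ) (D : Finset ι) : List ι → Matrix (ι → Fin 2) (ι → Fin 2) ℂ
  | [] => 1
  | n :: L => (if n ∈ D then p.bnd x n (x n + p.η / 2) L else 1) * sweep x D L

theorem sweep_congr {x y : ι → ℂ} {D E : Finset ι} {L : List ι} (h : ∀ n ∈ L, x n = y n)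
    (hD : ∀ n ∈ L, n ∈ D ↔ n ∈ E) : p.sweep x D L = p.sweep y E L := by
  induction L with
  | nil => rfl
  | cons n L ih =>
    rw [sweep, sweep, ih (fun m hm => h m (by simp [hm])) fun m hm => hD m (by simp [hm]),
      p.bnd_congr n _ fun m hm => h m (by simp [hm]), h n (by simp)]
    simp only [hD n (by simp)]

/-- The reversal of `j` crosses the factors outside `j` by `bnd_mul_refl`. At the place of `j` it is
either inserted, without any scalar, or annihilated by a second reversal of `j`, which leaves one.
-/
theorem refl_mul_sweep (x : ι → ℂ) {j : ι} (D : Finset ι) {L : List ι} (hL : L.Nodup)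
    (hj : j ∈ L) :
    ∃ c : ℂ, (j ∉ D → c = 1) ∧
      p.refl x j L * p.sweep (flip x j) D L = c • p.sweep x (symmDiff D {j}) L := by
  induction L with
  | nil => simp at hj
  | cons n L ih =>
    have hL' := List.nodup_cons.mp hL
    by_cases hn : n = j
    · subst hn
      have hs : p.sweep (flip x n) D L = p.sweep x (symmDiff D {n}) L := by
        refine p.sweep_congr (fun m hm => ?_) fun m hm => ?_
        · exact flip_of_ne x (by rintro rfl; exact hL'.1 hm)
        · have : m ≠ n := by rintro rfl; exact hL'.1 hm
          simp [Finset.mem_symmDiff, this]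
      by_cases hD : n ∈ D
      · obtain ⟨c, hc⟩ := p.refl_mul_refl_flip x n hL
        simp only [refl, if_true] at hc
        refine ⟨c, fun h => absurd hD h, ?_⟩
        simp only [refl, sweep, if_true, hD, Finset.mem_symmDiff, Finset.mem_singleton,
          not_true, and_false, or_self, if_false, one_mul, hs]
        rw [← mul_assoc, hc, smul_mul_assoc, one_mul]
      · refine ⟨1, fun _ => rfl, ?_⟩
        simp only [refl, sweep, if_true, hD, Finset.mem_symmDiff, Finset.mem_singleton,
          not_false_eq_true, and_true, or_true, if_false, one_mul, hs, one_smul]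
    · have hj' : j ∈ L := by simpa [Ne.symm hn] using hj
      obtain ⟨c, h1, h2⟩ := ih hL'.2 hj'
      refine ⟨c, h1, ?_⟩
      have hm : n ∈ symmDiff D {j} ↔ n ∈ D := by simp [Finset.mem_symmDiff, hn]
      simp only [refl, sweep, if_neg hn, hm, flip_of_ne x hn]
      split_ifs
      · rw [← mul_assoc, ← p.bnd_mul_refl x _ hL'.2 hL'.1 hj', mul_assoc, h2, mul_smul_comm]
      · rw [one_mul, one_mul, h2]

/-- A product of intertwiners that reverse the signs of inhomogeneities one after the other. -/
def reflWord (L : List ι) : (ι → ℂ) → List ι → Matrix (ι → Fin 2) (ι → Fin 2) ℂ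
  | _, [] => 1
  | x, j :: ω => p.refl x j L * reflWord L (flip x j) ω

theorem reflWord_eq_sweep {L : List ι} (hL : L.Nodup) (x : ι → ℂ) {ω : List ι}
    (hω : ∀ j ∈ ω, j ∈ L) :
    ∃ (c : ℂ) (D : Finset ι), (ω.Nodup → c = 1) ∧ (∀ j, j ∈ D ↔ Odd (ω.count j)) ∧
      p.reflWord L x ω = c • p.sweep x D L := by
  induction ω generalizing x with
  | nil =>
    refine ⟨1, ∅, fun _ => rfl, by simp, ?_⟩
    have : ∀ M : List ι, p.sweep x ∅ M = 1 := by
      intro M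
      induction M with
      | nil => rfl
      | cons n M ih => simp [sweep, ih]
    simp [reflWord, this]
  | cons j ω ih =>
    obtain ⟨c, D, h1, h2, h3⟩ := ih (flip x j) fun i hi => hω i (by simp [hi])
    obtain ⟨c', h4, h5⟩ := p.refl_mul_sweep x D hL (hω j (by simp))
    refine ⟨c * c', symmDiff D {j}, fun h => ?_, fun i => ?_, ?_⟩
    · rw [List.nodup_cons] at h
      have : j ∉ D := by
        rw [h2, List.count_eq_zero_of_not_mem h.1]
        simp
      rw [h1 h.2, h4 this, one_mul]
    · rw [Finset.mem_symmDiff, Finset.mem_singleton, h2, List.count_cons]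
      by_cases hij : i = j
      · subst hij
        simp [Nat.odd_add_one]
      · simp [hij, Ne.symm hij]
    · rw [reflWord, h3, mul_smul_comm, h5, smul_smul]

end Chain

end Boundary

/-! ### Product states and the contraction at one site -/

section ProductStates

set_option linter.unusedSectionVars false

variable {ι : Type*} [Fintype ι] [DecidableEq ι]

/-- The product state with local states `v`. -/
def tprod (v : ι → Fin 2 → ℂ) : (ι → Fin 2) → ℂ := fun h => ∏ i, v i (h i)

theorem tprod_update1 (v : ι → Fin 2 → ℂ) (h : ι → Fin 2) (i : ι) (s : Fin 2) :
    tprod v (update h i s) = (∏ m ∈ Finset.univ.erase i, v m (h m)) * v i s := by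
  rw [tprod, ← Finset.prod_erase_mul _ _ (Finset.mem_univ i), update_self]
  congr 1
  refine Finset.prod_congr rfl fun m hm => ?_
  rw [update_of_ne (Finset.ne_of_mem_erase hm)]

theorem tprod_update2 (v : ι → Fin 2 → ℂ) (h : ι → Fin 2) {i j : ι} (hij : i ≠ j) (s t : Fin 2) :
    tprod v (update (update h i s) j t) =
      (∏ m ∈ (Finset.univ.erase j).erase i, v m (h m)) * (v i s * v j t) := by
  rw [tprod_update1, ← Finset.prod_erase_mul _ _
    (Finset.mem_erase.mpr ⟨hij, Finset.mem_univ i⟩), update_self, mul_assoc]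
  congr 1
  refine Finset.prod_congr rfl fun m hm => ?_
  rw [update_of_ne (Finset.ne_of_mem_erase hm)]

theorem prod_erase_update (v : ι → Fin 2 → ℂ) (ψ : Fin 2 → ℂ) (i : ι) (h : ι → Fin 2) :
    ∏ m ∈ Finset.univ.erase i, update v i ψ m (h m) = ∏ m ∈ Finset.univ.erase i, v m (h m) :=
  Finset.prod_congr rfl fun m hm => by rw [update_of_ne (Finset.ne_of_mem_erase hm)]

theorem emb1_mulVec_tprod (i : ι) (X : Matrix (Fin 2) (Fin 2) ℂ) (v : ι → Fin 2 → ℂ) :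
    emb1 i X *ᵥ tprod v = tprod (update v i (X *ᵥ v i)) := by
  funext h
  rw [emb1_mulVec]
  conv_rhs => rw [← update_eq_self i h, tprod_update1]
  simp only [tprod_update1, update_self, prod_erase_update]
  rw [Matrix.mulVec, dotProduct, Finset.mul_sum]
  exact Finset.sum_congr rfl fun s _ => by ring

theorem tprod_vecMul_emb1 (i : ι) (X : Matrix (Fin 2) (Fin 2) ℂ) (v : ι → Fin 2 → ℂ) :
    tprod v ᵥ* emb1 i X = tprod (update v i (v i ᵥ* X)) := by
  rw [← Matrix.mulVec_transpose, emb1_transpose, emb1_mulVec_tprod, Matrix.mulVec_transpose]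

/-- A two-site operator in general entangles its sites. The hypothesis isolates the pairs of local
vectors whose image is again a product; the vertex-IRF relations will supply it. -/
theorem emb2_mulVec_tprod {i j : ι} (hij : i ≠ j)
    (X : Matrix (Fin 2 × Fin 2) (Fin 2 × Fin 2) ℂ) (v : ι → Fin 2 → ℂ) {c : ℂ} {α β : Fin 2 → ℂ}
    (hX : ∀ s t, ∑ s', ∑ t', X (s, t) (s', t') * (v i s' * v j t') = c * (α s * β t)) :
    emb2 i j X *ᵥ tprod v = c • tprod (update (update v i α) j β) := by
  funext h
  have hs : h = update (update h i (h i)) j (h j) := by simp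
  rw [emb2_mulVec, Pi.smul_apply, smul_eq_mul]
  conv_rhs => rw [hs, tprod_update2 _ _ hij, update_self, update_of_ne hij, update_self]
  have : ∏ m ∈ (Finset.univ.erase j).erase i, update (update v i α) j β m (h m) =
      ∏ m ∈ (Finset.univ.erase j).erase i, v m (h m) :=
    Finset.prod_congr rfl fun m hm => by
      rw [update_of_ne (Finset.ne_of_mem_erase (Finset.mem_of_mem_erase hm)),
        update_of_ne (Finset.ne_of_mem_erase hm)]
  rw [this, mul_left_comm, ← hX, Finset.mul_sum]
  refine Finset.sum_congr rfl fun s _ => ?_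
  rw [Finset.mul_sum]
  refine Finset.sum_congr rfl fun t _ => ?_
  rw [tprod_update2 _ _ hij]
  ring

theorem Rop_vecMul (η : ℂ) {i j : ι} (hij : i ≠ j) (u : ℂ) (f : (ι → Fin 2) → ℂ) :
    f ᵥ* Rop η i j u = Rop η i j u *ᵥ f := by
  rw [← Matrix.mulVec_transpose, Rop, emb2_transpose hij, Rmat_transpose]

theorem swapMat_mulVec_tprod {i j : ι} (hij : i ≠ j) (v : ι → Fin 2 → ℂ) :
    emb2 i j swapMat *ᵥ tprod v = tprod (update (update v i (v j)) j (v i)) := by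
  rw [emb2_mulVec_tprod hij swapMat v (c := 1) (α := v j) (β := v i), one_smul]
  intro s t
  fin_cases s <;> fin_cases t <;> simp [Fin.sum_univ_two, swapMat] <;> ring

theorem swapMat_transpose : swapMatᵀ = swapMat := by
  ext ⟨a, b⟩ ⟨c, d⟩
  fin_cases a <;> fin_cases b <;> fin_cases c <;> fin_cases d <;> simp [swapMat]

theorem tprod_vecMul_swapMat {i j : ι} (hij : i ≠ j) (v : ι → Fin 2 → ℂ) :
    tprod v ᵥ* emb2 i j swapMat = tprod (update (update v i (v j)) j (v i)) := by
  rw [← Matrix.mulVec_transpose, emb2_transpose hij, swapMat_transpose, swapMat_mulVec_tprod hij]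

theorem Rop_zero (η : ℂ) {i j : ι} (hij : i ≠ j) :
    Rop η i j 0 = sinh η • emb2 i j swapMat := by
  rw [Rop, Rmat_zero, emb2_smul hij]

theorem tprod_dotProduct (v w : ι → Fin 2 → ℂ) :
    tprod v ⬝ᵥ tprod w = ∏ i, (v i ⬝ᵥ w i) := by
  simp only [dotProduct, tprod, ← Finset.prod_mul_distrib]
  rw [Finset.prod_univ_sum]
  simp [Fintype.piFinset_univ]

/-- The spin-down local state. -/
def eDown : Fin 2 → ℂ := ![0, 1]

/-- The row vector `r`, contracted with `φ` at the site `a`, with spin down put at this site. -/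
def contract (a : ι) (φ : Fin 2 → ℂ) (r : (ι → Fin 2) → ℂ) : (ι → Fin 2) → ℂ :=
  r ᵥ* emb1 a (vecMulVec φ eDown)

theorem contract_tprod (a : ι) (φ : Fin 2 → ℂ) (v : ι → Fin 2 → ℂ) :
    contract a φ (tprod v) = (v a ⬝ᵥ φ) • tprod (update v a eDown) := by
  rw [contract, tprod_vecMul_emb1, vecMul_vecMulVec]
  funext h
  rw [← update_eq_self a h, Pi.smul_apply]
  simp only [tprod_update1, update_self, Pi.smul_apply, smul_eq_mul, prod_erase_update]
  ring

theorem contract_smul (a : ι) (φ : Fin 2 → ℂ) (c : ℂ) (r : (ι → Fin 2) → ℂ) :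
    contract a φ (c • r) = c • contract a φ r := by
  rw [contract, contract, smul_vecMul]

/-- The operator with column `w a` and row `eDown` fixes `w a`, because the lower entry of `w a` is
1. It commutes with `Y`, so it can be inserted on the right and moved to the row vector. -/
theorem dotProduct_eq_contract {a : ι} {w : ι → Fin 2 → ℂ} (hw : w a 1 = 1)
    {Y : Matrix (ι → Fin 2) (ι → Fin 2) ℂ} (hY : ∀ X, Commute (emb1 a X) Y)
    (r : (ι → Fin 2) → ℂ) :
    r ⬝ᵥ (Y *ᵥ tprod w) = contract a (w a) r ⬝ᵥ (Y *ᵥ tprod w) := by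
  have h1 : vecMulVec (w a) eDown *ᵥ w a = w a := by
    funext s
    simp [vecMulVec, Matrix.mulVec, dotProduct, eDown, Fin.sum_univ_two, hw]
  have h2 : emb1 a (vecMulVec (w a) eDown) *ᵥ tprod w = tprod w := by
    rw [emb1_mulVec_tprod, h1, update_eq_self]
  rw [contract, ← dotProduct_mulVec, mulVec_mulVec, (hY _).eq, ← mulVec_mulVec, h2]

/-- If `q R φ = σ φ' q'` at the sites `a` and `n`, a contraction at `a` passes through `R`. -/
theorem contract_vecMul_emb2 {a n : ι} (han : a ≠ n)
    (X : Matrix (Fin 2 × Fin 2) (Fin 2 × Fin 2) ℂ) {q q' φ φ' : Fin 2 → ℂ} {σ : ℂ}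
    (hX : ∀ s t', ∑ t, ∑ s', q t * X (s, t) (s', t') * φ s' = σ * (φ' s * q' t'))
    {Y : Matrix (ι → Fin 2) (ι → Fin 2) ℂ} (hY : ∀ Z, Commute (emb1 n Z) Y) (v : ι → Fin 2 → ℂ) :
    contract a φ (tprod (update v n q) ᵥ* Y ᵥ* emb2 a n X) =
      σ • contract a φ' (tprod (update v n q') ᵥ* Y) := by
  -- Any row vector at `n` is created from spin down by a local operator, which commutes with `Y`.
  -- Both sides then involve the same vector `r`, and only the relation at `a` and `n` is left.
  have key : ∀ ψ : Fin 2 → ℂ, tprod (update v n ψ) ᵥ* Y =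
      (tprod (update v n eDown) ᵥ* Y) ᵥ* emb1 n (vecMulVec eDown ψ) := by
    intro ψ
    rw [vecMul_vecMul, ← (hY _).eq, ← vecMul_vecMul, tprod_vecMul_emb1, update_self, update_idem]
    congr 3
    funext s
    simp [vecMulVec, Matrix.vecMul, dotProduct, eDown, Fin.sum_univ_two]
  rw [key q, key q']
  generalize tprod (update v n eDown) ᵥ* Y = r
  simp only [contract, ← Matrix.mulVec_transpose, emb1_transpose, emb2_transpose han]
  funext h
  simp only [emb1_mulVec, emb2_mulVec, Pi.smul_apply, smul_eq_mul, Matrix.transpose_apply,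
    vecMulVec_apply, update_self, update_of_ne han.symm, update_idem]
  simp only [Fin.sum_univ_two, eDown] at hX ⊢
  have h0 := hX 0 (h n)
  have h1 := hX 1 (h n)
  simp only [Matrix.cons_val_zero, Matrix.cons_val_one, zero_mul, one_mul, zero_add]
  linear_combination (![0, 1] : Fin 2 → ℂ) (h a) * r (update (update h a 0) n 1) * h0 +
    (![0, 1] : Fin 2 → ℂ) (h a) * r (update (update h a 1) n 1) * h1

end ProductStates

/-! ### Gauge vectors and the matrix element of a sweep -/

section GaugeStates

set_option linter.unusedSectionVars false

variable {ι : Type*} [Fintype ι] [DecidableEq ι]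

namespace Chain

variable {N : ℕ} (p : Chain N)

/-- A multiple of the first row of the inverse of the gauge matrix `S(v|β)`. -/
def rowS (v β : ℂ) : Fin 2 → ℂ := ![-exp (p.η * p.α - v), exp (p.η * β)]

/-- The second column of the gauge matrix `S(v|β)`. -/
def colS (v β : ℂ) : Fin 2 → ℂ := ![exp (v + p.η * (β - p.α)), 1]

theorem rowS_dotProduct_colS (v β : ℂ) : p.rowS v β ⬝ᵥ p.colS v β = 0 := by
  simp only [rowS, colS, dotProduct, Fin.sum_univ_two, Matrix.cons_val_zero, Matrix.cons_val_one,
    neg_mul, ← exp_add, mul_one]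
  rw [show p.η * p.α - v + (v + p.η * (β - p.α)) = p.η * β by ring]
  ring

/-- A vertex-IRF relation in the extreme case in which both steps of the dynamical parameter have
the same direction: a single face weight occurs, so a product goes to a product and the two
dynamical parameters are exchanged. -/
theorem Rop_mulVec_rowS {i j : ι} (hij : i ≠ j) {u l₁ l₂ β β' : ℂ} (hu : u = l₂ - l₁)
    (hβ : β' = β + 1) {v : ι → Fin 2 → ℂ} (hi : v i = p.rowS l₁ β) (hj : v j = p.rowS l₂ β') :
    Rop p.η i j u *ᵥ tprod v =
      sinh (u + p.η) • tprod (update (update v i (p.rowS l₁ β')) j (p.rowS l₂ β)) := by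
  refine emb2_mulVec_tprod hij _ v fun s t => ?_
  rw [hi, hj, hβ, hu]
  have h1 := Complex.exp_ne_zero p.η
  have h2 := Complex.exp_ne_zero l₁
  have h3 := Complex.exp_ne_zero l₂
  fin_cases s <;> fin_cases t <;> simp [Fin.sum_univ_two, rowS, Rmat, -mul_eq_mul_left_iff] <;>
  simp only [Complex.sinh, Complex.exp_add, Complex.exp_neg, neg_add, sub_eq_add_neg, neg_neg,
    mul_add, mul_one] <;>
  generalize Complex.exp p.η = a at * <;> generalize Complex.exp l₁ = b at * <;>
  generalize Complex.exp l₂ = c at * <;> field_simp <;> ring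

theorem Rop_mulVec_colS {i j : ι} (hij : i ≠ j) {u l₁ l₂ β β' : ℂ} (hu : u = l₁ - l₂)
    (hβ : β = β' + 1) {v : ι → Fin 2 → ℂ} (hi : v i = p.colS l₁ β) (hj : v j = p.colS l₂ β') :
    Rop p.η i j u *ᵥ tprod v =
      sinh (u + p.η) • tprod (update (update v i (p.colS l₁ β')) j (p.colS l₂ β)) := by
  refine emb2_mulVec_tprod hij _ v fun s t => ?_
  rw [hi, hj, hβ, hu]
  have h1 := Complex.exp_ne_zero p.η
  have h2 := Complex.exp_ne_zero l₁
  have h3 := Complex.exp_ne_zero l₂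
  fin_cases s <;> fin_cases t <;> simp [Fin.sum_univ_two, colS, Rmat, -mul_eq_mul_left_iff] <;>
  simp only [Complex.sinh, Complex.exp_add, Complex.exp_neg, neg_add, sub_eq_add_neg, neg_neg,
    mul_add, mul_one] <;>
  generalize Complex.exp p.η = a at * <;> generalize Complex.exp l₁ = b at * <;>
  generalize Complex.exp l₂ = c at * <;> field_simp <;> ring

/-- The crossed vertex-IRF relation, with a row vector at `n` and a column vector at `a`. Equality
of the two dynamical parameters leaves only the weight `sinh u` and moves them apart by one step
each. -/
theorem contract_vecMul_Rop {a n : ι} (han : a ≠ n) {u l₁ l₂ β : ℂ} (hu : u = l₁ - l₂)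
    {Y : Matrix (ι → Fin 2) (ι → Fin 2) ℂ} (hY : ∀ Z, Commute (emb1 n Z) Y) (v : ι → Fin 2 → ℂ) :
    contract a (p.colS l₁ β) (tprod (update v n (p.rowS l₂ β)) ᵥ* Y ᵥ* Rop p.η a n u) =
      sinh u • contract a (p.colS l₁ (β + 1)) (tprod (update v n (p.rowS l₂ (β - 1))) ᵥ* Y) := by
  refine contract_vecMul_emb2 han _ (fun s t => ?_) hY v
  rw [hu]
  have h1 := Complex.exp_ne_zero p.η
  have h2 := Complex.exp_ne_zero l₁
  have h3 := Complex.exp_ne_zero l₂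
  have h4 := Complex.exp_ne_zero (p.η * p.α)
  have h5 := Complex.exp_ne_zero (p.η * β)
  fin_cases s <;> fin_cases t <;> simp [Fin.sum_univ_two, rowS, colS, Rmat] <;>
  simp only [Complex.sinh, Complex.exp_add, Complex.exp_neg, neg_add, sub_eq_add_neg, neg_neg,
    mul_add, mul_one, mul_neg] <;>
  generalize Complex.exp p.η = a at * <;> generalize Complex.exp l₁ = b at * <;>
  generalize Complex.exp l₂ = c at * <;> generalize Complex.exp (p.η * p.α) = d at * <;>
  generalize Complex.exp (p.η * β) = e at * <;> field_simp <;> ring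

/-- Local row vectors `v`, replaced along a list of sites by those of the left reference state. -/
def rowState (v : ι → Fin 2 → ℂ) (x : ι → ℂ) : ℂ → List ι → ι → Fin 2 → ℂ
  | _, [] => v
  | β, n :: L => update (rowState v x (β + 1) L) n (p.rowS (-x n) β)

/-- Local vectors `v`, replaced along a list of sites by those of the right reference state. -/
def colState (v : ι → Fin 2 → ℂ) (x : ι → ℂ) : ℂ → List ι → ι → Fin 2 → ℂ
  | _, [] => v
  | β, n :: L => update (colState v x (β - 1) L) n (p.colS (-x n) β)

theorem rowState_update {a : ι} {L : List ι} (ha : a ∉ L) (v : ι → Fin 2 → ℂ) (x : ι → ℂ) (β : ℂ)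
    (ψ : Fin 2 → ℂ) : p.rowState (update v a ψ) x β L = update (p.rowState v x β L) a ψ := by
  induction L generalizing β with
  | nil => rfl
  | cons n L ih =>
    simp only [List.mem_cons, not_or] at ha
    rw [rowState, rowState, ih ha.2, update_comm ha.1]

theorem colState_update {a : ι} {L : List ι} (ha : a ∉ L) (v : ι → Fin 2 → ℂ) (x : ι → ℂ) (β : ℂ)
    (ψ : Fin 2 → ℂ) : p.colState (update v a ψ) x β L = update (p.colState v x β L) a ψ := by
  induction L generalizing β with
  | nil => rfl
  | cons n L ih =>
    simp only [List.mem_cons, not_or] at ha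
    rw [colState, colState, ih ha.2, update_comm ha.1]

theorem rowState_congr {x y : ι → ℂ} {L : List ι} (h : ∀ n ∈ L, x n = y n) (v : ι → Fin 2 → ℂ)
    (β : ℂ) : p.rowState v x β L = p.rowState v y β L := by
  induction L generalizing β with
  | nil => rfl
  | cons n L ih => rw [rowState, rowState, ih fun m hm => h m (by simp [hm]), h n (by simp)]

theorem colState_congr {x y : ι → ℂ} {L : List ι} (h : ∀ n ∈ L, x n = y n) (v : ι → Fin 2 → ℂ)
    (β : ℂ) : p.colState v x β L = p.colState v y β L := by
  induction L generalizing β with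
  | nil => rfl
  | cons n L ih => rw [colState, colState, ih fun m hm => h m (by simp [hm]), h n (by simp)]

/-- The bulk monodromy matrix with auxiliary site `a`. -/
def mono (x : ι → ℂ) (a : ι) (u : ℂ) : List ι → Matrix (ι → Fin 2) (ι → Fin 2) ℂ
  | [] => 1
  | n :: L => Rop p.η a n (u - x n - p.η / 2) * mono x a u L

/-- The bulk monodromy matrix with auxiliary site `a` in the opposite order. -/
def monoHat (x : ι → ℂ) (a : ι) (u : ℂ) : List ι → Matrix (ι → Fin 2) (ι → Fin 2) ℂ
  | [] => 1
  | n :: L => monoHat x a u L * Rop p.η a n (u + x n - p.η / 2)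

theorem bnd_eq_mono (x : ι → ℂ) (a : ι) (u : ℂ) (L : List ι) :
    p.bnd x a u L = p.mono x a u L * p.Kop a u * p.monoHat x a u L := by
  induction L with
  | nil => simp [bnd, mono, monoHat]
  | cons n L ih => rw [bnd, mono, monoHat, ih]; simp only [mul_assoc]

theorem emb1_commute_monoHat {i a : ι} {L : List ι} (x : ι → ℂ) (u : ℂ) (hia : i ≠ a)
    (hi : i ∉ L) (X : Matrix (Fin 2) (Fin 2) ℂ) : Commute (emb1 i X) (p.monoHat x a u L) := by
  induction L with
  | nil => exact Commute.one_right _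
  | cons n L ih =>
    simp only [List.mem_cons, not_or] at hi
    exact (ih hi.2).mul_right (emb1_emb2_commute hia hi.1 _ _)

/-- Every R-matrix exchanges the dynamical parameters of the auxiliary site and of one chain site:
each chain site goes down by one, and the auxiliary site climbs by the number of sites. -/
theorem rowState_vecMul_mono (v : ι → Fin 2 → ℂ) (x : ι → ℂ) {a : ι} {u l β β' : ℂ}
    (hl : l = -u + p.η / 2) (hβ : β' = β + 1) {L : List ι} (hL : L.Nodup) (ha : a ∉ L) :
    tprod (p.rowState (update v a (p.rowS l β)) x β' L) ᵥ* p.mono x a u L =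
      (L.map fun n => sinh (u - x n + p.η / 2)).prod •
        tprod (p.rowState (update v a (p.rowS l (β + L.length))) x β L) := by
  subst hl hβ
  induction L generalizing β v with
  | nil => simp [mono, rowState]
  | cons n L ih =>
    rw [List.nodup_cons] at hL
    simp only [List.mem_cons, not_or] at ha
    rw [mono, ← vecMul_vecMul, Rop_vecMul _ ha.1, rowState,
      p.Rop_mulVec_rowS ha.1 (l₁ := -u + p.η / 2) (l₂ := -x n) (β := β) (β' := β + 1)
        (by ring) rfl (by rw [update_of_ne ha.1, p.rowState_update ha.2, update_self])
        (by rw [update_self])]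
    -- Site `n` is not met again by the monodromy, so its new vector is absorbed into the background
    -- `v` and the induction continues with `β + 1` at the auxiliary site.
    have e1 : update (update (update (p.rowState (update v a (p.rowS (-u + p.η / 2) β)) x
        (β + 1 + 1) L) n (p.rowS (-x n) (β + 1))) a (p.rowS (-u + p.η / 2) (β + 1))) n
        (p.rowS (-x n) β) = p.rowState (update (update v n (p.rowS (-x n) β)) a
          (p.rowS (-u + p.η / 2) (β + 1))) x (β + 1 + 1) L := by
      rw [p.rowState_update ha.2, p.rowState_update ha.2, p.rowState_update hL.1]
      funext m
      simp only [update_apply]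
      grind
    have e2 : ∀ ρ, p.rowState (update (update v n (p.rowS (-x n) β)) a ρ) x (β + 1) L =
        p.rowState (update v a ρ) x β (n :: L) := fun ρ => by
      rw [rowState, ← p.rowState_update hL.1, update_comm ha.1]
    rw [e1, smul_vecMul, ih _ hL.2 ha.2, smul_smul, List.map_cons, List.prod_cons, e2,
      List.length_cons, show u - x n - p.η / 2 + p.η = u - x n + p.η / 2 by ring]
    push_cast
    rw [show β + 1 + (L.length : ℂ) = β + (L.length + 1) by ring]

theorem contract_monoHat (v : ι → Fin 2 → ℂ) (x : ι → ℂ) {a : ι} {u l β : ℂ}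
    (hl : l = u - p.η / 2) {L : List ι} (hL : L.Nodup) (ha : a ∉ L) :
    contract a (p.colS l β) (tprod (p.rowState v x β L) ᵥ* p.monoHat x a u L) =
      (L.map fun n => sinh (u + x n - p.η / 2)).prod •
        contract a (p.colS l (β + L.length)) (tprod (p.rowState v x (β - 1) L)) := by
  subst hl
  induction L generalizing β v with
  | nil => simp [monoHat, rowState]
  | cons n L ih =>
    rw [List.nodup_cons] at hL
    simp only [List.mem_cons, not_or] at ha
    rw [monoHat, ← vecMul_vecMul, rowState, p.contract_vecMul_Rop ha.1 (by ring)
      (p.emb1_commute_monoHat x u (Ne.symm ha.1) hL.1), ← p.rowState_update hL.1, ih _ hL.2 ha.2,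
      smul_smul, p.rowState_update hL.1, rowState, List.map_cons, List.prod_cons, List.length_cons]
    push_cast
    rw [show β + 1 + (L.length : ℂ) = β + (L.length + 1) by ring, add_sub_cancel_right,
      sub_add_cancel]

/-- The boundary contribution of a site whose inhomogeneity `w` changes sign. -/
def kFac (w β : ℂ) : ℂ := (p.rowS (-w) β ᵥ* p.Kminus (w + p.η / 2)) ⬝ᵥ p.colS w β

/-- The bulk part brings the row at `a` to `β + L.length`, and the contraction, moved leftwards
through the other bulk part, arrives with the same parameter; `K₋` between them gives `kFac`. The
remaining sites are lowered twice, from `β + 1` to `β - 1`, which is what the column state has after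
removal of its first site. -/
theorem contract_bnd (v : ι → Fin 2 → ℂ) (x : ι → ℂ) {a : ι} (β : ℂ) {L : List ι} (hL : L.Nodup)
    (ha : a ∉ L) :
    contract a (p.colS (x a) β)
        (tprod (p.rowState v x β (a :: L)) ᵥ* p.bnd x a (x a + p.η / 2) L) =
      ((L.map fun n => sinh (x a - x n + p.η) * sinh (x a + x n)).prod *
        p.kFac (x a) (β + L.length)) •
        tprod (p.rowState (update v a eDown) x (β - 1) L) := by
  rw [bnd_eq_mono, ← vecMul_vecMul, ← vecMul_vecMul, rowState, ← p.rowState_update ha,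
    p.rowState_vecMul_mono v x (by ring) rfl hL ha, smul_vecMul, smul_vecMul, Kop,
    tprod_vecMul_emb1, p.rowState_update ha, update_self, update_idem, ← p.rowState_update ha,
    contract_smul, p.contract_monoHat _ x (by ring) hL ha, contract_tprod, p.rowState_update ha,
    update_self, update_idem, ← p.rowState_update ha, smul_smul, smul_smul, List.prod_map_mul,
    kFac]
  simp only [show ∀ n, x a + p.η / 2 - x n + p.η / 2 = x a - x n + p.η from fun n => by ring,
    show ∀ n, x a + p.η / 2 + x n - p.η / 2 = x a + x n from fun n => by ring, mul_assoc]

theorem emb1_commute_sweep {a : ι} {L : List ι} (ha : a ∉ L) (x : ι → ℂ) (D : Finset ι)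
    (X : Matrix (Fin 2) (Fin 2) ℂ) : Commute (emb1 a X) (p.sweep x D L) := by
  induction L with
  | nil => exact Commute.one_right _
  | cons n L ih =>
    simp only [List.mem_cons, not_or] at ha
    rw [sweep]
    refine Commute.mul_right ?_ (ih ha.2)
    split_ifs
    · exact p.emb1_commute_bnd x _ ha.1 ha.2 X
    · exact Commute.one_right _

/-- The inhomogeneities with the signs of those in `D` reversed. -/
def flipSet (x : ι → ℂ) (D : Finset ι) : ι → ℂ := fun i => if i ∈ D then -x i else x i

/-- The matrix element of the complete reflection between the reference states. -/
def reflFac (x : ι → ℂ) : ℂ → List ι → ℂ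
  | _, [] => 1
  | β, j :: L => (L.map fun n => sinh (x j - x n + p.η) * sinh (x j + x n)).prod *
      p.kFac (x j) (β + L.length) * reflFac x (β - 1) L

/-- The sites are removed from the outermost inwards. An unreversed site carries a row and a column
gauge vector with equal arguments, which are orthogonal; a reversed one is evaluated by
`contract_bnd`. The backgrounds `v` and `w` store the sites already removed. -/
theorem rowState_sweep_colState (x : ι → ℂ) (D : Finset ι) {L : List ι} (hL : L.Nodup) (β : ℂ)
    (v w : ι → Fin 2 → ℂ) (hvw : ∀ i ∉ L, v i ⬝ᵥ w i = 1) :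
    tprod (p.rowState v x β L) ⬝ᵥ (p.sweep x D L *ᵥ tprod (p.colState w (flipSet x D) β L)) =
      if ∀ j ∈ L, j ∈ D then p.reflFac x β L else 0 := by
  induction L generalizing β v w with
  | nil =>
    simp only [rowState, colState, sweep, one_mulVec, tprod_dotProduct, reflFac]
    simp [hvw]
  | cons j L ih =>
    have hL' := List.nodup_cons.mp hL
    have hc : p.colState w (flipSet x D) β (j :: L) =
        p.colState (update w j (p.colS (-flipSet x D j) β)) (flipSet x D) (β - 1) L := by
      rw [colState, p.colState_update hL'.1]
    have hj : p.colState w (flipSet x D) β (j :: L) j = p.colS (-flipSet x D j) β := by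
      rw [colState, update_self]
    have hj1 : p.colState w (flipSet x D) β (j :: L) j 1 = 1 := by
      rw [hj]; simp [colS]
    rw [sweep]
    by_cases hD : j ∈ D
    · have hx : flipSet x D j = -x j := if_pos hD
      rw [if_pos hD, ← mulVec_mulVec, dotProduct_mulVec,
        dotProduct_eq_contract hj1 (p.emb1_commute_sweep hL'.1 x D), hj, hx, neg_neg,
        p.contract_bnd v x β hL'.2 hL'.1, hc, hx, neg_neg, smul_dotProduct, ih hL'.2]
      · simp only [List.mem_cons, forall_eq_or_imp, hD, true_and, reflFac, smul_eq_mul]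
        split_ifs <;> simp
      -- The removed site now carries `eDown` in the row, which pairs to 1 with the gauge column
      -- because the lower entry of the latter is 1.
      · intro i hi
        by_cases hij : i = j
        · subst hij
          simp [eDown, colS, dotProduct, Fin.sum_univ_two]
        · rw [update_of_ne hij, update_of_ne hij]
          exact hvw i (by simp [hij, hi])
    · have hx : flipSet x D j = x j := if_neg hD
      rw [if_neg hD, one_mul, dotProduct_eq_contract hj1 (p.emb1_commute_sweep hL'.1 x D), hj, hx,
        contract_tprod, rowState, update_self, rowS_dotProduct_colS, zero_smul, zero_dotProduct,
        if_neg]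
      simp [hD]

end Chain

end GaugeStates

/-! ### Action of the boundary matrix on the reference states at the special points -/

section ReferenceAction

set_option linter.unusedSectionVars false

variable {ι : Type*} [Fintype ι] [DecidableEq ι]

namespace Chain

variable {N : ℕ} (p : Chain N)

/-- The factor produced by `A₋(η/2 - x_j)` on the left reference state. -/
def rowFac (x : ι → ℂ) (j : ι) : List ι → ℂ
  | [] => 1
  | n :: L => if n = j then sinh (p.η - 2 * x j) * sinh p.η else
      sinh (p.η - x j - x n) * sinh (p.η - x j + x n) * rowFac x j L

/-- The factor produced by `D₋(x_j + η/2)` on the right reference state. -/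
def colFac (x : ι → ℂ) (j : ι) : List ι → ℂ
  | [] => 1
  | n :: L => if n = j then sinh (p.η + 2 * x j) * sinh p.η else
      sinh (p.η + x j + x n) * sinh (p.η + x j - x n) * colFac x j L

/-- For a site outside `j`, the first R-matrix exchanges two dynamical parameters; the second
commutes with the reversal produced inside and exchanges them back, now with `x j` reversed. At `j`
itself the second R-matrix is an exchange. Sites inside `j` stay within the reversal and contribute
no scalar, which explains the form of `rowFac`. -/
theorem rowState_vecMul_bnd (v : ι → Fin 2 → ℂ) (x : ι → ℂ) {a j : ι} {L : List ι} (hL : L.Nodup)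
    (ha : a ∉ L) (hj : j ∈ L) {β β' : ℂ} (hβ : β = β' + 1) :
    tprod (p.rowState (update v a (p.rowS (x j) β')) x β L) ᵥ* p.bnd x a (p.η / 2 - x j) L =
      p.rowFac x j L • (tprod (p.rowState (update v a (p.rowS (-x j) β')) (flip x j) β L) ᵥ*
        p.refl (flip x j) j L) := by
  induction L generalizing β β' v with
  | nil => simp at hj
  | cons n L ih =>
    rw [List.nodup_cons] at hL
    simp only [List.mem_cons, not_or] at ha
    have han := ha.1
    have hva : p.rowState (update v a (p.rowS (x j) β')) x β (n :: L) a = p.rowS (x j) β' := by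
      rw [rowState, update_of_ne han, p.rowState_update ha.2, update_self]
    have hvn : p.rowState (update v a (p.rowS (x j) β')) x β (n :: L) n = p.rowS (-x n) β := by
      rw [rowState, update_self]
    rw [bnd, ← vecMul_vecMul, ← vecMul_vecMul,
      Rop_vecMul _ han (p.η / 2 - x j - x n - p.η / 2),
      p.Rop_mulVec_rowS han (l₁ := x j) (l₂ := -x n) (by ring) hβ hva hvn, smul_vecMul, smul_vecMul]
    by_cases hn : n = j
    · subst hn
      -- The exchange, moved through the inner boundary matrix, makes `n` its auxiliary site: the
      -- matrix becomes the reversal of `n`, and the vectors at `a` and `n` trade places.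
      rw [show p.η / 2 - x n + x n - p.η / 2 = 0 by ring, Rop_zero _ han, vecMul_vecMul,
        mul_smul_comm, emb2_swap han swapMat (fun x y => by simp [swapMat, Prod.swap_eq_iff_eq_swap]),
        ← p.swap_bnd x (Ne.symm han) _ hL.1 ha.2, vecMul_smul, ← vecMul_vecMul,
        tprod_vecMul_swapMat (Ne.symm han), smul_smul, rowFac, if_pos rfl, refl, if_pos rfl,
        flip_self, p.bnd_flip x n _ hL.1, show -x n + p.η / 2 = p.η / 2 - x n by ring,
        show p.η / 2 - x n - x n - p.η / 2 + p.η = p.η - 2 * x n by ring]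
      congr 3
      rw [rowState, rowState, p.rowState_congr (y := x) (fun m hm => flip_of_ne x (by
        rintro rfl; exact hL.1 hm)), p.rowState_update ha.2, p.rowState_update ha.2, flip_self,
        neg_neg]
      funext m
      simp only [update_apply]
      grind
    · have hj' : j ∈ L := by simpa [Ne.symm hn] using hj
      have e1 : update (update (p.rowState (update v a (p.rowS (x j) β')) x β (n :: L)) a
          (p.rowS (x j) β)) n (p.rowS (-x n) β') = p.rowState (update (update v n
            (p.rowS (-x n) β')) a (p.rowS (x j) β)) x (β + 1) L := by
        rw [rowState, p.rowState_update ha.2, p.rowState_update ha.2, p.rowState_update hL.1]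
        funext m
        simp only [update_apply]
        grind
      rw [e1, ih _ hL.2 ha.2 hj' rfl, refl, if_neg hn, smul_vecMul, vecMul_vecMul,
        ← (p.Rop_commute_refl ha.2 hL.1 _ _ _).eq, ← vecMul_vecMul, Rop_symm _ han,
        Rop_vecMul _ (Ne.symm han),
        p.Rop_mulVec_rowS (Ne.symm han) (l₁ := -x n) (l₂ := -x j) (β := β') (β' := β) (by ring) hβ,
        smul_vecMul, smul_smul, smul_smul, rowFac, if_neg hn]
      · congr 1
        · rw [show p.η / 2 - x j - x n - p.η / 2 + p.η = p.η - x j - x n by ring,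
            show p.η / 2 - x j + x n - p.η / 2 + p.η = p.η - x j + x n by ring]
          ring
        · congr 2
          rw [rowState, p.rowState_update ha.2, p.rowState_update ha.2, p.rowState_update hL.1,
            flip_of_ne x hn]
          funext m
          simp only [update_apply]
          grind
      · rw [p.rowState_update ha.2, p.rowState_update hL.1, update_of_ne (Ne.symm han),
          update_self]
      · rw [p.rowState_update ha.2, update_self]

theorem bnd_mulVec_colState (w : ι → Fin 2 → ℂ) (x : ι → ℂ) {a j : ι} {L : List ι} (hL : L.Nodup)
    (ha : a ∉ L) (hj : j ∈ L) {β β' : ℂ} (hβ : β' = β + 1) :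
    p.bnd x a (x j + p.η / 2) L *ᵥ tprod (p.colState (update w a (p.colS (x j) β')) x β L) =
      p.colFac x j L • (p.refl x j L *ᵥ
        tprod (p.colState (update w a (p.colS (-x j) β')) (flip x j) β L)) := by
  induction L generalizing β β' w with
  | nil => simp at hj
  | cons n L ih =>
    rw [List.nodup_cons] at hL
    simp only [List.mem_cons, not_or] at ha
    have han := ha.1
    have hva : p.colState (update w a (p.colS (x j) β')) x β (n :: L) a = p.colS (x j) β' := by
      rw [colState, update_of_ne han, p.colState_update ha.2, update_self]
    have hvn : p.colState (update w a (p.colS (x j) β')) x β (n :: L) n = p.colS (-x n) β := by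
      rw [colState, update_self]
    rw [bnd, ← mulVec_mulVec, ← mulVec_mulVec,
      p.Rop_mulVec_colS han (l₁ := x j) (l₂ := -x n) (by ring) hβ hva hvn, mulVec_smul, mulVec_smul]
    by_cases hn : n = j
    · subst hn
      rw [show x n + p.η / 2 - x n - p.η / 2 = 0 by ring, Rop_zero _ han, mulVec_mulVec,
        smul_mul_assoc, p.swap_bnd x han _ ha.2 hL.1, smul_mulVec, ← mulVec_mulVec,
        swapMat_mulVec_tprod han, smul_smul, colFac, if_pos rfl, refl, if_pos rfl,
        show x n + p.η / 2 + x n - p.η / 2 + p.η = p.η + 2 * x n by ring]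
      congr 3
      rw [colState, colState, p.colState_congr (y := x) (fun m hm => flip_of_ne x (by
        rintro rfl; exact hL.1 hm)), p.colState_update ha.2, p.colState_update ha.2, flip_self,
        neg_neg]
      funext m
      simp only [update_apply]
      grind
    · have hj' : j ∈ L := by simpa [Ne.symm hn] using hj
      have e1 : update (update (p.colState (update w a (p.colS (x j) β')) x β (n :: L)) a
          (p.colS (x j) β)) n (p.colS (-x n) β') = p.colState (update (update w n
            (p.colS (-x n) β')) a (p.colS (x j) β)) x (β - 1) L := by
        rw [colState, p.colState_update ha.2, p.colState_update ha.2, p.colState_update hL.1]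
        funext m
        simp only [update_apply]
        grind
      rw [e1, ih _ hL.2 ha.2 hj' (by ring), refl, if_neg hn, mulVec_smul, mulVec_mulVec,
        (p.Rop_commute_refl ha.2 hL.1 _ _ _).eq, ← mulVec_mulVec, Rop_symm _ han,
        p.Rop_mulVec_colS (Ne.symm han) (l₁ := -x n) (l₂ := -x j) (β := β') (β' := β) (by ring) hβ,
        mulVec_smul, smul_smul, smul_smul, colFac, if_neg hn]
      · congr 1
        · rw [show x j + p.η / 2 - x n - p.η / 2 + p.η = p.η + x j - x n by ring,
            show x j + p.η / 2 + x n - p.η / 2 + p.η = p.η + x j + x n by ring]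
          ring
        · congr 2
          rw [colState, p.colState_update ha.2, p.colState_update ha.2, p.colState_update hL.1,
            flip_of_ne x hn]
          funext m
          simp only [update_apply]
          grind
      · rw [p.colState_update ha.2, p.colState_update hL.1, update_of_ne (Ne.symm han),
          update_self]
      · rw [p.colState_update ha.2, update_self]

end Chain

end ReferenceAction

/-! ### Block matrices as operators on the chain with one additional site `none` -/

section AuxiliarySite

variable {N : ℕ}

/-- A family indexed by the sites of the chain, extended by a value at the auxiliary site. -/
def withAux {α : Type*} (a : α) (v : Fin N → α) : Option (Fin N) → α := fun o => o.elim a v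

@[simp] theorem withAux_none {α : Type*} (a : α) (v : Fin N → α) : withAux a v none = a := rfl

@[simp] theorem withAux_some {α : Type*} (a : α) (v : Fin N → α) (i : Fin N) :
    withAux a v (some i) = v i := rfl

theorem withAux_self {α : Type*} (h : Option (Fin N) → α) :
    withAux (h none) (fun i => h (some i)) = h := by
  funext o
  cases o <;> rfl

@[simp] theorem update_withAux_none {α : Type*} (a b : α) (v : Fin N → α) :
    update (withAux a v) none b = withAux b v := by
  funext o
  cases o <;> simp

@[simp] theorem update_withAux_some {α : Type*} (a b : α) (v : Fin N → α) (i : Fin N) :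
    update (withAux a v) (some i) b = withAux a (update v i b) := by
  funext o
  cases o with
  | none => simp
  | some j => simp [update_apply]

theorem withAux_inj {α : Type*} {a b : α} {v w : Fin N → α} :
    withAux a v = withAux b w ↔ a = b ∧ v = w :=
  ⟨fun h => ⟨congrFun h none, funext fun i => congrFun h (some i)⟩, by rintro ⟨rfl, rfl⟩; rfl⟩

theorem sum_withAux (f : (Option (Fin N) → Fin 2) → ℂ) :
    ∑ h, f h = ∑ a, ∑ h : Conf N, f (withAux a h) := by
  rw [← Fintype.sum_prod_type']
  refine Fintype.sum_equiv (Equiv.piOptionEquivProd (β := fun _ => Fin 2)) _ _ fun h => ?_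
  exact congrArg f (withAux_self h).symm

/-- The block matrix of an operator on the chain with the auxiliary site. -/
def blk (X : Matrix (Option (Fin N) → Fin 2) (Option (Fin N) → Fin 2) ℂ) : AuxOp N :=
  Matrix.of fun a b => Matrix.of fun h k => X (withAux a h) (withAux b k)

theorem blk_mul (X Y : Matrix (Option (Fin N) → Fin 2) (Option (Fin N) → Fin 2) ℂ) :
    blk (X * Y) = blk X * blk Y := by
  ext a b h k
  simp only [blk, Matrix.mul_apply, Matrix.of_apply, Matrix.sum_apply, sum_withAux]

theorem blk_one : blk (1 : Matrix (Option (Fin N) → Fin 2) (Option (Fin N) → Fin 2) ℂ) = 1 := by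
  ext a b h k
  simp only [blk, Matrix.of_apply, Matrix.one_apply, withAux_inj]
  by_cases hab : a = b <;> simp [hab, Matrix.one_apply]

theorem onSite_eq_emb1 (n : Fin N) (X : Matrix (Fin 2) (Fin 2) ℂ) : onSite n X = emb1 n X := by
  ext h k
  rw [emb1_apply, onSite, Matrix.of_apply]
  split_ifs <;> rfl

theorem blk_emb1_none (K : Matrix (Fin 2) (Fin 2) ℂ) :
    blk (emb1 (none : Option (Fin N)) K) = onAux N K := by
  ext a b h k
  simp only [blk, onAux, Matrix.of_apply, emb1, withAux_none, update_withAux_none, withAux_inj,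
    Matrix.map_apply, Matrix.smul_apply, Matrix.one_apply, smul_eq_mul]
  by_cases hk : h = k
  · subst hk; simp
  · simp [hk, Ne.symm hk]

theorem blk_emb1_some (i : Fin N) (K : Matrix (Fin 2) (Fin 2) ℂ) :
    blk (emb1 (some i) K) = Matrix.diagonal fun _ => emb1 i K := by
  ext a b h k
  simp only [blk, Matrix.of_apply, emb1, withAux_some, update_withAux_some, withAux_inj,
    Matrix.diagonal_apply]
  by_cases hab : a = b
  · subst hab; simp
  · simp [hab, Ne.symm hab]

theorem blk_emb2_some (i j : Fin N) (X : Matrix (Fin 2 × Fin 2) (Fin 2 × Fin 2) ℂ) :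
    blk (emb2 (some i) (some j) X) = Matrix.diagonal fun _ => emb2 i j X := by
  ext a b h k
  simp only [blk, Matrix.of_apply, emb2, withAux_some, update_withAux_some, withAux_inj,
    Matrix.diagonal_apply]
  by_cases hab : a = b
  · subst hab; simp
  · simp [hab, Ne.symm hab]

theorem blk_emb2_none (j : Fin N) (X : Matrix (Fin 2 × Fin 2) (Fin 2 × Fin 2) ℂ) :
    blk (emb2 none (some j) X) =
      Matrix.of fun a b => onSite j (Matrix.of fun s t => X (a, s) (b, t)) := by
  ext a b h k
  simp only [blk, Matrix.of_apply, emb2, withAux_some, withAux_none, update_withAux_none,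
    update_withAux_some, withAux_inj, onSite_eq_emb1, emb1]
  rw [Finset.sum_eq_single b]
  · simp
  · intro s _ hs
    simp [Ne.symm hs]
  · simp

/-- The contraction of the auxiliary site of a block matrix with a row and a column vector. -/
def sandwich (ρ : Fin 2 → ℂ) (X : AuxOp N) (χ : Fin 2 → ℂ) : Op N :=
  ∑ a, ∑ b, (ρ a * χ b) • X a b

theorem sandwich_smul_left (c : ℂ) (ρ : Fin 2 → ℂ) (X : AuxOp N) (χ : Fin 2 → ℂ) :
    sandwich (c • ρ) X χ = c • sandwich ρ X χ := by
  simp only [sandwich, Finset.smul_sum, smul_smul, Pi.smul_apply, smul_eq_mul, mul_assoc]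

theorem sandwich_diagonal (ρ χ : Fin 2 → ℂ) (W : Op N) :
    sandwich ρ (Matrix.diagonal fun _ => W) χ = (ρ ⬝ᵥ χ) • W := by
  simp [sandwich, dotProduct, Fin.sum_univ_two, add_smul]

theorem sandwich_mul_diagonal (ρ χ : Fin 2 → ℂ) (X : AuxOp N) (W : Op N) :
    sandwich ρ (X * Matrix.diagonal fun _ => W) χ = sandwich ρ X χ * W := by
  simp only [sandwich, Matrix.mul_diagonal, Finset.sum_mul, smul_mul_assoc]

theorem sandwich_diagonal_mul (ρ χ : Fin 2 → ℂ) (X : AuxOp N) (W : Op N) :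
    sandwich ρ ((Matrix.diagonal fun _ => W) * X) χ = W * sandwich ρ X χ := by
  simp only [sandwich, Matrix.diagonal_mul, Finset.mul_sum, mul_smul_comm]

theorem tprod_withAux (ρ : Fin 2 → ℂ) (v : Fin N → Fin 2 → ℂ) (a : Fin 2) (h : Conf N) :
    tprod (withAux ρ v) (withAux a h) = ρ a * tprod v h := by
  simp [tprod, Fintype.prod_option]

theorem tprod_vecMul_sandwich (ρ χ : Fin 2 → ℂ) (v : Fin N → Fin 2 → ℂ)
    (X : Matrix (Option (Fin N) → Fin 2) (Option (Fin N) → Fin 2) ℂ) (k : Conf N) :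
    (tprod v ᵥ* sandwich ρ (blk X) χ) k =
      ∑ b, χ b * (tprod (withAux ρ v) ᵥ* X) (withAux b k) := by
  simp only [Matrix.vecMul, dotProduct, sum_withAux, tprod_withAux, sandwich, Matrix.sum_apply,
    Matrix.add_apply, Matrix.smul_apply, blk, Matrix.of_apply, smul_eq_mul, Fin.sum_univ_two]
  simp only [← Finset.sum_add_distrib, Finset.mul_sum]
  exact Finset.sum_congr rfl fun h _ => by ring

theorem sandwich_mulVec_tprod (ρ χ : Fin 2 → ℂ) (w : Fin N → Fin 2 → ℂ)
    (X : Matrix (Option (Fin N) → Fin 2) (Option (Fin N) → Fin 2) ℂ) (h : Conf N) :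
    (sandwich ρ (blk X) χ *ᵥ tprod w) h =
      ∑ a, ρ a * (X *ᵥ tprod (withAux χ w)) (withAux a h) := by
  simp only [Matrix.mulVec, dotProduct, sum_withAux, tprod_withAux, sandwich, Matrix.sum_apply,
    Matrix.add_apply, Matrix.smul_apply, blk, Matrix.of_apply, smul_eq_mul, Fin.sum_univ_two]
  simp only [← Finset.sum_add_distrib, Finset.mul_sum]
  exact Finset.sum_congr rfl fun h _ => by ring

theorem vecMul_sandwich_congr {ρ ρ' : Fin 2 → ℂ} (χ : Fin 2 → ℂ) {v v' : Fin N → Fin 2 → ℂ}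
    {X Y : Matrix (Option (Fin N) → Fin 2) (Option (Fin N) → Fin 2) ℂ} {c : ℂ}
    (h : tprod (withAux ρ v) ᵥ* X = c • (tprod (withAux ρ' v') ᵥ* Y)) :
    tprod v ᵥ* sandwich ρ (blk X) χ = c • (tprod v' ᵥ* sandwich ρ' (blk Y) χ) := by
  funext k
  simp only [tprod_vecMul_sandwich, h, Pi.smul_apply, smul_eq_mul, Finset.mul_sum]
  exact Finset.sum_congr rfl fun b _ => by ring

theorem sandwich_mulVec_congr (ρ : Fin 2 → ℂ) {χ χ' : Fin 2 → ℂ} {w w' : Fin N → Fin 2 → ℂ}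
    {X Y : Matrix (Option (Fin N) → Fin 2) (Option (Fin N) → Fin 2) ℂ} {c : ℂ}
    (h : X *ᵥ tprod (withAux χ w) = c • (Y *ᵥ tprod (withAux χ' w'))) :
    sandwich ρ (blk X) χ *ᵥ tprod w = c • (sandwich ρ (blk Y) χ' *ᵥ tprod w') := by
  funext k
  simp only [sandwich_mulVec_tprod, h, Pi.smul_apply, smul_eq_mul, Finset.mul_sum]
  exact Finset.sum_congr rfl fun b _ => by ring

/-- The sites of the chain, the last one first. -/
def sites (N : ℕ) : List (Fin N) := (List.finRange N).reverse

theorem nodup_sites (N : ℕ) : (sites N).Nodup := List.nodup_reverse.mpr (List.nodup_finRange N)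

theorem mem_sites (j : Fin N) : j ∈ sites N := by simp [sites]

theorem ofFn_rev {α : Type*} (f : Fin N → α) :
    List.ofFn (fun i : Fin N => f i.rev) = (sites N).map f := by
  rw [sites, List.ofFn_eq_map, List.finRange_reverse, List.map_map]
  rfl

namespace Chain

variable (p : Chain N)

theorem blk_Rop_none (j : Fin N) (u : ℂ) : blk (Rop p.η none (some j) u) = p.R0 j u :=
  blk_emb2_none j _

theorem blk_mono (x : Fin N → ℂ) (c u : ℂ) (L : List (Fin N)) :
    blk (p.mono (withAux c x) none u (L.map some)) =
      (L.map fun n => p.R0 n (u - x n - p.η / 2)).prod := by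
  induction L with
  | nil => exact blk_one
  | cons n L ih =>
    simp only [List.map_cons, List.prod_cons, mono, blk_mul, blk_Rop_none, ih, withAux_some]

theorem conj_mul_conj {M : Type*} [Monoid M] {Y : M} (hY : Y * Y = 1) (A B : M) :
    Y * (A * B) * Y = Y * A * Y * (Y * B * Y) := by
  calc Y * (A * B) * Y = Y * A * (Y * Y) * B * Y := by rw [hY, mul_one]; simp only [mul_assoc]
    _ = Y * A * Y * (Y * B * Y) := by simp only [mul_assoc]

/-- The partial transpose in the auxiliary space reverses a product only if the entries of the
factors commute; they do because the factors live on different sites. -/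
theorem commute_prod_R0 {n : Fin N} {L : List (Fin N)} (hn : n ∉ L) (f : Fin N → ℂ)
    (Z : Matrix (Fin 2) (Fin 2) ℂ) (a b : Fin 2) :
    Commute (onSite n Z) ((L.map fun m => p.R0 m (f m)).prod a b) := by
  induction L generalizing a with
  | nil =>
    simp only [List.map_nil, List.prod_nil, Matrix.one_apply]
    split_ifs
    · exact Commute.one_right _
    · exact Commute.zero_right _
  | cons m L ih =>
    simp only [List.mem_cons, not_or] at hn
    simp only [List.map_cons, List.prod_cons, Matrix.mul_apply]
    refine Commute.sum_right _ _ _ fun c _ => Commute.mul_right ?_ (ih hn.2 c)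
    rw [R0, Matrix.of_apply, onSite_eq_emb1, onSite_eq_emb1]
    exact emb1_commute hn.1 _ _

theorem onAux_pauliY_mul_self : onAux N pauliY * onAux N pauliY = 1 := by
  rw [← blk_emb1_none, ← blk_mul, emb1_mul]
  have : pauliY * pauliY = 1 := by
    ext a b
    fin_cases a <;> fin_cases b <;> simp [pauliY, Matrix.mul_apply, Fin.sum_univ_two]
  rw [this, emb1_one, blk_one]

/-- Crossing symmetry of the six-vertex R-matrix. -/
theorem neg_pauliY_conj_R0 (n : Fin N) {u v : ℂ} (h : v = -u - p.η) :
    (-1 : ℂ) • (onAux N pauliY * (p.R0 n v).transpose * onAux N pauliY) = p.R0 n u := by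
  subst h
  have h1 : sinh (-u - p.η) = -sinh (u + p.η) := by rw [← sinh_neg]; ring_nf
  have hI : ∀ z : ℂ, Complex.I * (Complex.I * z) = -z := fun z => by
    rw [← mul_assoc, Complex.I_mul_I, neg_one_mul]
  ext a b h k
  fin_cases a <;> fin_cases b <;>
  simp [Matrix.mul_apply, Fin.sum_univ_two, onAux, pauliY, R0, onSite_eq_emb1, emb1_apply, hI] <;>
  split_ifs <;> generalize h n = s <;> generalize k n = t <;> fin_cases s <;> fin_cases t <;>
  simp [Rmat, h1]

/-- The partial transpose reverses the order of the factors, and each of them then uses one sign of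
`(-1)^N` in the crossing relation, since `-u - x n - η/2 = -(u + x n - η/2) - η`. -/
theorem blk_monoHat (x : Fin N → ℂ) (c u : ℂ) {L : List (Fin N)} (hL : L.Nodup) :
    blk (p.monoHat (withAux c x) none u (L.map some)) = (-1 : ℂ) ^ L.length • (onAux N pauliY *
      ((L.map fun n => p.R0 n (-u - x n - p.η / 2)).prod).transpose * onAux N pauliY) := by
  induction L with
  | nil =>
    simp [monoHat, blk_one, onAux_pauliY_mul_self]
  | cons n L ih =>
    rw [List.nodup_cons] at hL
    have ht : (p.R0 n (-u - x n - p.η / 2) *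
        (L.map fun n => p.R0 n (-u - x n - p.η / 2)).prod).transpose =
        ((L.map fun n => p.R0 n (-u - x n - p.η / 2)).prod).transpose *
          (p.R0 n (-u - x n - p.η / 2)).transpose := by
      ext a b : 1
      simp only [Matrix.transpose_apply, Matrix.mul_apply]
      refine Finset.sum_congr rfl fun c _ => ?_
      exact (p.commute_prod_R0 hL.1 _ _ _ _).eq
    simp only [List.map_cons, List.prod_cons, monoHat, blk_mul, blk_Rop_none, ih hL.2,
      withAux_some, List.length_cons, ht]
    rw [← p.neg_pauliY_conj_R0 n (u := u + x n - p.η / 2) (v := -u - x n - p.η / 2) (by ring)]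
    generalize ((L.map fun n => p.R0 n (-u - x n - p.η / 2)).prod).transpose = A
    generalize (p.R0 n (-u - x n - p.η / 2)).transpose = B
    rw [pow_succ, mul_smul, conj_mul_conj onAux_pauliY_mul_self, smul_mul_smul_comm, mul_smul]

/-- The boundary monodromy matrix with inhomogeneities `x`. -/
def Ublk (x : Fin N → ℂ) (u : ℂ) : AuxOp N :=
  -- The 0 is an idle inhomogeneity at the auxiliary site, which enters no factor.
  blk (p.bnd (withAux 0 x) none u ((sites N).map some))

theorem Uminus_eq_Ublk (u : ℂ) : p.Uminus u = p.Ublk p.ξ u := by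
  rw [Ublk, bnd_eq_mono, blk_mul, blk_mul, blk_mono, p.blk_monoHat _ _ _ (nodup_sites N), Kop,
    blk_emb1_none, Uminus, Mhat, M, M, ofFn_rev (fun i => p.R0 i (u - p.ξ i - p.η / 2)),
    ofFn_rev (fun i => p.R0 i (-u - p.ξ i - p.η / 2))]
  simp [sites]

theorem blk_bnd_some (x : Fin N → ℂ) (c u : ℂ) (i : Fin N) (L : List (Fin N)) :
    blk (p.bnd (withAux c x) (some i) u (L.map some)) =
      Matrix.diagonal fun _ => p.bnd x i u L := by
  induction L with
  | nil => exact blk_emb1_some i _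
  | cons n L ih =>
    simp only [List.map_cons, bnd, blk_mul, ih, withAux_some, Rop, blk_emb2_some,
      Matrix.diagonal_mul_diagonal]

theorem blk_refl_some (x : Fin N → ℂ) (c : ℂ) (j : Fin N) (L : List (Fin N)) :
    blk (p.refl (withAux c x) (some j) (L.map some)) = Matrix.diagonal fun _ => p.refl x j L := by
  induction L with
  | nil =>
    simp only [List.map_nil, refl, blk_one]
    exact Matrix.diagonal_one.symm
  | cons n L ih =>
    simp only [List.map_cons, refl, Option.some.injEq, withAux_some]
    split_ifs
    · exact p.blk_bnd_some x c _ j L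
    · exact ih

theorem rowState_withAux (ρ : Fin 2 → ℂ) (v : Fin N → Fin 2 → ℂ) (x : Fin N → ℂ) (c β : ℂ)
    (L : List (Fin N)) :
    p.rowState (withAux ρ v) (withAux c x) β (L.map some) = withAux ρ (p.rowState v x β L) := by
  induction L generalizing β with
  | nil => rfl
  | cons n L ih => simp [rowState, ih]

theorem colState_withAux (ρ : Fin 2 → ℂ) (v : Fin N → Fin 2 → ℂ) (x : Fin N → ℂ) (c β : ℂ)
    (L : List (Fin N)) :
    p.colState (withAux ρ v) (withAux c x) β (L.map some) = withAux ρ (p.colState v x β L) := by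
  induction L generalizing β with
  | nil => rfl
  | cons n L ih => simp [colState, ih]

theorem rowFac_withAux (x : Fin N → ℂ) (c : ℂ) (j : Fin N) (L : List (Fin N)) :
    p.rowFac (withAux c x) (some j) (L.map some) = p.rowFac x j L := by
  induction L with
  | nil => rfl
  | cons n L ih => simp [rowFac, ih]

theorem colFac_withAux (x : Fin N → ℂ) (c : ℂ) (j : Fin N) (L : List (Fin N)) :
    p.colFac (withAux c x) (some j) (L.map some) = p.colFac x j L := by
  induction L with
  | nil => rfl
  | cons n L ih => simp [colFac, ih]

theorem flip_withAux (x : Fin N → ℂ) (c : ℂ) (j : Fin N) :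
    flip (withAux c x) (some j) = withAux c (flip x j) := by
  simp [flip]

theorem nodup_map_some_sites : ((sites N).map some).Nodup :=
  (nodup_sites N).map (Option.some_injective _)

theorem Ublk_mul_refl (x : Fin N → ℂ) (u : ℂ) (j : Fin N) (ρ χ : Fin 2 → ℂ) :
    sandwich ρ (p.Ublk x u) χ * p.refl x j (sites N) =
      p.refl x j (sites N) * sandwich ρ (p.Ublk (flip x j) u) χ := by
  have := congrArg blk (p.bnd_mul_refl (withAux 0 x) (a := none) (j := some j) u
    nodup_map_some_sites (by simp) (List.mem_map_of_mem (mem_sites j)))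
  rw [blk_mul, blk_mul, blk_refl_some, flip_withAux] at this
  rw [← sandwich_mul_diagonal, ← sandwich_diagonal_mul, Ublk, Ublk, this]

theorem rowState_vecMul_Ublk (v : Fin N → Fin 2 → ℂ) (x : Fin N → ℂ) (j : Fin N) (β : ℂ)
    (χ : Fin 2 → ℂ) :
    tprod (p.rowState v x β (sites N)) ᵥ*
        sandwich (p.rowS (x j) (β - 1)) (p.Ublk x (p.η / 2 - x j)) χ =
      (p.rowFac x j (sites N) * (p.rowS (-x j) (β - 1) ⬝ᵥ χ)) •
        (tprod (p.rowState v (flip x j) β (sites N)) ᵥ* p.refl (flip x j) j (sites N)) := by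
  have := p.rowState_vecMul_bnd (withAux 0 v) (withAux 0 x) (a := none) (j := some j)
    nodup_map_some_sites (by simp) (List.mem_map_of_mem (mem_sites j)) (β := β) (β' := β - 1)
    (by ring)
  rw [update_withAux_none, update_withAux_none, flip_withAux, rowState_withAux, rowState_withAux,
    rowFac_withAux] at this
  have h := vecMul_sandwich_congr χ this
  rw [blk_refl_some, sandwich_diagonal, vecMul_smul, smul_smul] at h
  exact h

theorem Ublk_mulVec_colState (w : Fin N → Fin 2 → ℂ) (x : Fin N → ℂ) (j : Fin N) (β : ℂ)
    (ρ : Fin 2 → ℂ) :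
    sandwich ρ (p.Ublk x (x j + p.η / 2)) (p.colS (x j) (β + 1)) *ᵥ
        tprod (p.colState w x β (sites N)) =
      (p.colFac x j (sites N) * (ρ ⬝ᵥ p.colS (-x j) (β + 1))) •
        (p.refl x j (sites N) *ᵥ tprod (p.colState w (flip x j) β (sites N))) := by
  have := p.bnd_mulVec_colState (withAux 0 w) (withAux 0 x) (a := none) (j := some j)
    nodup_map_some_sites (by simp) (List.mem_map_of_mem (mem_sites j)) (β := β) (β' := β + 1) rfl
  rw [update_withAux_none, update_withAux_none, flip_withAux, colState_withAux, colState_withAux,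
    colFac_withAux] at this
  have h := sandwich_mulVec_congr ρ this
  rw [blk_refl_some, sandwich_diagonal, smul_mulVec, smul_smul] at h
  exact h

end Chain

end AuxiliarySite

/-! ### The bulk gauge transformation and the gauged reference states -/

section Gauge

variable {N : ℕ}

/-- The spin-up local state. -/
def eUp : Fin 2 → ℂ := ![1, 0]

theorem refUp_eq_tprod : refUp N = tprod fun _ => eUp := by
  funext h
  by_cases hh : h = fun _ => 0
  · subst hh; simp [refUp, tprod, eUp]
  · obtain ⟨i, hi⟩ := Function.ne_iff.mp hh
    rw [refUp, Pi.single_eq_of_ne hh, tprod, Finset.prod_eq_zero (Finset.mem_univ i)]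
    have : h i = 1 := by omega
    simp [this, eUp]

theorem refDown_eq_tprod : refDown N = tprod fun _ => eDown := by
  funext h
  by_cases hh : h = fun _ => 1
  · subst hh; simp [refDown, tprod, eDown]
  · obtain ⟨i, hi⟩ := Function.ne_iff.mp hh
    rw [refDown, Pi.single_eq_of_ne hh, tprod, Finset.prod_eq_zero (Finset.mem_univ i)]
    have : h i = 0 := by omega
    simp [this, eDown]

theorem tprod_eq_zero {v : Fin N → Fin 2 → ℂ} {h : Conf N} (i : Fin N) (hi : v i (h i) = 0) :
    tprod v h = 0 := Finset.prod_eq_zero (Finset.mem_univ i) hi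

theorem gaugeS_det (η α u β : ℂ) :
    (gaugeS η α u β).det = -(2 * sinh (η * β) * exp (u - η * α)) := by
  rw [gaugeS, Matrix.det_fin_two_of, Complex.sinh,
    show u - η * (β + α) = u - η * α + -(η * β) by ring,
    show u + η * (β - α) = u - η * α + η * β by ring, exp_add, exp_add]
  ring

theorem isUnit_gaugeS_det {η α u β : ℂ} (h : sinh (η * β) ≠ 0) :
    IsUnit (gaugeS η α u β).det := by
  rw [gaugeS_det, isUnit_iff_ne_zero]
  exact neg_ne_zero.mpr (mul_ne_zero (mul_ne_zero two_ne_zero h) (Complex.exp_ne_zero _))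

/-- The `σᶻ`-dependent shift of the local factor at site `n`. -/
def spinAbove (n : Fin N) (h : Conf N) : ℂ := ∑ j ∈ Finset.Ioi n, sz (h j)

theorem spinAbove_int (n : Fin N) (h : Conf N) : ∃ m : ℤ, spinAbove n h = m := by
  refine ⟨∑ j ∈ Finset.Ioi n, if h j = 0 then 1 else -1, ?_⟩
  rw [spinAbove]
  push_cast
  exact Finset.sum_congr rfl fun j _ => by rw [sz]

theorem spinAbove_congr {n : Fin N} {h k : Conf N} (hk : ∀ m, m ≠ n → h m = k m) :
    spinAbove n h = spinAbove n k :=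
  Finset.sum_congr rfl fun j hj => by rw [hk j (ne_of_gt (Finset.mem_Ioi.mp hj))]

theorem spinAbove_update (n : Fin N) (h : Conf N) (s : Fin 2) :
    spinAbove n (update h n s) = spinAbove n h :=
  spinAbove_congr fun _ hm => update_of_ne hm _ _

theorem spinAbove_up {n : Fin N} {h : Conf N} (hh : ∀ j, n < j → h j = 0) :
    spinAbove n h = (Finset.Ioi n).card := by
  rw [spinAbove, Finset.sum_congr rfl fun j hj => by rw [hh j (Finset.mem_Ioi.mp hj)]]
  simp [sz]

theorem spinAbove_down {n : Fin N} {h : Conf N} (hh : ∀ j, n < j → h j = 1) :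
    spinAbove n h = -(Finset.Ioi n).card := by
  rw [spinAbove, Finset.sum_congr rfl fun j hj => by rw [hh j (Finset.mem_Ioi.mp hj)]]
  simp [sz]

namespace Chain

variable (p : Chain N)

theorem gaugeSite_apply (β : ℂ) (n : Fin N) (h k : Conf N) :
    p.gaugeSite β n h k = emb1 n (gaugeS p.η p.α (-p.ξ n) (β + spinAbove n h)) h k := by
  rw [emb1_apply, gaugeSite, Matrix.of_apply, spinAbove]
  split_ifs <;> rfl

theorem gaugeSite_mulVec (β : ℂ) (n : Fin N) (f : Conf N → ℂ) (h : Conf N) :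
    (p.gaugeSite β n *ᵥ f) h =
      (emb1 n (gaugeS p.η p.α (-p.ξ n) (β + spinAbove n h)) *ᵥ f) h :=
  Finset.sum_congr rfl fun k _ => congrArg (· * f k) (p.gaugeSite_apply β n h k)

theorem vecMul_gaugeSite (β : ℂ) (n : Fin N) (f : Conf N → ℂ) (k : Conf N) :
    (f ᵥ* p.gaugeSite β n) k =
      (f ᵥ* emb1 n (gaugeS p.η p.α (-p.ξ n) (β + spinAbove n k))) k := by
  refine Finset.sum_congr rfl fun h _ => congrArg (f h * ·) ?_
  beta_reduce
  rw [gaugeSite_apply, emb1_apply, emb1_apply]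
  split_ifs with hk
  · rw [spinAbove_congr hk]
  · rfl

/-- The local factor is block diagonal in the spins of the other sites, with blocks whose parameter
is `β` plus an integer; it is inverted block by block. -/
theorem isUnit_gaugeSite {β : ℂ} (hβ : ∀ m : ℤ, sinh (p.η * (β + m)) ≠ 0) (n : Fin N) :
    IsUnit (p.gaugeSite β n) := by
  refine IsUnit.of_mul_eq_one (Matrix.of fun h k =>
    emb1 n (gaugeS p.η p.α (-p.ξ n) (β + spinAbove n h))⁻¹ h k) ?_
  refine matrix_ext_mulVec fun f => funext fun h => ?_
  set F := gaugeS p.η p.α (-p.ξ n) (β + spinAbove n h) with hF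
  have hdet : IsUnit F.det := by
    obtain ⟨m, hm⟩ := spinAbove_int n h
    rw [hF, hm]
    exact isUnit_gaugeS_det (hβ m)
  have h1 : ∀ s, (Matrix.of (fun h k =>
      emb1 n (gaugeS p.η p.α (-p.ξ n) (β + spinAbove n h))⁻¹ h k) *ᵥ f) (update h n s) =
      (emb1 n F⁻¹ *ᵥ f) (update h n s) := fun s => by
    refine Finset.sum_congr rfl fun k _ => congrArg (· * f k) ?_
    beta_reduce
    rw [Matrix.of_apply, spinAbove_update]
  rw [← mulVec_mulVec, gaugeSite_mulVec, emb1_mulVec, ← hF]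
  simp only [h1]
  rw [← emb1_mulVec, mulVec_mulVec, emb1_mul, Matrix.mul_nonsing_inv _ hdet, emb1_one]

theorem gaugeBulk_eq (β : ℂ) : p.gaugeBulk β = ((sites N).map (p.gaugeSite β)).prod :=
  congrArg List.prod (ofFn_rev _)

theorem isUnit_gaugeBulk {β : ℂ} (hβ : ∀ m : ℤ, sinh (p.η * (β + m)) ≠ 0) :
    IsUnit (p.gaugeBulk β) := by
  rw [gaugeBulk_eq]
  induction sites N with
  | nil => simp
  | cons n L ih =>
    rw [List.map_cons, List.prod_cons]
    exact (p.isUnit_gaugeSite hβ n).mul ih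

/-- On a state with all spins above `n` up, the spin-dependent shift is a number, so the local
factor acts as a one-site operator. -/
theorem tprod_vecMul_gaugeSite (β : ℂ) (n : Fin N) {v : Fin N → Fin 2 → ℂ}
    (hv : ∀ j, n < j → v j = eUp) :
    tprod v ᵥ* p.gaugeSite β n = tprod (update v n
      (v n ᵥ* gaugeS p.η p.α (-p.ξ n) (β + (Finset.Ioi n).card))) := by
  funext k
  rw [vecMul_gaugeSite, tprod_vecMul_emb1]
  by_cases hk : ∀ j, n < j → k j = 0
  · rw [spinAbove_up hk]
  · push Not at hk
    obtain ⟨j, hj, hkj⟩ := hk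
    have h1 : k j = 1 := by omega
    have h2 : ∀ ψ, update v n ψ j (k j) = 0 := fun ψ => by
      rw [update_of_ne (ne_of_gt hj), hv j hj, h1]; rfl
    rw [tprod_eq_zero j (h2 _), tprod_eq_zero j (h2 _)]

theorem gaugeSite_mulVec_tprod (β : ℂ) (n : Fin N) {w : Fin N → Fin 2 → ℂ}
    (hw : ∀ j, n < j → w j = eDown) :
    p.gaugeSite β n *ᵥ tprod w = tprod (update w n
      (gaugeS p.η p.α (-p.ξ n) (β - (Finset.Ioi n).card) *ᵥ w n)) := by
  funext k
  rw [gaugeSite_mulVec, emb1_mulVec_tprod]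
  by_cases hk : ∀ j, n < j → k j = 1
  · rw [spinAbove_down hk, ← sub_eq_add_neg]
  · push Not at hk
    obtain ⟨j, hj, hkj⟩ := hk
    have h1 : k j = 0 := by omega
    have h2 : ∀ ψ, update w n ψ j (k j) = 0 := fun ψ => by
      rw [update_of_ne (ne_of_gt hj), hw j hj, h1]; rfl
    rw [tprod_eq_zero j (h2 _), tprod_eq_zero j (h2 _)]

theorem rowS_vecMul_gaugeS (v β : ℂ) :
    p.rowS v β ᵥ* gaugeS p.η p.α v β = (2 * sinh (p.η * β)) • eUp := by
  have h1 : exp (p.η * p.α - v) * exp (v - p.η * (β + p.α)) = exp (-(p.η * β)) := by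
    rw [← exp_add]; ring_nf
  have h2 : exp (p.η * p.α - v) * exp (v + p.η * (β - p.α)) = exp (p.η * β) := by
    rw [← exp_add]; ring_nf
  funext s
  fin_cases s
  · simp [rowS, gaugeS, eUp, h1, Complex.sinh, Matrix.vecMul, dotProduct, Fin.sum_univ_two]
    ring
  · simp [rowS, gaugeS, eUp, h2, Matrix.vecMul, dotProduct, Fin.sum_univ_two]

theorem gaugeS_mulVec_eDown (v β : ℂ) : gaugeS p.η p.α v β *ᵥ eDown = p.colS v β := by
  funext s
  fin_cases s <;> simp [gaugeS, eDown, colS, Matrix.mulVec, dotProduct, Fin.sum_univ_two]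

theorem rowS_eq {v β : ℂ} (h : sinh (p.η * β) ≠ 0) :
    p.rowS v β = (2 * sinh (p.η * β)) • (gaugeS p.η p.α v β)⁻¹ 0 := by
  have h1 := congrArg (· ᵥ* (gaugeS p.η p.α v β)⁻¹) (p.rowS_vecMul_gaugeS v β)
  simp only [vecMul_vecMul, Matrix.mul_nonsing_inv _ (isUnit_gaugeS_det h), vecMul_one,
    smul_vecMul] at h1
  rw [h1]
  congr 1
  funext s
  simp [eUp, Matrix.vecMul, dotProduct, Fin.sum_univ_two]

/-- The normalization of the left reference state. -/
def rowNorm : ℂ → List (Fin N) → ℂ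
  | _, [] => 1
  | β, _ :: L => 2 * sinh (p.η * β) * rowNorm (β + 1) L

theorem rowNorm_ne_zero {β : ℂ} (hβ : ∀ m : ℤ, sinh (p.η * (β + m)) ≠ 0) (L : List (Fin N)) :
    p.rowNorm β L ≠ 0 := by
  induction L generalizing β with
  | nil => exact one_ne_zero
  | cons n L ih =>
    refine mul_ne_zero (mul_ne_zero two_ne_zero ?_) (ih fun m => ?_)
    · simpa using hβ 0
    · have := hβ (1 + m)
      push_cast at this
      rwa [add_assoc]

theorem card_Ioi_of_sites {n : Fin N} {L : List (Fin N)} (hL : (n :: L).Pairwise (· > ·))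
    (hout : ∀ i, i ∉ n :: L → ∀ m ∈ n :: L, m < i) :
    ((Finset.Ioi n).card : ℂ) = N - (n :: L).length := by
  have hnd : (n :: L).Nodup := hL.imp fun h => ne_of_gt h
  have h1 : Finset.Ioi n = (n :: L).toFinsetᶜ := by
    ext i
    rw [Finset.mem_Ioi, Finset.mem_compl, List.mem_toFinset]
    refine ⟨fun hi hmem => ?_, fun hi => hout i hi n (by simp)⟩
    rcases List.mem_cons.mp hmem with rfl | hmem
    · exact lt_irrefl _ hi
    · exact lt_asymm hi ((List.pairwise_cons.mp hL).1 i hmem)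
  have h2 := Finset.card_compl_add_card (n :: L).toFinset
  rw [← h1, List.toFinset_card_of_nodup hnd, Fintype.card_fin] at h2
  rw [eq_sub_iff_add_eq]
  exact_mod_cast h2

/-- Acting to the left, the factor of the last site comes first and turns that site into spin up,
which raises the parameter of the next factor by one. This is the increment built into `rowState`.
-/
theorem rowState_vecMul_gauge (β : ℂ) {β' : ℂ} {L : List (Fin N)} (hL : L.Pairwise (· > ·))
    (hout : ∀ i, i ∉ L → ∀ m ∈ L, m < i) (hβ : β' = β + (N - L.length))
    {v : Fin N → Fin 2 → ℂ} (hv : ∀ i ∉ L, v i = eUp) :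
    tprod (p.rowState v p.ξ β' L) ᵥ* (L.map (p.gaugeSite β)).prod =
      p.rowNorm β' L • refUp N := by
  induction L generalizing β' v with
  | nil =>
    have : v = fun _ => eUp := funext fun i => hv i (by simp)
    simp [rowState, this, refUp_eq_tprod, rowNorm]
  | cons n L ih =>
    have hn : n ∉ L := fun h => lt_irrefl _ ((List.pairwise_cons.mp hL).1 n h)
    have hoff : ∀ j, n < j → p.rowState v p.ξ β' (n :: L) j = eUp := by
      intro j hj
      have hj' : j ∉ n :: L := fun h => by
        rcases List.mem_cons.mp h with rfl | h
        · exact lt_irrefl _ hj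
        · exact lt_asymm hj ((List.pairwise_cons.mp hL).1 j h)
      have : ∀ (M : List (Fin N)) (b : ℂ), j ∉ M → p.rowState v p.ξ b M j = v j := by
        intro M
        induction M with
        | nil => intro b _; rfl
        | cons m M ihM =>
          intro b hM
          simp only [List.mem_cons, not_or] at hM
          rw [rowState, update_of_ne hM.1, ihM _ hM.2]
      rw [this _ _ hj', hv j hj']
    rw [List.map_cons, List.prod_cons, ← vecMul_vecMul, p.tprod_vecMul_gaugeSite β n hoff,
      card_Ioi_of_sites hL hout, ← hβ, rowState, update_self, rowS_vecMul_gaugeS, update_idem,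
      ← p.rowState_update hn]
    have hsm : tprod (p.rowState (update v n ((2 * sinh (p.η * β')) • eUp)) p.ξ (β' + 1) L) =
        (2 * sinh (p.η * β')) • tprod (p.rowState (update v n eUp) p.ξ (β' + 1) L) := by
      rw [p.rowState_update hn, p.rowState_update hn]
      funext h
      rw [Pi.smul_apply, ← update_eq_self n h]
      simp only [tprod_update1, update_self, prod_erase_update, Pi.smul_apply, smul_eq_mul]
      ring
    rw [hsm, smul_vecMul, ih (List.pairwise_cons.mp hL).2, smul_smul, rowNorm]
    · intro i hi m hm
      by_cases hin : i = n
      · rw [hin]; exact (List.pairwise_cons.mp hL).1 m hm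
      · exact hout i (by simp [hin, hi]) m (by simp [hm])
    · rw [hβ, List.length_cons]; push_cast; ring
    · intro i hi
      by_cases hin : i = n
      · rw [hin, update_self]
      · rw [update_of_ne hin, hv i (by simp [hin, hi])]

/-- Acting to the right, the factor of the first site comes first. All sites above the current one
are then still down, so its parameter is lowered by their number, as in `colState`. -/
theorem gauge_mulVec_refDown (β : ℂ) {β' : ℂ} {L : List (Fin N)} (hL : L.Pairwise (· > ·))
    (hout : ∀ i, i ∉ L → ∀ m ∈ L, m < i) (hβ : β' = β - (N - L.length)) :
    (L.map (p.gaugeSite β)).prod *ᵥ refDown N =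
      tprod (p.colState (fun _ => eDown) p.ξ β' L) := by
  have hoff : ∀ (M : List (Fin N)) (b : ℂ) j, j ∉ M →
      p.colState (fun _ => eDown) p.ξ b M j = eDown := by
    intro M
    induction M with
    | nil => intro b j _; rfl
    | cons m M ihM =>
      intro b j hM
      simp only [List.mem_cons, not_or] at hM
      rw [colState, update_of_ne hM.1, ihM _ _ hM.2]
  induction L generalizing β' with
  | nil => simp [colState, refDown_eq_tprod]
  | cons n L ih =>
    have hn : n ∉ L := fun h => lt_irrefl _ ((List.pairwise_cons.mp hL).1 n h)
    rw [List.map_cons, List.prod_cons, ← mulVec_mulVec,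
      ih (β' := β' - 1) (List.pairwise_cons.mp hL).2, p.gaugeSite_mulVec_tprod β n,
      card_Ioi_of_sites hL hout, ← hβ, hoff L _ n hn, gaugeS_mulVec_eDown, colState]
    · intro j hj
      exact hoff L _ j fun h => lt_asymm hj ((List.pairwise_cons.mp hL).1 j h)
    · intro i hi m hm
      by_cases hin : i = n
      · rw [hin]; exact (List.pairwise_cons.mp hL).1 m hm
      · exact hout i (by simp [hin, hi]) m (by simp [hm])
    · rw [hβ, List.length_cons]; push_cast; ring

theorem pairwise_sites : (sites N).Pairwise (· > ·) := by
  rw [sites, List.pairwise_reverse]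
  exact List.pairwise_lt_finRange N

theorem refUp_vecMul_gaugeBulk_inv {β : ℂ} (hβ : ∀ m : ℤ, sinh (p.η * (β + m)) ≠ 0) :
    refUp N ᵥ* (p.gaugeBulk β)⁻¹ = (p.rowNorm β (sites N))⁻¹ •
      tprod (p.rowState (fun _ => eUp) p.ξ β (sites N)) := by
  have h1 := p.rowState_vecMul_gauge β (β' := β) (v := fun _ => eUp) (L := sites N) pairwise_sites
    (fun i hi => absurd (mem_sites i) hi) (by simp [sites]) (fun i _ => rfl)
  have h2 : IsUnit (p.gaugeBulk β).det :=
    (Matrix.isUnit_iff_isUnit_det _).mp (p.isUnit_gaugeBulk hβ)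
  rw [← gaugeBulk_eq] at h1
  have h3 := congrArg (· ᵥ* (p.gaugeBulk β)⁻¹) h1
  simp only [vecMul_vecMul, Matrix.mul_nonsing_inv _ h2, vecMul_one, smul_vecMul] at h3
  rw [h3, smul_smul, inv_mul_cancel₀ (p.rowNorm_ne_zero hβ _), one_smul]

theorem gaugeBulk_mulVec_refDown (β : ℂ) :
    p.gaugeBulk β *ᵥ refDown N = tprod (p.colState (fun _ => eDown) p.ξ β (sites N)) := by
  rw [gaugeBulk_eq]
  exact p.gauge_mulVec_refDown β pairwise_sites (fun i hi => absurd (mem_sites i) hi)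
    (by simp [sites])

theorem Utilde_eq_sandwich (u β : ℂ) (a b : Fin 2) :
    p.Utilde u β a b = sandwich ((gaugeS p.η p.α (-u + p.η / 2) β)⁻¹ a) (p.Ublk p.ξ u)
      (fun c => gaugeS p.η p.α (u - p.η / 2) β c b) := by
  rw [Utilde, Uminus_eq_Ublk, onAux, onAux]
  generalize (gaugeS p.η p.α (-u + p.η / 2) β)⁻¹ = A
  generalize gaugeS p.η p.α (u - p.η / 2) β = B
  simp only [Matrix.mul_apply, Fin.sum_univ_two, Matrix.map_apply, sandwich, smul_mul_assoc,
    mul_smul_comm, one_mul, mul_one, smul_smul, smul_add]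
  simp only [mul_comm]
  abel

end Chain

end Gauge

/-! ### Products of `A₋` and `D₋` as products of reversals -/

section Words

variable {N : ℕ}

/-- The inhomogeneities after a succession of sign reversals. -/
def flips (x : Fin N → ℂ) (ω : List (Fin N)) : Fin N → ℂ := ω.foldl flip x

theorem flips_cons (x : Fin N → ℂ) (j : Fin N) (ω : List (Fin N)) :
    flips x (j :: ω) = flips (flip x j) ω := rfl

theorem flips_append (x : Fin N → ℂ) (ω ω' : List (Fin N)) :
    flips x (ω ++ ω') = flips (flips x ω) ω' := List.foldl_append

theorem flips_reverse (x : Fin N → ℂ) (ω : List (Fin N)) : flips (flips x ω) ω.reverse = x := by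
  induction ω generalizing x with
  | nil => rfl
  | cons j ω ih =>
    rw [flips_cons, List.reverse_cons, flips_append, ih]
    exact flip_flip x j

theorem flips_apply (x : Fin N → ℂ) (ω : List (Fin N)) (i : Fin N) :
    flips x ω i = if Odd (ω.count i) then -x i else x i := by
  induction ω generalizing x with
  | nil => simp [flips]
  | cons j ω ih =>
    rw [flips_cons, ih]
    by_cases hij : i = j
    · subst hij
      by_cases h : Odd (ω.count i) <;> simp [h, Nat.odd_add_one]
    · simp [flip_of_ne x hij, Ne.symm hij]

namespace Chain

variable (p : Chain N)

theorem reflWord_append (L : List (Fin N)) (x : Fin N → ℂ) (ω ω' : List (Fin N)) :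
    p.reflWord L x (ω ++ ω') = p.reflWord L x ω * p.reflWord L (flips x ω) ω' := by
  induction ω generalizing x with
  | nil => simp [reflWord, flips]
  | cons j ω ih => rw [List.cons_append, reflWord, reflWord, ih, flips_cons, mul_assoc]

/-- The factor is even in the other inhomogeneities, so earlier reversals of other sites do not
change it and the order of the operators does not matter. -/
theorem rowFac_congr {x y : Fin N → ℂ} {j : Fin N} (hj : x j = y j)
    (h : ∀ i, x i = y i ∨ x i = -y i) (L : List (Fin N)) : p.rowFac x j L = p.rowFac y j L := by
  induction L with
  | nil => rfl
  | cons n L ih =>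
    rw [rowFac, rowFac, ih, hj]
    rcases h n with hn | hn <;> rw [hn]
    rw [sub_neg_eq_add, ← sub_eq_add_neg, mul_comm (sinh (p.η - y j + y n))]

theorem colFac_congr {x y : Fin N → ℂ} {j : Fin N} (hj : x j = y j)
    (h : ∀ i, x i = y i ∨ x i = -y i) (L : List (Fin N)) : p.colFac x j L = p.colFac y j L := by
  induction L with
  | nil => rfl
  | cons n L ih =>
    rw [colFac, colFac, ih, hj]
    rcases h n with hn | hn <;> rw [hn]
    rw [sub_neg_eq_add, ← sub_eq_add_neg, mul_comm (sinh (p.η + y j - y n))]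

theorem flip_sign {x y : Fin N → ℂ} (h : ∀ i, x i = y i ∨ x i = -y i) (j i : Fin N) :
    flip x j i = y i ∨ flip x j i = -y i := by
  by_cases hij : i = j
  · subst hij
    rw [flip_self]
    rcases h i with h | h <;> simp [h]
  · rw [flip_of_ne x hij]
    exact h i

/-- The operator `A₋(η/2 - z|β)` in the vertex picture, for the chain with inhomogeneities `x`. -/
def vertexA (x : Fin N → ℂ) (β z : ℂ) : Op N :=
  sandwich ((gaugeS p.η p.α z β)⁻¹ 0) (p.Ublk x (p.η / 2 - z))
    (fun c => gaugeS p.η p.α (-z) β c 0)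

/-- The operator `D₋(z + η/2|β)` in the vertex picture, for the chain with inhomogeneities `x`. -/
def vertexD (x : Fin N → ℂ) (β z : ℂ) : Op N :=
  sandwich ((gaugeS p.η p.α (-z) β)⁻¹ 1) (p.Ublk x (z + p.η / 2))
    (fun c => gaugeS p.η p.α z β c 1)

/-- With `σᶻ = 1` the parameter `β - 1` becomes `β`; in `DSOS_eq`, `σᶻ = -1` turns `β + 1` into `β`.
Both families are thus conjugated by the same gauge operator, which cancels in the pairing. -/
theorem ASOS_eq (z β : ℂ) :
    p.ASOS (p.η / 2 - z) (β - 1) =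
      (p.gaugeBulk β)⁻¹ * p.vertexA p.ξ (β - 1) z * p.gaugeBulk β := by
  rw [ASOS, USOS, Matrix.of_apply, Utilde_eq_sandwich, vertexA,
    show -(p.η / 2 - z) + p.η / 2 = z by ring, show p.η / 2 - z - p.η / 2 = -z by ring]
  simp [sz]

theorem DSOS_eq (z β : ℂ) :
    p.DSOS (z + p.η / 2) (β + 1) =
      (p.gaugeBulk β)⁻¹ * p.vertexD p.ξ (β + 1) z * p.gaugeBulk β := by
  rw [DSOS, USOS, Matrix.of_apply, Utilde_eq_sandwich, vertexD,
    show -(z + p.η / 2) + p.η / 2 = -z by ring, show z + p.η / 2 - p.η / 2 = z by ring]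
  simp [sz]

theorem inv_mul_gaugeS {v β : ℂ} (h : sinh (p.η * β) ≠ 0) (a : Fin 2) :
    (gaugeS p.η p.α v β)⁻¹ a ⬝ᵥ (fun c => gaugeS p.η p.α v β c a) = 1 := by
  have := congrFun (congrFun (Matrix.nonsing_inv_mul _ (isUnit_gaugeS_det (α := p.α) (u := v) h)) a) a
  rwa [Matrix.mul_apply, Matrix.one_apply_eq] at this

theorem rowState_vecMul_vertexA {β : ℂ} (h : sinh (p.η * (β - 1)) ≠ 0) (v : Fin N → Fin 2 → ℂ)
    (x : Fin N → ℂ) (j : Fin N) :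
    tprod (p.rowState v x β (sites N)) ᵥ* p.vertexA x (β - 1) (x j) = p.rowFac x j (sites N) •
      (tprod (p.rowState v (flip x j) β (sites N)) ᵥ* p.refl (flip x j) j (sites N)) := by
  -- `rowS` is this multiple of the first row of the inverse gauge matrix. It occurs on both sides
  -- and is cancelled at the end.
  have hne : 2 * sinh (p.η * (β - 1)) ≠ 0 := mul_ne_zero two_ne_zero h
  have h1 := p.rowState_vecMul_Ublk v x j β (fun c => gaugeS p.η p.α (-x j) (β - 1) c 0)
  rw [p.rowS_eq h, p.rowS_eq h, sandwich_smul_left, smul_dotProduct, p.inv_mul_gaugeS h,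
    vecMul_smul, smul_eq_mul, mul_one, mul_comm (p.rowFac x j (sites N)),
    mul_smul (2 * sinh (p.η * (β - 1)))] at h1
  exact smul_right_injective _ hne h1

theorem vertexD_mulVec_colState {β : ℂ} (h : sinh (p.η * (β + 1)) ≠ 0) (w : Fin N → Fin 2 → ℂ)
    (x : Fin N → ℂ) (j : Fin N) :
    p.vertexD x (β + 1) (x j) *ᵥ tprod (p.colState w x β (sites N)) = p.colFac x j (sites N) •
      (p.refl x j (sites N) *ᵥ tprod (p.colState w (flip x j) β (sites N))) := by
  have hc : ∀ v b, p.colS v b = fun c => gaugeS p.η p.α v b c 1 := fun v b => by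
    funext c
    fin_cases c <;> simp [colS, gaugeS]
  have h1 := p.Ublk_mulVec_colState w x j β ((gaugeS p.η p.α (-x j) (β + 1))⁻¹ 1)
  rw [hc, hc, p.inv_mul_gaugeS h, mul_one] at h1
  exact h1

theorem vertexA_mul_refl (x : Fin N → ℂ) (β z : ℂ) (j : Fin N) :
    p.refl (flip x j) j (sites N) * p.vertexA x β z =
      p.vertexA (flip x j) β z * p.refl (flip x j) j (sites N) := by
  have := p.Ublk_mul_refl (flip x j) (p.η / 2 - z) j ((gaugeS p.η p.α z β)⁻¹ 0)
    (fun c => gaugeS p.η p.α (-z) β c 0)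
  rw [flip_flip] at this
  exact this.symm

theorem vertexD_mul_refl (x : Fin N → ℂ) (β z : ℂ) (j : Fin N) :
    p.vertexD x β z * p.refl x j (sites N) =
      p.refl x j (sites N) * p.vertexD (flip x j) β z :=
  p.Ublk_mul_refl x (z + p.η / 2) j _ _

theorem list_prod_intertwine {ι M : Type*} [Monoid M] {W : M} {f g : ι → M}
    (h : ∀ i, W * f i = g i * W) (l : List ι) : W * (l.map f).prod = (l.map g).prod * W := by
  induction l with
  | nil => simp
  | cons i l ih =>
    rw [List.map_cons, List.prod_cons, ← mul_assoc, h, mul_assoc, ih, List.map_cons,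
      List.prod_cons, mul_assoc]

/-- Each operator produces a reversal, which the later ones cross while the sign in their chain is
updated. Reversals pile up on the right, so their word is the reverse of `ω`, read from the fully
reversed inhomogeneities. -/
theorem rowState_vecMul_word {β : ℂ} (h : sinh (p.η * (β - 1)) ≠ 0) (v : Fin N → Fin 2 → ℂ)
    (c y : Fin N → ℂ) {ω : List (Fin N)} (hω : ω.Nodup) {x : Fin N → ℂ}
    (hx : ∀ j ∈ ω, x j = y j) (hxy : ∀ i, x i = y i ∨ x i = -y i) :
    tprod (p.rowState v x β (sites N)) ᵥ*
        (ω.map fun j => c j • p.vertexA x (β - 1) (y j)).prod =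
      (ω.map fun j => c j * p.rowFac y j (sites N)).prod •
        (tprod (p.rowState v (flips x ω) β (sites N)) ᵥ*
          p.reflWord (sites N) (flips x ω) ω.reverse) := by
  induction ω generalizing x with
  | nil => simp [flips, reflWord]
  | cons j ω ih =>
    rw [List.nodup_cons] at hω
    have hxj : ∀ i ∈ ω, flip x j i = y i := fun i hi => by
      rw [flip_of_ne x (by rintro rfl; exact hω.1 hi), hx i (by simp [hi])]
    have hint : p.refl (flip x j) j (sites N) *
        (ω.map fun j => c j • p.vertexA x (β - 1) (y j)).prod =
        (ω.map fun i => c i • p.vertexA (flip x j) (β - 1) (y i)).prod *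
          p.refl (flip x j) j (sites N) :=
      list_prod_intertwine (fun i => by
        rw [mul_smul_comm, p.vertexA_mul_refl, smul_mul_assoc]) ω
    rw [List.map_cons, List.prod_cons, ← vecMul_vecMul, vecMul_smul, ← hx j (by simp),
      p.rowState_vecMul_vertexA h, smul_vecMul, smul_vecMul, vecMul_vecMul, hint, ← vecMul_vecMul,
      ih hω.2 hxj (flip_sign hxy j), smul_vecMul, vecMul_vecMul, List.reverse_cons,
      reflWord_append, flips_cons, flips_reverse, List.map_cons, List.prod_cons, smul_smul,
      smul_smul, p.rowFac_congr (hx j (by simp)) hxy]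
    simp [reflWord]

theorem vertexD_word_mulVec_colState {β : ℂ} (h : sinh (p.η * (β + 1)) ≠ 0)
    (w : Fin N → Fin 2 → ℂ) (c y : Fin N → ℂ) {ω : List (Fin N)} (hω : ω.Nodup) {x : Fin N → ℂ}
    (hx : ∀ j ∈ ω, x j = y j) (hxy : ∀ i, x i = y i ∨ x i = -y i) :
    (ω.reverse.map fun j => c j • p.vertexD x (β + 1) (y j)).prod *ᵥ
        tprod (p.colState w x β (sites N)) =
      (ω.map fun j => c j * p.colFac y j (sites N)).prod •
        (p.reflWord (sites N) x ω *ᵥ tprod (p.colState w (flips x ω) β (sites N))) := by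
  induction ω generalizing x with
  | nil => simp [flips, reflWord]
  | cons j ω ih =>
    rw [List.nodup_cons] at hω
    have hxj : ∀ i ∈ ω, flip x j i = y i := fun i hi => by
      rw [flip_of_ne x (by rintro rfl; exact hω.1 hi), hx i (by simp [hi])]
    have hint : p.refl x j (sites N) *
        (ω.reverse.map fun i => c i • p.vertexD (flip x j) (β + 1) (y i)).prod =
        (ω.reverse.map fun j => c j • p.vertexD x (β + 1) (y j)).prod * p.refl x j (sites N) :=
      list_prod_intertwine (fun i => by
        rw [mul_smul_comm, ← p.vertexD_mul_refl, smul_mul_assoc]) ω.reverse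
    rw [List.reverse_cons, List.map_append, List.prod_append, List.map_singleton,
      List.prod_singleton, ← mulVec_mulVec, smul_mulVec, ← hx j (by simp),
      p.vertexD_mulVec_colState h, mulVec_smul, mulVec_smul, mulVec_mulVec, ← hint,
      ← mulVec_mulVec, ih hω.2 hxj (flip_sign hxy j), mulVec_smul, mulVec_mulVec, reflWord,
      flips_cons, List.map_cons, List.prod_cons, smul_smul,
      smul_smul, p.colFac_congr (hx j (by simp)) hxy]

theorem list_prod_conj {ι : Type*} {G : Op N} (hG : IsUnit G) (f : ι → Op N) (l : List ι) :
    (l.map fun i => G⁻¹ * f i * G).prod = G⁻¹ * (l.map f).prod * G := by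
  have h1 : IsUnit G.det := (Matrix.isUnit_iff_isUnit_det _).mp hG
  induction l with
  | nil => simp [Matrix.nonsing_inv_mul _ h1]
  | cons i l ih =>
    rw [List.map_cons, List.prod_cons, ih, List.map_cons, List.prod_cons]
    calc G⁻¹ * f i * G * (G⁻¹ * (l.map f).prod * G)
        = G⁻¹ * f i * (G * G⁻¹) * (l.map f).prod * G := by simp only [mul_assoc]
      _ = _ := by rw [Matrix.mul_nonsing_inv _ h1, mul_one]; simp only [mul_assoc]

/-- The pairing of the states created by words in `A₋` and `D₋` from the reference states. -/
theorem pairing_words {β : ℂ} (hβ : ∀ m : ℤ, sinh (p.η * (β + m)) ≠ 0) (c₁ c₂ : Fin N → ℂ)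
    {ω₁ ω₂ : List (Fin N)} (h₁ : ω₁.Nodup) (h₂ : ω₂.Nodup) :
    ∃ e : ℂ, ((∀ j ∈ ω₁, j ∉ ω₂) → e = 1) ∧
    (refUp N ᵥ* (ω₁.map fun j => c₁ j • p.ASOS (p.η / 2 - p.ξ j) (β - 1)).prod) ⬝ᵥ
        ((ω₂.reverse.map fun j => c₂ j • p.DSOS (p.ξ j + p.η / 2) (β + 1)).prod *ᵥ refDown N) =
      (p.rowNorm β (sites N))⁻¹ * (ω₁.map fun j => c₁ j * p.rowFac p.ξ j (sites N)).prod *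
        (ω₂.map fun j => c₂ j * p.colFac p.ξ j (sites N)).prod *
          (e * if ∀ j, Odd (ω₁.count j + ω₂.count j) then
            p.reflFac (flips p.ξ ω₁) β (sites N) else 0) := by
  have hu := p.isUnit_gaugeBulk hβ
  have hud : IsUnit (p.gaugeBulk β).det := (Matrix.isUnit_iff_isUnit_det _).mp hu
  have hm : sinh (p.η * (β - 1)) ≠ 0 := by simpa [sub_eq_add_neg] using hβ (-1)
  have hp : sinh (p.η * (β + 1)) ≠ 0 := by simpa using hβ 1
  -- The left reversals lead from `flips ξ ω₁` back to `ξ`, and the right ones on to `flips ξ ω₂`.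
  -- Together they form one word, to be put in normal form.
  obtain ⟨e, D, he, hD, hw⟩ := p.reflWord_eq_sweep (nodup_sites N) (flips p.ξ ω₁)
    (ω := ω₁.reverse ++ ω₂) fun j _ => mem_sites j
  refine ⟨e, fun hdis => he ?_, ?_⟩
  · refine List.Nodup.append (List.nodup_reverse.mpr h₁) h₂ fun j hj => ?_
    exact hdis j (List.mem_reverse.mp hj)
  · have hA : ∀ j, c₁ j • p.ASOS (p.η / 2 - p.ξ j) (β - 1) =
        (p.gaugeBulk β)⁻¹ * (c₁ j • p.vertexA p.ξ (β - 1) (p.ξ j)) * p.gaugeBulk β := fun j => by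
      rw [ASOS_eq, mul_smul_comm, smul_mul_assoc]
    have hDD : ∀ j, c₂ j • p.DSOS (p.ξ j + p.η / 2) (β + 1) =
        (p.gaugeBulk β)⁻¹ * (c₂ j • p.vertexD p.ξ (β + 1) (p.ξ j)) * p.gaugeBulk β := fun j => by
      rw [DSOS_eq, mul_smul_comm, smul_mul_assoc]
    simp only [hA, hDD]
    rw [list_prod_conj hu, list_prod_conj hu, ← vecMul_vecMul, ← vecMul_vecMul, ← mulVec_mulVec,
      ← mulVec_mulVec, ← dotProduct_mulVec, mulVec_mulVec _ (p.gaugeBulk β),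
      Matrix.mul_nonsing_inv _ hud, one_mulVec, p.refUp_vecMul_gaugeBulk_inv hβ,
      gaugeBulk_mulVec_refDown, smul_vecMul,
      p.rowState_vecMul_word hm _ c₁ p.ξ h₁ (fun j _ => rfl) (fun i => Or.inl rfl),
      p.vertexD_word_mulVec_colState hp _ c₂ p.ξ h₂ (fun j _ => rfl) (fun i => Or.inl rfl),
      smul_dotProduct, smul_dotProduct, dotProduct_smul, ← dotProduct_mulVec, mulVec_mulVec]
    have hx : flips (flips p.ξ ω₁) ω₁.reverse = p.ξ := flips_reverse _ _
    have hfl : flips p.ξ ω₂ = flipSet (flips p.ξ ω₁) D := by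
      funext i
      rw [← hx, ← flips_append, hx, flips_apply, flipSet]
      exact if_congr (hD i).symm rfl rfl
    have hwd := p.reflWord_append (sites N) (flips p.ξ ω₁) ω₁.reverse ω₂
    rw [hx] at hwd
    rw [← hwd, hw, hfl, smul_mulVec, dotProduct_smul,
      p.rowState_sweep_colState (flips p.ξ ω₁) D (nodup_sites N) β _ _
        (fun i hi => absurd (mem_sites i) hi)]
    have hiff : (∀ j ∈ sites N, j ∈ D) ↔ ∀ j, Odd (ω₁.count j + ω₂.count j) := by
      simp [mem_sites, hD, List.count_append]
    simp only [hiff, smul_eq_mul, mul_assoc]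

end Chain

end Words

/-! ### Explicit products for the scalar factors -/

section Scalars

theorem sites_succ (N : ℕ) : sites (N + 1) = Fin.last N :: (sites N).map Fin.castSucc := by
  rw [sites, List.finRange_succ_last, List.reverse_append, List.reverse_singleton, sites,
    List.map_reverse]
  rfl

theorem prod_map_sites {N : ℕ} (f : Fin N → ℂ) : ((sites N).map f).prod = ∏ j, f j := by
  rw [← ofFn_rev, List.prod_ofFn]
  exact Equiv.prod_comp Fin.revPerm f

theorem sinh_ne_zero_of {z : ℂ} (h : ∀ m : ℤ, z ≠ m * (Real.pi * Complex.I)) : sinh z ≠ 0 := by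
  intro h0
  have h1 : Complex.sin (z * Complex.I) = 0 := by rw [Complex.sin_mul_I, h0, zero_mul]
  obtain ⟨m, hm⟩ := Complex.sin_eq_zero_iff.mp h1
  refine h (-m) ?_
  have h2 : z = -(z * Complex.I * Complex.I) := by
    rw [mul_assoc, Complex.I_mul_I]; ring
  rw [h2, hm]
  push_cast
  ring

theorem sinh_sq_sub (a b : ℂ) : sinh a ^ 2 - sinh b ^ 2 = sinh (a + b) * sinh (a - b) := by
  rw [sinh_add, sinh_sub]
  linear_combination (sinh b) ^ 2 * cosh_sq a - (sinh a) ^ 2 * cosh_sq b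

theorem vdm_eq {N : ℕ} (x : Fin N → ℂ) :
    vdm x = ∏ i, ∏ j, if i < j then sinh (x i + x j) * sinh (x j - x i) else 1 := by
  have h1 : vdm x = (Matrix.vandermonde fun i => sinh (x i) ^ 2).det := by
    rw [vdm]
    congr 1
    ext i j
    simp [Matrix.vandermonde_apply, pow_mul]
  rw [h1, Matrix.det_vandermonde]
  refine Finset.prod_congr rfl fun i _ => ?_
  rw [← Finset.prod_filter]
  refine Finset.prod_congr (by ext j; simp) fun j _ => ?_
  rw [sinh_sq_sub, add_comm]

theorem prod_eq_self_mul {N : ℕ} (f : Fin N → ℂ) (j : Fin N) :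
    ∏ n, f n = f j * ((∏ n, if n < j then f n else 1) * ∏ n, if j < n then f n else 1) := by
  rw [← Finset.mul_prod_erase _ _ (Finset.mem_univ j), ← Finset.prod_mul_distrib,
    ← Finset.mul_prod_erase Finset.univ (fun n => (if n < j then f n else 1) *
      (if j < n then f n else 1)) (Finset.mem_univ j)]
  simp only [lt_irrefl, if_false, one_mul]
  congr 1
  refine Finset.prod_congr rfl fun n hn => ?_
  rcases lt_or_gt_of_ne (Finset.ne_of_mem_erase hn) with h | h
  · simp [h, h.not_gt]
  · simp [h, h.not_gt]

namespace Chain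

variable {N : ℕ} (p : Chain N)

theorem rowNorm_sites (β : ℂ) :
    p.rowNorm β (sites N) = ∏ j : Fin N, (2 * sinh (p.η * (β + N - ((j : ℕ) + 1)))) := by
  have key : ∀ (n : ℕ) (L : List (Fin N)) (b : ℂ), L.length = n →
      p.rowNorm b L = ∏ j : Fin n, (2 * sinh (p.η * (b + n - ((j : ℕ) + 1)))) := by
    intro n
    induction n with
    | zero =>
      intro L b hL
      rw [List.length_eq_zero_iff.mp hL]
      simp [rowNorm]
    | succ n ih =>
      intro L b hL
      obtain ⟨m, L, rfl⟩ := List.exists_cons_of_length_eq_add_one hL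
      rw [rowNorm, ih L _ (by simpa using hL), Fin.prod_univ_castSucc, mul_comm]
      simp only [Fin.val_castSucc, Fin.val_last]
      push_cast
      congr 1
      · refine Finset.prod_congr rfl fun j _ => ?_
        ring_nf
      · ring_nf
  exact key N _ β (by simp [sites])

theorem reflFac_map {ι κ : Type*} (f : ι → κ) (x : κ → ℂ) (β : ℂ) (L : List ι) :
    p.reflFac x β (L.map f) = p.reflFac (x ∘ f) β L := by
  induction L generalizing β with
  | nil => rfl
  | cons n L ih =>
    rw [List.map_cons, reflFac, reflFac, ih, List.map_map, List.length_map]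
    rfl

theorem rowFac_map {ι κ : Type*} [DecidableEq ι] [DecidableEq κ] {f : ι → κ} (hf : Injective f)
    (x : κ → ℂ) (j : ι) (L : List ι) : p.rowFac x (f j) (L.map f) = p.rowFac (x ∘ f) j L := by
  induction L with
  | nil => rfl
  | cons n L ih => simp [rowFac, ih, hf.eq_iff]

theorem colFac_map {ι κ : Type*} [DecidableEq ι] [DecidableEq κ] {f : ι → κ} (hf : Injective f)
    (x : κ → ℂ) (j : ι) (L : List ι) : p.colFac x (f j) (L.map f) = p.colFac (x ∘ f) j L := by
  induction L with
  | nil => rfl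
  | cons n L ih => simp [colFac, ih, hf.eq_iff]

/-- Site `j`, counted from 0, is stripped after `n - 1 - j` others, at parameter `β - (n - 1 - j)`
and with `j` sites inside it; the sum of the two is the argument of `kFac`. -/
theorem reflFac_sites {n : ℕ} (x : Fin n → ℂ) (β : ℂ) :
    p.reflFac x β (sites n) = (∏ i, ∏ j, if i < j then
      sinh (x j - x i + p.η) * sinh (x j + x i) else 1) *
        ∏ j : Fin n, p.kFac (x j) (β - n + 2 * (j : ℕ) + 1) := by
  rw [Finset.prod_comm, ← Finset.prod_mul_distrib]
  induction n generalizing β with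
  | zero => simp [sites, reflFac]
  | succ n ih =>
    rw [sites_succ, reflFac, reflFac_map, ih, List.map_map, prod_map_sites, Fin.prod_univ_castSucc,
      List.length_map, mul_comm]
    congr 1
    · refine Finset.prod_congr rfl fun j _ => ?_
      rw [Fin.prod_univ_castSucc]
      simp only [Fin.castSucc_lt_castSucc_iff, (Fin.castSucc_lt_last _).not_gt, if_false, mul_one,
        Function.comp_apply, Fin.val_castSucc]
      congr 2
      push_cast
      ring
    · rw [Fin.prod_univ_castSucc]
      simp only [Fin.castSucc_lt_last, if_true, lt_irrefl, if_false, mul_one, Function.comp_apply,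
        Fin.val_last]
      congr 2
      rw [sites, List.length_reverse, List.length_finRange]
      push_cast
      ring

theorem rowFac_sites {n : ℕ} (x : Fin n → ℂ) (j : Fin n) :
    p.rowFac x j (sites n) = sinh (p.η - 2 * x j) * sinh p.η *
      ∏ i, if j < i then sinh (p.η - x j - x i) * sinh (p.η - x j + x i) else 1 := by
  induction n with
  | zero => exact j.elim0
  | succ n ih =>
    rw [sites_succ, rowFac, Fin.prod_univ_castSucc]
    induction j using Fin.lastCases with
    | last => simp [(Fin.castSucc_lt_last _).not_gt]
    | cast j =>
      rw [if_neg (Fin.castSucc_lt_last j).ne', rowFac_map _ (Fin.castSucc_injective n), ih]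
      simp only [Fin.castSucc_lt_castSucc_iff, Fin.castSucc_lt_last, if_true, Function.comp_apply]
      ring

theorem colFac_sites {n : ℕ} (x : Fin n → ℂ) (j : Fin n) :
    p.colFac x j (sites n) = sinh (p.η + 2 * x j) * sinh p.η *
      ∏ i, if j < i then sinh (p.η + x j + x i) * sinh (p.η + x j - x i) else 1 := by
  induction n with
  | zero => exact j.elim0
  | succ n ih =>
    rw [sites_succ, colFac, Fin.prod_univ_castSucc]
    induction j using Fin.lastCases with
    | last => simp [(Fin.castSucc_lt_last _).not_gt]
    | cast j =>
      rw [if_neg (Fin.castSucc_lt_last j).ne', colFac_map _ (Fin.castSucc_injective n), ih]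
      simp only [Fin.castSucc_lt_castSucc_iff, Fin.castSucc_lt_last, if_true, Function.comp_apply]
      ring

/-- The dependence of the boundary factor on the dynamical parameter. -/
def dynFac (b : ℂ) : ℂ :=
  exp (p.η * b) * (exp p.ς - 2 * p.κ * sinh (p.η * (b - p.α) - p.τ)) / sinh p.ς

/-- The separation of `w` from `b` is the reason why the normalization does not depend on the label
of the state. -/
theorem kFac_eq (hς : sinh p.ς ≠ 0) (w b : ℂ) :
    p.kFac w b = -(exp w * sinh (2 * w)) * p.dynFac b := by
  simp only [kFac, rowS, colS, Kminus, dynFac, dotProduct, Matrix.vecMul, Fin.sum_univ_two,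
    Matrix.smul_apply, smul_eq_mul, Matrix.of_apply, Matrix.cons_val_zero, Matrix.cons_val_one,
    Matrix.cons_val', Matrix.cons_val_fin_one]
  rw [show w + p.η / 2 - p.η / 2 + p.ς = w + p.ς by ring,
    show 2 * (w + p.η / 2) - p.η = w + w by ring,
    show p.ς - (w + p.η / 2) + p.η / 2 = p.ς - w by ring,
    show p.η * (b - p.α) = p.η * b - p.η * p.α by ring, two_mul w]
  generalize p.η * b = x
  generalize p.η * p.α = y
  field_simp
  rw [show w * (1 + 1) = w + w by ring]
  have h1 := Complex.exp_ne_zero w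
  have h2 := Complex.exp_ne_zero p.ς
  have h3 := Complex.exp_ne_zero p.τ
  have h4 := Complex.exp_ne_zero x
  have h5 := Complex.exp_ne_zero y
  simp only [Complex.sinh, Complex.exp_add, Complex.exp_neg, neg_add, sub_eq_add_neg, neg_neg]
  generalize Complex.exp w = a at *
  generalize Complex.exp p.ς = c at *
  generalize Complex.exp p.τ = d at *
  generalize Complex.exp x = e at *
  generalize Complex.exp y = f at *
  field_simp
  ring

theorem kFac_eq_bMinus {b : ℂ} (h : sinh (p.η * b) ≠ 0) (w : ℂ) :
    p.kFac w b = 2 * sinh (p.η * b) * p.bMinus (w + p.η / 2) b := by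
  have hc : p.colS w b = fun c => gaugeS p.η p.α w b c 1 := by
    funext c
    fin_cases c <;> simp [colS, gaugeS]
  rw [kFac, p.rowS_eq h, hc, smul_vecMul, smul_dotProduct, bMinus, KSOS,
    show -(w + p.η / 2) + p.η / 2 = -w by ring, show w + p.η / 2 - p.η / 2 = w by ring, smul_eq_mul]
  rfl

end Chain

end Scalars

/-! ### Words selected by exponents 0 and 1 -/

section Words

theorem prod_map_pow_eq_filter {ι R : Type*} [Monoid R] (F : ι → R) (e : ι → ℕ)
    (he : ∀ i, e i = 0 ∨ e i = 1) (L : List ι) :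
    (L.map fun i => F i ^ e i).prod = ((L.filter fun i => e i = 1).map F).prod := by
  induction L with
  | nil => rfl
  | cons i L ih =>
    rcases he i with h | h
    · simp [h, ih]
    · simp [h, ih]

theorem prod_map_filter_ofFn {N : ℕ} (π : Equiv.Perm (Fin N)) (P : Fin N → Prop)
    [DecidablePred P] (f : Fin N → ℂ) :
    (((List.ofFn π).filter fun j => P j).map f).prod = ∏ j, if P j then f j else 1 := by
  have h : ∀ L : List (Fin N), ((L.filter fun j => P j).map f).prod =
      (L.map fun j => if P j then f j else 1).prod := by
    intro L
    induction L with
    | nil => rfl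
    | cons j L ih => by_cases hj : P j <;> simp [hj, ih]
  rw [h, List.map_ofFn, List.prod_ofFn]
  exact Equiv.prod_comp π fun j => if P j then f j else 1

theorem nodup_filter_ofFn {N : ℕ} (π : Equiv.Perm (Fin N)) (P : Fin N → Prop)
    [DecidablePred P] : ((List.ofFn π).filter fun j => P j).Nodup :=
  (List.nodup_ofFn.mpr π.injective).filter _

theorem count_filter_ofFn {N : ℕ} (π : Equiv.Perm (Fin N)) (P : Fin N → Prop)
    [DecidablePred P] (j : Fin N) :
    ((List.ofFn π).filter fun j => P j).count j = if P j then 1 else 0 := by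
  rw [List.Nodup.count (nodup_filter_ofFn π P)]
  have : j ∈ List.ofFn π := List.mem_ofFn.mpr (π.surjective j)
  simp [this]

end Words

/-! ### Products over pairs of sites -/

section PairProd

variable {N : ℕ}

/-- The product of `f i j` over all pairs `i < j`. -/
def pairProd (f : Fin N → Fin N → ℂ) : ℂ := ∏ i, ∏ j, if i < j then f i j else 1

theorem pairProd_mul (f g : Fin N → Fin N → ℂ) :
    pairProd f * pairProd g = pairProd fun i j => f i j * g i j := by
  simp only [pairProd, ← Finset.prod_mul_distrib]
  refine Finset.prod_congr rfl fun i _ => Finset.prod_congr rfl fun j _ => ?_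
  split_ifs <;> simp

theorem pairProd_inv (f : Fin N → Fin N → ℂ) :
    (pairProd f)⁻¹ = pairProd fun i j => (f i j)⁻¹ := by
  simp only [pairProd, ← Finset.prod_inv_distrib]
  refine Finset.prod_congr rfl fun i _ => Finset.prod_congr rfl fun j _ => ?_
  split_ifs <;> simp

theorem pairProd_congr {f g : Fin N → Fin N → ℂ} (h : ∀ i j, i < j → f i j = g i j) :
    pairProd f = pairProd g :=
  Finset.prod_congr rfl fun i _ => Finset.prod_congr rfl fun j _ => by
    split_ifs with hij
    exacts [h i j hij, rfl]

theorem pairProd_ne_zero {f : Fin N → Fin N → ℂ} (h : ∀ i j, i < j → f i j ≠ 0) :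
    pairProd f ≠ 0 :=
  Finset.prod_ne_zero_iff.mpr fun i _ => Finset.prod_ne_zero_iff.mpr fun j _ => by
    split_ifs with hij
    exacts [h i j hij, one_ne_zero]

theorem vdm_eq_pairProd (x : Fin N → ℂ) :
    vdm x = pairProd fun i j => sinh (x i + x j) * sinh (x j - x i) := vdm_eq x

end PairProd

/-! ### The normalization constant and the three claims -/

namespace Chain

variable {N : ℕ} (p : Chain N)

/-- The inhomogeneities are generic: no two of the shifted ones coincide up to sign modulo the
periods of `sinh²`. -/
def Generic : Prop :=
  ∀ j k : Fin N, j ≠ k → ∀ a b : Fin 2, ∀ m : ℤ,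
    p.xiShift j a + p.xiShift k b ≠ m * (Real.pi * Complex.I) ∧
    p.xiShift j a - p.xiShift k b ≠ m * (Real.pi * Complex.I)

variable {p}

theorem Generic.sinh_add_ne (h : p.Generic) {i j : Fin N} (hij : i ≠ j) (a b : Fin 2) :
    sinh (p.xiShift i a + p.xiShift j b) ≠ 0 :=
  sinh_ne_zero_of fun m => (h i j hij a b m).1

theorem Generic.sinh_sub_ne (h : p.Generic) {i j : Fin N} (hij : i ≠ j) (a b : Fin 2) :
    sinh (p.xiShift i a - p.xiShift j b) ≠ 0 :=
  sinh_ne_zero_of fun m => (h i j hij a b m).2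

theorem Generic.sinh_ne (h : p.Generic) {i j : Fin N} (hij : i < j) :
    sinh (p.ξ i + p.ξ j) ≠ 0 ∧ sinh (p.ξ i + p.ξ j + p.η) ≠ 0 ∧ sinh (p.ξ i + p.ξ j - p.η) ≠ 0 ∧
    sinh (p.ξ j - p.ξ i) ≠ 0 ∧ sinh (p.ξ j - p.ξ i + p.η) ≠ 0 ∧ sinh (p.ξ j - p.ξ i - p.η) ≠ 0 := by
  refine ⟨?_, ?_, ?_, ?_, ?_, ?_⟩
  · convert h.sinh_add_ne hij.ne 0 1 using 2; simp [xiShift]; ring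
  · convert h.sinh_add_ne hij.ne 0 0 using 2; simp [xiShift]; ring
  · convert h.sinh_add_ne hij.ne 1 1 using 2; simp [xiShift]; ring
  · convert h.sinh_sub_ne hij.ne' 0 0 using 2; simp [xiShift]
  · convert h.sinh_sub_ne hij.ne' 0 1 using 2; simp [xiShift]; ring
  · convert h.sinh_sub_ne hij.ne' 1 0 using 2; simp [xiShift]; ring

theorem Generic.vdm_ne_zero (h : p.Generic) (a : Conf N) :
    vdm (fun j => p.xiShift j (a j)) ≠ 0 := by
  rw [vdm_eq_pairProd]
  exact pairProd_ne_zero fun i j hij =>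
    mul_ne_zero (h.sinh_add_ne hij.ne _ _) (h.sinh_sub_ne hij.ne' _ _)

theorem Generic.vdm_ξ_ne_zero (h : p.Generic) : vdm p.ξ ≠ 0 := by
  rw [vdm_eq_pairProd]
  exact pairProd_ne_zero fun i j hij =>
    mul_ne_zero (h.sinh_ne hij).1 (h.sinh_ne hij).2.2.2.1

variable (p)

/-- The inhomogeneity `ξ_j` with the sign that it carries on the configuration `h`. -/
def signedξ (h : Conf N) (j : Fin N) : ℂ := if h j = 0 then -p.ξ j else p.ξ j

/-- The factor that a pair of sites contributes to the coefficient `A₋(η/2 - ξ_i)`. -/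
def coefPair (i j : Fin N) : ℂ := sinh (p.η - p.ξ i - p.ξ j) * sinh (p.ξ i - p.ξ j - p.η)

/-- The factor that a pair of sites contributes to the eigenvalues of the dressed operators. -/
def facPair (h : Conf N) (i j : Fin N) : ℂ :=
  if h i = 0 then sinh (p.η - p.ξ i - p.ξ j) * sinh (p.η - p.ξ i + p.ξ j)
  else sinh (p.η + p.ξ i + p.ξ j) * sinh (p.η + p.ξ i - p.ξ j)

theorem coefA_eq (g : ℂ → ℂ) (j : Fin N) :
    p.coefA g (p.η / 2 - p.ξ j) = g (p.η / 2 - p.ξ j) * (-(sinh (p.η - 2 * p.ξ j) * sinh p.η)) *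
      ((∏ n, if n < j then p.coefPair j n else 1) * ∏ n, if j < n then p.coefPair j n else 1) := by
  have h : p.a (p.η / 2 - p.ξ j) * p.d (-(p.η / 2 - p.ξ j)) = ∏ n, p.coefPair j n := by
    rw [a, d, ← Finset.prod_mul_distrib]
    refine Finset.prod_congr rfl fun n _ => ?_
    rw [coefPair]
    congr 2 <;> ring
  rw [coefA, mul_assoc, h, prod_eq_self_mul _ j, coefPair,
    show p.η - p.ξ j - p.ξ j = p.η - 2 * p.ξ j by ring,
    show p.ξ j - p.ξ j - p.η = -p.η by ring, sinh_neg]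
  ring

/-- The factor with `n = j` in `A₋(η/2 - ξ_j)` cancels the one-site factor of `rowFac` up to sign;
`k_j` is the ratio that makes it cancel the one-site factor of `colFac` as well. -/
theorem siteFac_eq (hη : sinh p.η ≠ 0)
    (hk : ∀ j : Fin N, sinh (2 * p.ξ j + p.η) ≠ 0 ∧ sinh (2 * p.ξ j - p.η) ≠ 0)
    (g : ℂ → ℂ) (h : Conf N) (j : Fin N) :
    (if h j = 0 then (p.coefA g (p.η / 2 - p.ξ j))⁻¹ * p.rowFac p.ξ j (sites N)
      else (p.k j * p.coefA g (p.η / 2 - p.ξ j))⁻¹ * p.colFac p.ξ j (sites N)) =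
    ((if h j = 0 then -1 else 1) / g (p.η / 2 - p.ξ j)) *
      ((∏ i, if j < i then p.facPair h j i else 1) *
        ((∏ n, if n < j then p.coefPair j n else 1)⁻¹ *
          (∏ n, if j < n then p.coefPair j n else 1)⁻¹)) := by
  obtain ⟨h1, h2⟩ := hk j
  have h3 : sinh (p.η - 2 * p.ξ j) = -sinh (2 * p.ξ j - p.η) := by
    rw [← sinh_neg]; congr 1; ring
  rw [coefA_eq, rowFac_sites, colFac_sites, k, h3, add_comm p.η (2 * p.ξ j)]
  by_cases h0 : h j = 0
  · simp only [facPair, h0, if_true, mul_inv]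
    field_simp
  · simp only [facPair, h0, if_false, mul_inv]
    field_simp

/-- The contribution of one pair of sites, in the four cases of their two labels. After
normalization of the arguments only six functions `sinh (±u + v + mη)`, with `m` in `{-1, 0, 1}`,
remain and cancel. -/
theorem pair_identity {η u v : ℂ} (hs : sinh (u + v) ≠ 0) (hsp : sinh (u + v + η) ≠ 0)
    (hsm : sinh (u + v - η) ≠ 0) (hd : sinh (v - u) ≠ 0) (hdp : sinh (v - u + η) ≠ 0)
    (hdm : sinh (v - u - η) ≠ 0) (a b : Fin 2) :
    (if a = 0 then sinh (η - u - v) * sinh (η - u + v) else sinh (η + u + v) * sinh (η + u - v)) *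
      ((sinh (η - v - u) * sinh (v - u - η))⁻¹ * (sinh (η - u - v) * sinh (u - v - η))⁻¹) *
      (sinh ((if b = 0 then -v else v) - (if a = 0 then -u else u) + η) *
        sinh ((if b = 0 then -v else v) + (if a = 0 then -u else u))) =
    sinh (u + v) * sinh (v - u) *
      ((sinh (u + η / 2 - ((0 : Fin 2) : ℕ) * η + (v + η / 2 - ((0 : Fin 2) : ℕ) * η)) *
        sinh (v + η / 2 - ((0 : Fin 2) : ℕ) * η - (u + η / 2 - ((0 : Fin 2) : ℕ) * η))) *
      (sinh (u + η / 2 - ((1 : Fin 2) : ℕ) * η + (v + η / 2 - ((1 : Fin 2) : ℕ) * η)) *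
        sinh (v + η / 2 - ((1 : Fin 2) : ℕ) * η - (u + η / 2 - ((1 : Fin 2) : ℕ) * η)))⁻¹) *
      (sinh (u + η / 2 - (a : ℕ) * η + (v + η / 2 - (b : ℕ) * η)) *
        sinh (v + η / 2 - (b : ℕ) * η - (u + η / 2 - (a : ℕ) * η)))⁻¹ := by
  have e1 : sinh (η - u - v) = -sinh (u + v - η) := by rw [← sinh_neg]; congr 1; ring
  have e2 : sinh (η - v - u) = -sinh (u + v - η) := by rw [← sinh_neg]; congr 1; ring
  have e3 : sinh (u - v - η) = -sinh (v - u + η) := by rw [← sinh_neg]; congr 1; ring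
  have e4 : sinh (η + u - v) = -sinh (v - u - η) := by rw [← sinh_neg]; congr 1; ring
  have e5 : sinh (η - u + v) = sinh (v - u + η) := by congr 1; ring
  have e6 : sinh (η + u + v) = sinh (u + v + η) := by congr 1; ring
  have f1 : sinh (-v + u + η) = -sinh (v - u - η) := by rw [← sinh_neg]; congr 1; ring
  have f2 : sinh (-v + -u) = -sinh (u + v) := by rw [← sinh_neg]; congr 1; ring
  have f3 : sinh (v + u + η) = sinh (u + v + η) := by congr 1; ring
  have f4 : sinh (v + -u) = sinh (v - u) := by congr 1
  have f5 : sinh (-v - u + η) = -sinh (u + v - η) := by rw [← sinh_neg]; congr 1; ring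
  have f6 : sinh (-v + u) = -sinh (v - u) := by rw [← sinh_neg]; congr 1; ring
  have f7 : sinh (v + u) = sinh (u + v) := by congr 1; ring
  have g1 : sinh (u + η / 2 + (v + η / 2)) = sinh (u + v + η) := by congr 1; ring
  have g3 : sinh (u + η / 2 - η + (v + η / 2 - η)) = sinh (u + v - η) := by congr 1; ring
  have g5 : sinh (u + η / 2 - η + (v + η / 2)) = sinh (u + v) := by congr 1; ring
  have g6 : sinh (v + η / 2 - (u + η / 2 - η)) = sinh (v - u + η) := by congr 1; ring
  have g7 : sinh (u + η / 2 + (v + η / 2 - η)) = sinh (u + v) := by congr 1; ring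
  have g8 : sinh (v + η / 2 - η - (u + η / 2)) = sinh (v - u - η) := by congr 1; ring
  fin_cases a <;> fin_cases b <;>
    simp [e1, e2, e3, e4, e5, e6, f1, f2, f3, f4, f5, f6, f7, g1, g3, g5, g6, g7, g8] <;>
    field_simp

theorem vdm_quotient (hg : p.Generic) (h : Conf N) :
    pairProd (p.facPair h) *
      ((pairProd fun i j => p.coefPair j i)⁻¹ * (pairProd p.coefPair)⁻¹) *
      (pairProd fun i j => sinh (p.signedξ h j - p.signedξ h i + p.η) *
        sinh (p.signedξ h j + p.signedξ h i)) =
    vdm p.ξ * (vdm (fun n => p.xiShift n 0) / vdm (fun n => p.xiShift n 1)) /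
      vdm (fun j => p.xiShift j (h j)) := by
  simp only [vdm_eq_pairProd, div_eq_mul_inv, pairProd_inv, pairProd_mul]
  refine pairProd_congr fun i j hij => ?_
  obtain ⟨h1, h2, h3, h4, h5, h6⟩ := hg.sinh_ne hij
  exact pair_identity h1 h2 h3 h4 h5 h6 (h i) (h j)

/-- The same arithmetic progression of parameters, read from its two ends. -/
theorem prod_dynFac (β : ℂ) :
    ∏ j : Fin N, p.dynFac (β - N + 2 * (j : ℕ) + 1) =
      ∏ j : Fin N, p.dynFac (β + 1 + N - 2 * ((j : ℕ) + 1)) := by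
  rw [← Equiv.prod_comp Fin.revPerm]
  refine Finset.prod_congr rfl fun j _ => ?_
  have : (((Fin.revPerm j : Fin N) : ℕ) : ℂ) = N - ((j : ℕ) + 1) := by
    rw [Fin.revPerm_apply, Fin.val_rev, Nat.cast_sub (by omega)]
    push_cast
    rfl
  rw [this]
  ring_nf

theorem bMinus_eq_dynFac (hς : sinh p.ς ≠ 0) {b : ℂ} (hb : sinh (p.η * b) ≠ 0) (j : Fin N) :
    2 * (p.bMinus (p.η / 2 - p.ξ j) b * sinh (p.η * b)) =
      exp (-p.ξ j) * sinh (2 * p.ξ j) * p.dynFac b := by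
  have h := p.kFac_eq_bMinus hb (-p.ξ j)
  rw [p.kFac_eq hς, neg_add_eq_sub, show 2 * -p.ξ j = -(2 * p.ξ j) by ring, sinh_neg] at h
  linear_combination -h

variable {β : ℂ}

theorem sinh_row_ne (hβ : ∀ m : ℤ, sinh (p.η * (β + m)) ≠ 0) (j : Fin N) :
    sinh (p.η * (β + N - ((j : ℕ) + 1))) ≠ 0 := by
  have := hβ (N - ((j : ℕ) + 1))
  push_cast at this
  convert this using 3
  ring

theorem sinh_bnd_ne (hβ : ∀ m : ℤ, sinh (p.η * (β + m)) ≠ 0) (j : Fin N) :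
    sinh (p.η * (β + 1 + N - 2 * ((j : ℕ) + 1))) ≠ 0 := by
  have := hβ (1 + N - 2 * ((j : ℕ) + 1))
  push_cast at this
  convert this using 3
  ring

theorem normConst_eq (hς : sinh p.ς ≠ 0) (hβ : ∀ m : ℤ, sinh (p.η * (β + m)) ≠ 0) (g : ℂ → ℂ) :
    p.normConst g β = (p.rowNorm β (sites N))⁻¹ *
      (∏ j, -(exp (-p.ξ j) * sinh (2 * p.ξ j) / g (p.η / 2 - p.ξ j))) *
      (∏ j : Fin N, p.dynFac (β - N + 2 * (j : ℕ) + 1)) *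
      (vdm p.ξ * (vdm (fun n => p.xiShift n 0) / vdm (fun n => p.xiShift n 1))) := by
  have h : (-1 : ℂ) ^ N = ∏ _j : Fin N, (-1 : ℂ) := by simp
  rw [normConst, prod_dynFac, rowNorm_sites, ← Finset.prod_inv_distrib, ← Finset.prod_mul_distrib,
    ← Finset.prod_mul_distrib, mul_assoc ((-1) ^ N), mul_right_comm, h, ← Finset.prod_mul_distrib]
  congr 1
  refine Finset.prod_congr rfl fun j _ => ?_
  have h1 := p.sinh_row_ne hβ j
  have h2 := p.bMinus_eq_dynFac hς (p.sinh_bnd_ne hβ j) j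
  rw [show ∀ x y z : ℂ, x⁻¹ * -(y / z) * p.dynFac (β + 1 + N - 2 * ((j : ℕ) + 1)) =
    -(x⁻¹ * (y * p.dynFac (β + 1 + N - 2 * ((j : ℕ) + 1))) / z) from fun _ _ _ => by ring, ← h2]
  field_simp

theorem norm_identity (hη : sinh p.η ≠ 0) (hς : sinh p.ς ≠ 0)
    (hβ : ∀ m : ℤ, sinh (p.η * (β + m)) ≠ 0) (hgen : p.Generic)
    (hk : ∀ j : Fin N, sinh (2 * p.ξ j + p.η) ≠ 0 ∧ sinh (2 * p.ξ j - p.η) ≠ 0)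
    (g : ℂ → ℂ) (h : Conf N) :
    (p.rowNorm β (sites N))⁻¹ *
      (∏ j, if h j = 0 then (p.coefA g (p.η / 2 - p.ξ j))⁻¹ * p.rowFac p.ξ j (sites N)
        else (p.k j * p.coefA g (p.η / 2 - p.ξ j))⁻¹ * p.colFac p.ξ j (sites N)) *
      p.reflFac (p.signedξ h) β (sites N) =
    p.normConst g β * exp (2 * ∑ j, ((h j : ℕ) : ℂ) * p.ξ j) /
      vdm (fun j => p.xiShift j (h j)) := by
  have hc : (∏ j, ∏ n, if n < j then p.coefPair j n else 1) = pairProd fun i j => p.coefPair j i :=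
    Finset.prod_comm
  -- Passing from `-ξ_j` to `ξ_j` changes the sign of `sinh (2w)`, which the sign from `siteFac_eq`
  -- compensates, and multiplies `exp w` by `exp (2 ξ_j)`. This is the origin of the exponential in
  -- the claim.
  have hs : (∏ j, (if h j = 0 then -1 else 1) / g (p.η / 2 - p.ξ j)) *
      ∏ j : Fin N, p.kFac (p.signedξ h j) (β - N + 2 * (j : ℕ) + 1) =
      (∏ j, -(exp (-p.ξ j) * sinh (2 * p.ξ j) / g (p.η / 2 - p.ξ j))) *
        (∏ j : Fin N, p.dynFac (β - N + 2 * (j : ℕ) + 1)) *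
          exp (2 * ∑ j, ((h j : ℕ) : ℂ) * p.ξ j) := by
    rw [Finset.mul_sum, Complex.exp_sum, ← Finset.prod_mul_distrib, ← Finset.prod_mul_distrib,
      ← Finset.prod_mul_distrib]
    refine Finset.prod_congr rfl fun j _ => ?_
    rw [p.kFac_eq hς, signedξ]
    rcases Fin.exists_fin_two.mp ⟨h j, rfl⟩ with h0 | h0
    · rw [h0]
      simp only [if_true, mul_neg, sinh_neg, Fin.val_zero, Nat.cast_zero, zero_mul, mul_zero,
        exp_zero]
      ring
    · rw [h0]
      have : exp (p.ξ j) = exp (-p.ξ j) * exp (2 * p.ξ j) := by rw [← Complex.exp_add]; ring_nf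
      simp only [one_ne_zero, if_false, Fin.val_one, Nat.cast_one, one_mul]
      rw [this]
      ring
  simp only [p.siteFac_eq hη hk g h]
  rw [Finset.prod_mul_distrib, Finset.prod_mul_distrib, Finset.prod_mul_distrib,
    Finset.prod_inv_distrib, Finset.prod_inv_distrib, hc, reflFac_sites, p.normConst_eq hς hβ]
  have hq := p.vdm_quotient hgen h
  simp only [pairProd] at hq ⊢
  generalize (∏ j, (if h j = 0 then (-1 : ℂ) else 1) / g (p.η / 2 - p.ξ j)) = x1 at *
  generalize (∏ j : Fin N, p.kFac (p.signedξ h j) (β - N + 2 * (j : ℕ) + 1)) = x2 at *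
  linear_combination (p.rowNorm β (sites N))⁻¹ * x1 * x2 * hq +
    (p.rowNorm β (sites N))⁻¹ * (vdm p.ξ * (vdm (fun n => p.xiShift n 0) /
      vdm (fun n => p.xiShift n 1)) / vdm (fun j => p.xiShift j (h j))) * hs

theorem pairing_states (hη : sinh p.η ≠ 0) (hς : sinh p.ς ≠ 0)
    (hβ : ∀ m : ℤ, sinh (p.η * (β + m)) ≠ 0) (hgen : p.Generic)
    (hk : ∀ j : Fin N, sinh (2 * p.ξ j + p.η) ≠ 0 ∧ sinh (2 * p.ξ j - p.η) ≠ 0)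
    (g : ℂ → ℂ) (π ρ : Equiv.Perm (Fin N)) (h k : Conf N) :
    p.sovLeft g β π h ⬝ᵥ p.sovRight g β ρ k =
      if h = k then p.normConst g β * exp (2 * ∑ j, ((h j : ℕ) : ℂ) * p.ξ j) /
        vdm (fun j => p.xiShift j (h j)) else 0 := by
  have two : ∀ a : Fin 2, a = 0 ∨ a = 1 := by decide
  set ω₁ := (List.ofFn π).filter fun j => h j = 0 with hω₁
  -- The reversal lists the factors in the order in which they act on the reference state.
  set ω₂ := ((List.ofFn ρ).filter fun j => k j = 1).reverse with hω₂
  have hl : p.sovLeft g β π h = refUp N ᵥ* (ω₁.map fun j => (p.coefA g (p.η / 2 - p.ξ j))⁻¹ •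
      p.ASOS (p.η / 2 - p.ξ j) (β - 1)).prod := by
    have := prod_map_pow_eq_filter (fun j => (p.coefA g (p.η / 2 - p.ξ j))⁻¹ •
      p.ASOS (p.η / 2 - p.ξ j) (β - 1)) (fun j => 1 - (h j : ℕ))
      (fun j => by rcases two (h j) with e | e <;> simp [e]) (List.ofFn π)
    rw [List.map_ofFn] at this
    rw [sovLeft, hω₁]
    refine congrArg (refUp N ᵥ* ·) (this.trans ?_)
    congr 3
    funext j
    rcases two (h j) with e | e <;> simp [e]
  have hr : p.sovRight g β ρ k = (ω₂.reverse.map fun j =>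
      (p.k j * p.coefA g (p.η / 2 - p.ξ j))⁻¹ • p.DSOS (p.ξ j + p.η / 2) (β + 1)).prod *ᵥ
        refDown N := by
    have := prod_map_pow_eq_filter (fun j => (p.k j * p.coefA g (p.η / 2 - p.ξ j))⁻¹ •
      p.DSOS (p.ξ j + p.η / 2) (β + 1)) (fun j => (k j : ℕ))
      (fun j => by rcases two (k j) with e | e <;> simp [e]) (List.ofFn ρ)
    rw [List.map_ofFn] at this
    rw [sovRight, hω₂, List.reverse_reverse]
    refine congrArg (· *ᵥ refDown N) (this.trans ?_)
    congr 3
    funext j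
    rcases two (k j) with e | e <;> simp [e]
  have c1 : ∀ j, ω₁.count j = if h j = 0 then 1 else 0 := count_filter_ofFn π (h · = 0)
  have c2 : ∀ j, ω₂.count j = if k j = 1 then 1 else 0 := fun j => by
    rw [hω₂, List.count_reverse]
    exact count_filter_ofFn ρ (k · = 1) j
  -- Site `j` is reversed on the left if `h j = 0` and on the right if `k j = 1`; exactly one of
  -- these holds when the labels agree at `j`.
  have hodd : (∀ j, Odd (ω₁.count j + ω₂.count j)) ↔ h = k := by
    rw [funext_iff]
    refine forall_congr' fun j => ?_
    rw [c1, c2]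
    rcases two (h j) with e | e <;> rcases two (k j) with e' | e' <;> simp [e, e']
  obtain ⟨e, he, hp⟩ := p.pairing_words hβ (fun j => (p.coefA g (p.η / 2 - p.ξ j))⁻¹)
    (fun j => (p.k j * p.coefA g (p.η / 2 - p.ξ j))⁻¹) (nodup_filter_ofFn π (h · = 0))
    (List.nodup_reverse.mpr (nodup_filter_ofFn ρ (k · = 1)))
  rw [hl, hr, hp]
  simp only [← hω₁, ← hω₂, hodd]
  by_cases hhk : h = k
  · subst hhk
    have he1 : e = 1 := he fun j hj hj' => by simp_all
    have hy : flips p.ξ ω₁ = p.signedξ h := by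
      funext j
      rw [flips_apply, c1, signedξ]
      rcases two (h j) with e | e <;> simp [e]
    rw [if_pos rfl, if_pos rfl, he1, one_mul, hy, ← p.norm_identity hη hς hβ hgen hk g h]
    congr 1
    rw [mul_assoc, hω₁, hω₂, List.map_reverse, List.prod_reverse,
      prod_map_filter_ofFn π (h · = 0), prod_map_filter_ofFn ρ (h · = 1),
      ← Finset.prod_mul_distrib]
    congr 1
    refine Finset.prod_congr rfl fun j _ => ?_
    rcases two (h j) with e | e <;> simp [e]
  · simp [hhk]

theorem normConst_eq_pairing (hη : sinh p.η ≠ 0) (hς : sinh p.ς ≠ 0)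
    (hβ : ∀ m : ℤ, sinh (p.η * (β + m)) ≠ 0) (hgen : p.Generic)
    (hk : ∀ j : Fin N, sinh (2 * p.ξ j + p.η) ≠ 0 ∧ sinh (2 * p.ξ j - p.η) ≠ 0)
    (g : ℂ → ℂ) (π : Equiv.Perm (Fin N)) :
    p.normConst g β = vdm (fun j => p.xiShift j 0) *
      (p.sovLeft g β π (fun _ => 0) ⬝ᵥ refDown N) := by
  have h0 : p.sovRight g β 1 (fun _ => 0) = refDown N := by simp [sovRight]
  have := p.pairing_states hη hς hβ hgen hk g π 1 (fun _ => 0) (fun _ => 0)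
  rw [h0] at this
  rw [this]
  have hv := hgen.vdm_ne_zero fun _ => 0
  simp only [if_true, Fin.val_zero, Nat.cast_zero, zero_mul, Finset.sum_const_zero, mul_zero,
    exp_zero, mul_one]
  rw [mul_div_cancel₀ _ hv]

theorem dynFac_ne_zero_iff (hς : sinh p.ς ≠ 0) (hκ : p.κ ≠ 0) {αm βm : ℂ}
    (h₁ : sinh αm * cosh βm = sinh p.ς / (2 * p.κ))
    (h₂ : cosh αm * sinh βm = cosh p.ς / (2 * p.κ)) (b : ℂ) :
    p.dynFac b ≠ 0 ↔ sinh (p.η * (b - p.α) - p.τ) ≠ sinh (αm + βm) := by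
  -- By the addition formula the two boundary relations add up to `sinh ς + cosh ς`, so the zero of
  -- the bracket in `dynFac` is expressed by `αm + βm`.
  have h : sinh (αm + βm) = exp p.ς / (2 * p.κ) := by
    rw [sinh_add, h₁, h₂, ← cosh_add_sinh]; ring
  rw [h, dynFac, not_iff_not, div_eq_zero_iff, mul_eq_zero,
    or_iff_left hς, or_iff_right (exp_ne_zero _), sub_eq_zero, eq_div_iff (by simpa using hκ),
    mul_comm _ (2 * p.κ), eq_comm]

theorem normConst_ne_zero_iff (hς : sinh p.ς ≠ 0) (hκ : p.κ ≠ 0) {αm βm : ℂ}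
    (h₁ : sinh αm * cosh βm = sinh p.ς / (2 * p.κ))
    (h₂ : cosh αm * sinh βm = cosh p.ς / (2 * p.κ))
    (hβ : ∀ m : ℤ, sinh (p.η * (β + m)) ≠ 0) (hgen : p.Generic) {g : ℂ → ℂ}
    (hg₀ : ∀ j : Fin N, g (p.η / 2 - p.ξ j) ≠ 0) (h2ξ : ∀ j : Fin N, sinh (2 * p.ξ j) ≠ 0) :
    p.normConst g β ≠ 0 ↔
      ∀ j : Fin N, sinh (p.η * (β + 1 - p.α + N - 2 * ((j : ℕ) + 1)) - p.τ) ≠ sinh (αm + βm) := by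
  have hn : p.rowNorm β (sites N) ≠ 0 := by
    rw [rowNorm_sites]
    exact Finset.prod_ne_zero_iff.mpr fun j _ => mul_ne_zero two_ne_zero (p.sinh_row_ne hβ j)
  have hs : (∏ j, -(exp (-p.ξ j) * sinh (2 * p.ξ j) / g (p.η / 2 - p.ξ j))) ≠ 0 :=
    Finset.prod_ne_zero_iff.mpr fun j _ =>
      neg_ne_zero.mpr (div_ne_zero (mul_ne_zero (exp_ne_zero _) (h2ξ j)) (hg₀ j))
  have hv := mul_ne_zero hgen.vdm_ξ_ne_zero
    (div_ne_zero (hgen.vdm_ne_zero fun _ => 0) (hgen.vdm_ne_zero fun _ => 1))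
  rw [p.normConst_eq hς hβ, mul_ne_zero_iff_right hv, mul_ne_zero_iff_left
    (mul_ne_zero (inv_ne_zero hn) hs), prod_dynFac, Finset.prod_ne_zero_iff]
  simp only [Finset.mem_univ, true_implies, p.dynFac_ne_zero_iff hς hκ h₁ h₂]
  refine forall_congr' fun j => ?_
  rw [show β + 1 + N - 2 * ((j : ℕ) + 1) - p.α = β + 1 - p.α + N - 2 * ((j : ℕ) + 1) by ring]

end Chain

end
end XXZOpen

theorem mainTheorem6 {N : ℕ} (p : XXZOpen.Chain N) (β αm βm : ℂ) (g : ℂ → ℂ)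
    (hη : Complex.sinh p.η ≠ 0)
    (hς : Complex.sinh p.ς ≠ 0)
    (hκ : p.κ ≠ 0)
    (hαβ₁ : Complex.sinh αm * Complex.cosh βm = Complex.sinh p.ς / (2 * p.κ))
    (hαβ₂ : Complex.cosh αm * Complex.sinh βm = Complex.cosh p.ς / (2 * p.κ))
    (hβ : ∀ m : ℤ, Complex.sinh (p.η * (β + m)) ≠ 0)
    (hinh : ∀ j k : Fin N, j ≠ k → ∀ a b : Fin 2, ∀ m : ℤ,
      p.xiShift j a + p.xiShift k b ≠ m * (Real.pi * Complex.I) ∧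
      p.xiShift j a - p.xiShift k b ≠ m * (Real.pi * Complex.I))
    (hk : ∀ j : Fin N, Complex.sinh (2 * p.ξ j + p.η) ≠ 0 ∧ Complex.sinh (2 * p.ξ j - p.η) ≠ 0)
    (hg : ∀ j : Fin N, g (p.ξ j + p.η / 2) * g (-p.ξ j + p.η / 2) =
      -((Complex.sinh (p.ξ j) ^ 2 - Complex.sinh αm ^ 2) *
          (Complex.sinh (p.ξ j) ^ 2 + Complex.cosh βm ^ 2) /
        (Complex.sinh αm ^ 2 * Complex.cosh βm ^ 2)))
    (hg₀ : ∀ j : Fin N, g (p.η / 2 - p.ξ j) ≠ 0) :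
    (∀ π ρ : Equiv.Perm (Fin N), ∀ h k : XXZOpen.Conf N,
      p.sovLeft g β π h ⬝ᵥ p.sovRight g β ρ k =
        if h = k then
          p.normConst g β * Complex.exp (2 * ∑ j, ((h j : ℕ) : ℂ) * p.ξ j) /
            XXZOpen.vdm (fun j => p.xiShift j (h j))
        else 0) ∧
    (∀ π : Equiv.Perm (Fin N),
      p.normConst g β = XXZOpen.vdm (fun j => p.xiShift j 0) *
        (p.sovLeft g β π (fun _ => 0) ⬝ᵥ XXZOpen.refDown N)) ∧
    ((∀ j : Fin N, Complex.sinh (2 * p.ξ j) ≠ 0) →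
      (p.normConst g β ≠ 0 ↔
        ∀ j : Fin N, Complex.sinh (p.η * (β + 1 - p.α + N - 2 * ((j : ℕ) + 1)) - p.τ) ≠
          Complex.sinh (αm + βm))) := by
  have hgen : p.Generic := hinh
  refine ⟨fun π ρ h k => p.pairing_states hη hς hβ hgen hk g π ρ h k,
    fun π => p.normConst_eq_pairing hη hς hβ hgen hk g π,
    fun h2ξ => p.normConst_ne_zero_iff hς hκ hαβ₁ hαβ₂ hβ hgen hg₀ h2ξ⟩
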